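/- Fix $n\ge 1$, a delay bound $D_M\in\mathbb Z_{\ge 0}$, nonzero amplitudes $a_1,\dots,a_n\in\mathbb R$ and positive numbers $\alpha_0,k,\lambda,\omega_h,H_m,H_M,\Delta_Q,\sigma_0$ with $kH_m>\lambda$ and $\omega_h>2\lambda$. Write $|\cdot|$ for the Euclidean norm and $|x|_H^2=x^THx$. **The scheme.** Let $Q(\theta)=Q^*+\tfrac12|\theta-\theta^*|_H^2$ with unknown $\theta^*\in\mathbb R^n$, $Q^*\in\mathbb R$ and unknown symmetric $H$, $H_mI\le H\le H_MI$. For $\varepsilon>0$ put $T=\max\{nD_M\lfloor 1/\sqrt\varepsilon\rfloor,\,2n+1\}$, $\omega_i=2\pi i/T$, $S_i(j)=a_i\sin(\omega_ij)$, $M_i(j)=\frac2{a_i}\sin(\omega_ij)$ ($i=1,\dots,n$) and $\alpha(j)=\alpha_0(1-\varepsilon\lambda)^j$. Given $\theta(0)\in\mathbb R^n$, $Q_0\in\mathbb R$ and an unknown integer delay $0\le D(j)\le D_M$, the scheme is $$\hat\theta(j)=\theta(0)\ (0\le j\le D_M),\qquad \hat\theta(j+1)=\hat\theta(j)-\varepsilon\frac{kM(j)}{\alpha(j)}[y(j)-\eta(j)]\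 (j\ge D_M),$$ $$\eta(D_M)=Q_0,\qquad \eta(j+1)=\eta(j)+\varepsilon\omega_h[y(j)-\eta(j)]\ (j\ge D_M),$$ where $\theta(j)=\theta(0)$ for $0\le j\le D_M$, $\theta(j)=\hat\theta(j)+\alpha(j)S(j)$ for $j>D_M$, $y(j)=0$ for $j<D_M$ and $y(j)=Q(\theta(j-D(j)))$ for $j\ge D_M$. It is assumed that $|\theta(0)-\theta^*|\le\sigma_0$ and $|Q^*-Q_0|\le\Delta_Q$. The errors are $\tilde\theta(j)=\hat\theta(j)-\theta^*$ and $\tilde\eta(j)=\eta(j)-Q^*$. **The constants.** For $\sigma>\sigma_0$ and $0<\varepsilon^*<1$ with $\varepsilon^*\omega_h\ne1$ let $A=\sqrt{\sum_i a_i^2}$, $B=\sqrt{\sum_i a_i^{-2}}$, $\bar\lambda_*=|1-\varepsilon^*\lambda|$, $w_*=|1-\varepsilon^*\omega_h|$, $\kappa_*=|1-\varepsilon^*kH_m|$ and $$\bar\rho_1=0.19245\,nD_MkH_M\Big[\sum_{i}\tfrac1i+\sum_{i\ne l}\tfrac{|a_l|}{|a_i|}\Big(\tfrac1{|i-l|}+\tfrac1{i+l}\Big)\Big],\quad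 \bar\rho_2=0.3849\,nD_Mk\sum_i\tfrac1{i|a_i|},$$ $$\bar\rho_3=kH_MA^2\sqrt{\sum_i c_i^2/a_i^2},\quad \bar\rho_4=0.19245\,nD_Mk\sum_i\tfrac1{i|a_i|},$$ $$c_i=\frac{(nD_M+\sqrt{\varepsilon^*})(2nD_M+\sqrt{\varepsilon^*})}{12}+\frac{\sqrt{\varepsilon^*}(\sqrt{\varepsilon^*}+nD_M)+D_M^2n^2\big(1+\frac1{3.3072\pi i}\big)}{3.3072\pi i},$$ $$\sigma_y=\tfrac{H_M}2\bar\lambda_*^{-2D_M}(\sigma+\alpha_0A)^2,\qquad \sigma_\eta=\Delta_Qw_*^{-D_M}+\frac{\varepsilon^*\omega_h\sigma_y}{\bar\lambda_*^2-w_*},$$ $$\Delta_G=\bar\rho_1\sigma+\bar\rho_2\frac{\sigma_\eta}{\alpha_0}+\bar\rho_3\alpha_0+\bar\rho_4\frac{\sigma^2H_M}{\alpha_0},\qquad \Delta=\frac{2k}{\alpha_0}\Big[\tfrac{H_M}2(\sigma+\alpha_0A)^2+\sigma_\eta\Big]B,$$ $$\bar\Delta_{out}=\frac{kD_MH_M}{\alpha_0}B(\sigma+\alpha_0A)(1+\bar\lambda_*^{-D_M})\Big[\frac{2\sqrt{\varepsilon^*}k(\sigma_y+\sigma_\eta)}{\alpha_0}B+\frac{\alpha_0A}{\bar\lambda_*}\Big(\lambda\sqrt{\varepsilon^*}+\tfrac{2\pi}{(1-\sqrt{\varepsilon^*})D_M}\Big[\tfrac{\pi\sqrt{\varepsilon^*}}{(1-\sqrt{\varepsilon^*})D_M}+1\Big]\Big)\Big],$$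 and, with $\Delta'=\Delta+\sqrt{\varepsilon^*}\,\bar\Delta_{out}$, $$\Delta_Y=kH_M\Delta_G+\bar\rho_1\Delta'+\frac{\omega_h\bar\rho_2}{\alpha_0}(\sigma_y+\sigma_\eta)+\frac{\bar\rho_2\lambda(\sigma_\eta w_*+\varepsilon^*\omega_h\sigma_y)}{\alpha_0\bar\lambda_*}+\bar\rho_3\alpha_0\lambda+\frac{2\bar\rho_4\sigma H_M}{\alpha_0}\Delta'+\bar\Delta_{out}+\frac{\varepsilon^*\bar\rho_4H_M}{\alpha_0}\Delta'^2+\frac{\bar\rho_4\lambda H_M}{\alpha_0\bar\lambda_*}(\sigma+\varepsilon^*\Delta')^2.$$ **Conditions on $\varepsilon^*$.** $$\text{(a)}\ \ nD_M\Big\lfloor\frac1{\sqrt{\varepsilon^*}}\Big\rfloor\ge2n+1,\qquad\text{(b)}\ \ \varepsilon^*\max\{\lambda+kH_m,\ \omega_h+2\lambda-\varepsilon^*\lambda^2\}<2,$$ $$\text{(c)}\ \ (\sigma_0+\sqrt{\varepsilon^*}\Delta_G\bar\lambda_*^{D_M})\kappa_*^{-D_M}+\sqrt{\varepsilon^*}\Delta_G+\frac{(\sqrt{\varepsilon^*})^3\Delta_Y}{\bar\lambda_*-\kappa_*}<\sigma.$$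 **Theorem.** (1) Let $\sigma>\sigma_0$ and let $\varepsilon^*\in(0,1)$ with $\varepsilon^*\omega_h\neq 1$ satisfy (a)–(c). Then for every $\varepsilon\in(0,\varepsilon^*]$ one has $|1-\varepsilon\lambda|<1$, and for all $H,\theta^*,Q^*,Q_0,\theta(0)$ and delays $D$ as above, $$|\tilde\theta(j)|<\sigma|1-\varepsilon\lambda|^j,\qquad |\tilde\eta(j)|<\sigma_\eta|1-\varepsilon\lambda|^{2j}\qquad(j\ge D_M),$$ and $|\theta(j)-\theta^*|\le(\sigma+\alpha_0A)|1-\varepsilon\lambda|^j$ for all $j\ge0$; so $\theta(j)$ converges to $\theta^*$ exponentially and without bias. (2) If $D_M\ge1$, the conditions are always feasible: for all parameters as above (in particular for all sufficiently small $k,\lambda$ with $\lambda<kH_m$, $2\lambda<\omega_h$) and every $\sigma>\sigma_0$ there is $\varepsilon_0>0$ such that every $\varepsilon^*\in(0,\varepsilon_0]$ satisfies $\varepsilon^*<1$, $\varepsilon^*\omega_h\ne1$ and (a)–(c). -/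

import Mathlib

noncomputable section

namespace UnbiasedES

/-- The numerical data of the scheme in dimension `n`: the tuning parameters of the algorithm
and the known bounds on the uncertain quantities. Coordinates `1, …, n` are indexed by `Fin n`,
so the coordinate with index `i : Fin n` is the coordinate number `i + 1`. -/
structure Params (n : ℕ) where
  /-- known bound on the measurement delay -/
  DM : ℕ
  /-- dither amplitudes -/
  a : Fin n → ℝ
  /-- initial size of the decaying perturbation -/
  α₀ : ℝ
  /-- adaptation gain -/
  k : ℝ
  /-- parameter of the decay rate -/
  lam : ℝ
  /-- gain of the high-pass filter -/
  ωh : ℝ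
  /-- lower bound on the Hessian -/
  Hm : ℝ
  /-- upper bound on the Hessian -/
  HM : ℝ
  /-- bound on the uncertainty of the extremum value -/
  ΔQ : ℝ
  /-- bound on the initial estimation error -/
  σ₀ : ℝ

/-- Sign conditions on the parameters, together with `k Hm > lam` and `ωh > 2 lam`. -/
structure Params.Valid {n : ℕ} (P : Params n) : Prop where
  a_ne : ∀ i, P.a i ≠ 0
  α₀_pos : 0 < P.α₀
  k_pos : 0 < P.k
  lam_pos : 0 < P.lam
  ωh_pos : 0 < P.ωh
  Hm_pos : 0 < P.Hm
  HM_pos : 0 < P.HM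
  ΔQ_pos : 0 < P.ΔQ
  σ₀_pos : 0 < P.σ₀
  gain : P.lam < P.k * P.Hm
  filter : 2 * P.lam < P.ωh

variable {n : ℕ}

/-! ### The map, the dithers and the algorithm -/

/-- The weighted square `|x|_H² = xᵀ H x`. -/
def wsq (H : Matrix (Fin n) (Fin n) ℝ) (x : EuclideanSpace ℝ (Fin n)) : ℝ :=
  ∑ i, ∑ l, x i * H i l * x l

/-- The quadratic map `Q(θ) = Q* + |θ - θ*|_H² / 2`. -/
def quadMap (H : Matrix (Fin n) (Fin n) ℝ) (θs : EuclideanSpace ℝ (Fin n)) (Qs : ℝ)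
    (θ : EuclideanSpace ℝ (Fin n)) : ℝ :=
  Qs + 1 / 2 * wsq H (θ - θs)

/-- The common period `T = max {n DM ⌊1/√ε⌋, 2n + 1}` of the dithers. -/
def period (P : Params n) (ε : ℝ) : ℕ :=
  max (n * P.DM * ⌊1 / √ε⌋₊) (2 * n + 1)

/-- The dither frequencies `ω_i = 2πi/T`. -/
def freq (P : Params n) (ε : ℝ) (i : Fin n) : ℝ :=
  2 * Real.pi * ((i : ℝ) + 1) / (period P ε : ℝ)

/-- The perturbation `S_i(j) = a_i sin(ω_i j)`. -/
def pert (P : Params n) (ε : ℝ) (j : ℕ) : EuclideanSpace ℝ (Fin n) :=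
  WithLp.toLp 2 fun i => P.a i * Real.sin (freq P ε i * j)

/-- The demodulation `M_i(j) = (2/a_i) sin(ω_i j)`. -/
def demod (P : Params n) (ε : ℝ) (j : ℕ) : EuclideanSpace ℝ (Fin n) :=
  WithLp.toLp 2 fun i => 2 / P.a i * Real.sin (freq P ε i * j)

/-- The decaying factor `α(j) = α₀ (1 - ε lam)^j`. -/
def alpha (P : Params n) (ε : ℝ) (j : ℕ) : ℝ :=
  P.α₀ * (1 - ε * P.lam) ^ j

/-- The input `θ(j)` applied to the map, given the initial input `θ0` and the estimate `θh`. -/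
def input (P : Params n) (ε : ℝ) (θ0 : EuclideanSpace ℝ (Fin n))
    (θh : ℕ → EuclideanSpace ℝ (Fin n)) (j : ℕ) : EuclideanSpace ℝ (Fin n) :=
  if j ≤ P.DM then θ0 else θh j + alpha P ε j • pert P ε j

/-- The delayed measurement: `y(j) = 0` for `j < DM` and `y(j) = Q(θ(j - D(j)))` for `j ≥ DM`.
(As `D(j) ≤ DM` for the delays considered, the subtraction does not truncate.) -/
def meas (P : Params n) (ε : ℝ) (Q : EuclideanSpace ℝ (Fin n) → ℝ) (D : ℕ → ℕ)
    (θ0 : EuclideanSpace ℝ (Fin n)) (θh : ℕ → EuclideanSpace ℝ (Fin n)) (j : ℕ) : ℝ :=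
  if j < P.DM then 0 else Q (input P ε θ0 θh (j - D j))

/-- `(θh, η)` is the solution of the unbiased extremum seeking algorithm for the map `Q`, the
delay `D`, the initial input `θ0` and the initial filter state `Q0`. -/
structure IsESSolution (P : Params n) (ε : ℝ) (Q : EuclideanSpace ℝ (Fin n) → ℝ) (D : ℕ → ℕ)
    (θ0 : EuclideanSpace ℝ (Fin n)) (Q0 : ℝ)
    (θh : ℕ → EuclideanSpace ℝ (Fin n)) (η : ℕ → ℝ) : Prop where
  est_init : ∀ j, j ≤ P.DM → θh j = θ0
  est_step : ∀ j, P.DM ≤ j →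
    θh (j + 1) = θh j -
      (ε * (P.k / alpha P ε j) * (meas P ε Q D θ0 θh j - η j)) • demod P ε j
  filter_init : η P.DM = Q0
  filter_step : ∀ j, P.DM ≤ j →
    η (j + 1) = η j + ε * P.ωh * (meas P ε Q D θ0 θh j - η j)

/-! ### The explicit constants; `e` stands for `ε*` -/

/-- `√(∑ a_i²)` -/
def ampNorm (P : Params n) : ℝ := √(∑ i, P.a i ^ 2)

/-- `√(∑ 1/a_i²)` -/
def invAmpNorm (P : Params n) : ℝ := √(∑ i, 1 / P.a i ^ 2)

def rho1 (P : Params n) : ℝ :=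
  0.19245 * n * P.DM * P.k * P.HM *
    ((∑ i : Fin n, 1 / ((i : ℝ) + 1)) +
      ∑ i : Fin n, ∑ l ∈ Finset.univ.filter (fun l : Fin n => l ≠ i),
        |P.a l| / |P.a i| *
          (1 / |((i : ℝ) + 1) - ((l : ℝ) + 1)| + 1 / (((i : ℝ) + 1) + ((l : ℝ) + 1))))

def rho2 (P : Params n) : ℝ :=
  0.3849 * n * P.DM * P.k * ∑ i : Fin n, 1 / (((i : ℝ) + 1) * |P.a i|)

def cCoef (P : Params n) (e : ℝ) (i : Fin n) : ℝ :=
  (n * P.DM + √e) * (2 * n * P.DM + √e) / 12 +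
    (√e * (√e + n * P.DM) +
        (P.DM : ℝ) ^ 2 * (n : ℝ) ^ 2 * (1 + 1 / (3.3072 * Real.pi * ((i : ℝ) + 1)))) /
      (3.3072 * Real.pi * ((i : ℝ) + 1))

def rho3 (P : Params n) (e : ℝ) : ℝ :=
  P.k * P.HM * (∑ s, P.a s ^ 2) * √(∑ i, cCoef P e i ^ 2 / P.a i ^ 2)

def rho4 (P : Params n) : ℝ :=
  0.19245 * n * P.DM * P.k * ∑ i : Fin n, 1 / (((i : ℝ) + 1) * |P.a i|)

def sigmaY (P : Params n) (σ e : ℝ) : ℝ :=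
  P.HM / 2 * (|1 - e * P.lam| ^ (2 * P.DM))⁻¹ * (σ + P.α₀ * ampNorm P) ^ 2

def sigmaEta (P : Params n) (σ e : ℝ) : ℝ :=
  P.ΔQ * (|1 - e * P.ωh| ^ P.DM)⁻¹ +
    e * P.ωh * sigmaY P σ e / (|1 - e * P.lam| ^ 2 - |1 - e * P.ωh|)

def deltaG (P : Params n) (σ e : ℝ) : ℝ :=
  rho1 P * σ + rho2 P * (sigmaEta P σ e / P.α₀) + rho3 P e * P.α₀ +
    rho4 P * (σ ^ 2 * P.HM / P.α₀)

def delta (P : Params n) (σ e : ℝ) : ℝ :=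
  2 * P.k / P.α₀ * (P.HM / 2 * (σ + P.α₀ * ampNorm P) ^ 2 + sigmaEta P σ e) * invAmpNorm P

def deltaOut (P : Params n) (σ e : ℝ) : ℝ :=
  P.k * P.DM * P.HM / P.α₀ * invAmpNorm P * (σ + P.α₀ * ampNorm P) *
    (1 + (|1 - e * P.lam| ^ P.DM)⁻¹) *
    (2 * √e * P.k * (sigmaY P σ e + sigmaEta P σ e) / P.α₀ * invAmpNorm P +
      P.α₀ * ampNorm P *
          (P.lam * √e +
            2 * Real.pi / ((1 - √e) * P.DM) * (Real.pi * √e / ((1 - √e) * P.DM) + 1)) /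
        |1 - e * P.lam|)

def deltaY (P : Params n) (σ e : ℝ) : ℝ :=
  P.k * P.HM * deltaG P σ e +
    rho1 P * (delta P σ e + √e * deltaOut P σ e) +
    P.ωh * rho2 P / P.α₀ * (sigmaY P σ e + sigmaEta P σ e) +
    rho2 P * P.lam * (sigmaEta P σ e * |1 - e * P.ωh| + e * P.ωh * sigmaY P σ e) /
      (P.α₀ * |1 - e * P.lam|) +
    rho3 P e * P.α₀ * P.lam +
    2 * rho4 P * σ * P.α₀⁻¹ * P.HM * (delta P σ e + √e * deltaOut P σ e) +
    deltaOut P σ e +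
    e * rho4 P * P.α₀⁻¹ * P.HM * (delta P σ e + √e * deltaOut P σ e) ^ 2 +
    rho4 P * P.α₀⁻¹ * P.lam / |1 - e * P.lam| * P.HM *
      (σ + e * (delta P σ e + √e * deltaOut P σ e)) ^ 2

/-- The explicit conditions on `e = ε*`. The fields `lt_one` and `ne_zero` only say that the
quantities `1/(1 - √e)` and `|1 - e ωh|^(-DM)` in the constants are finite. -/
structure Conditions (P : Params n) (σ e : ℝ) : Prop where
  pos : 0 < e
  lt_one : e < 1
  ne_zero : 1 - e * P.ωh ≠ 0
  cond_a : 2 * n + 1 ≤ n * P.DM * ⌊1 / √e⌋₊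
  cond_b : e * max (P.lam + P.k * P.Hm) (P.ωh + 2 * P.lam - e * P.lam ^ 2) < 2
  cond_c :
    (P.σ₀ + √e * deltaG P σ e * |1 - e * P.lam| ^ P.DM) * (|1 - e * P.k * P.Hm| ^ P.DM)⁻¹ +
      √e * deltaG P σ e +
      √e ^ 3 * deltaY P σ e / (|1 - e * P.lam| - |1 - e * P.k * P.Hm|) < σ

end UnbiasedES

end

/-! The scheme is a slow recursion with step ε, driven by dithers whose period T is of order 1/√ε,
and the proof is averaging with an exact change of variables. Put x = θ̂ - θ* and μ = 1 - ελ. Apart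
from the delay, y - η = α(g + ⟨S, Hx⟩ + (α/2)|S|_H²) with the slow factor g = (|x|_H²/2 - η̃)/α.
After multiplication by M the middle term averages to Hx, while M and |S|_H² M have mean zero.
Antiderivatives of M, of M Sᵀ - I and of |S|_H² M/2 (`demodPrim`, `corrMatrix`, `cubicPrim`) are
O(T), so εk times them is O(√ε). Adding them to x gives the `corrected` error z, and summation by
parts (`correction_identity`, `corrected_succ`) yields z(j+1) = (I - εkH)z(j) + O(ε√ε)μ^j
(`norm_corrected_succ_le`). As I - εkH contracts by κ = 1 - εkH_m < μ, z decays like μ^j. The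
division by the decaying α is harmless because y - η is quadratic in the error and decays like
μ^(2j); hence no bias remains.

The bounds on x, η̃ and z are proved together by induction (`invariant`). Passing from z back to x
at the new time is implicit, since the correction contains the new x; `le_of_le_corrBound` resolves
this.

Three points make the explicit constants work. (i) Condition (c) forces ε* to be small: it implies
√ε* Δ_Y < σ(kH_m - λ) (`sqrt_mul_deltaY_lt`), and bounding single terms of Δ_Y from below gives √ε*
≤ 2/27 and bounds on ε* times the gains. This numerical room absorbs all losses from delays and
decay. (ii) The constants are evaluated at ε*, but the filter gain is larger for ε < ε*. The error
bound `sigmaAt` is then smaller by a multiple of √ε* - √ε, which compensates (`filter_bound_le`).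
(iii) Up to time 2D_M the delayed input may still be θ(0), which doubles the delay error. A sharper
bound on z over this short window removes the factor 2 (`decay_pow_le_two_mul`).

For feasibility, the constants extend continuously to ε* = 0, where (c) becomes σ₀ < σ. -/

noncomputable section

namespace UnbiasedES

open Finset

variable {n : ℕ}

local notation "⟪" x ", " y "⟫" => inner ℝ x y

/-! ### The Hessian as a symmetric operator -/


/-- The linear operator `x ↦ H x` on Euclidean space. -/
def hess (H : Matrix (Fin n) (Fin n) ℝ) :
    EuclideanSpace ℝ (Fin n) →ₗ[ℝ] EuclideanSpace ℝ (Fin n) :=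
  Matrix.toLpLin 2 2 H

lemma hess_apply (H : Matrix (Fin n) (Fin n) ℝ) (x : EuclideanSpace ℝ (Fin n)) (i : Fin n) :
    hess H x i = ∑ l, H i l * x l := rfl

lemma inner_eq_sum (x y : EuclideanSpace ℝ (Fin n)) : ⟪x, y⟫ = ∑ i, x i * y i := by
  rw [PiLp.inner_apply]
  exact sum_congr rfl fun i _ => by simp [mul_comm]

lemma inner_hess (H : Matrix (Fin n) (Fin n) ℝ) (x y : EuclideanSpace ℝ (Fin n)) :
    ⟪x, hess H y⟫ = ∑ i, ∑ l, x i * H i l * y l := by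
  simp only [inner_eq_sum, hess_apply, mul_sum, mul_assoc]

lemma wsq_eq_inner (H : Matrix (Fin n) (Fin n) ℝ) (x : EuclideanSpace ℝ (Fin n)) :
    wsq H x = ⟪x, hess H x⟫ := (inner_hess H x x).symm

/-- A symmetric operator whose quadratic form lies between `m|x|²` and `M|x|²`. -/
structure FormBetween {E : Type*} [NormedAddCommGroup E] [InnerProductSpace ℝ E]
    (L : E →ₗ[ℝ] E) (m M : ℝ) : Prop where
  symm : ∀ x y, ⟪L x, y⟫ = ⟪x, L y⟫
  lower : ∀ x, m * ‖x‖ ^ 2 ≤ ⟪x, L x⟫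
  upper : ∀ x, ⟪x, L x⟫ ≤ M * ‖x‖ ^ 2

lemma inner_hess_smul_one (c : ℝ) (x : EuclideanSpace ℝ (Fin n)) :
    ⟪x, hess (c • (1 : Matrix (Fin n) (Fin n) ℝ)) x⟫ = c * ‖x‖ ^ 2 := by
  rw [hess, map_smul, LinearMap.smul_apply, inner_smul_right, Matrix.toLpLin_one,
    LinearMap.id_apply, real_inner_self_eq_norm_sq]

lemma inner_hess_nonneg {H : Matrix (Fin n) (Fin n) ℝ} (hH : H.PosSemidef)
    (x : EuclideanSpace ℝ (Fin n)) : 0 ≤ ⟪x, hess H x⟫ := by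
  have := hH.dotProduct_mulVec_nonneg x.ofLp
  rw [inner_hess]
  simpa [dotProduct, Matrix.mulVec, mul_sum, mul_assoc] using this

lemma formBetween_hess {H : Matrix (Fin n) (Fin n) ℝ} {m M : ℝ}
    (h1 : (H - m • (1 : Matrix (Fin n) (Fin n) ℝ)).PosSemidef)
    (h2 : (M • (1 : Matrix (Fin n) (Fin n) ℝ) - H).PosSemidef) : FormBetween (hess H) m M := by
  have hs : ∀ i l, H i l = H l i := by
    intro i l
    have := h1.1.apply i l
    simp only [Matrix.sub_apply, Matrix.smul_apply, star_trivial, Matrix.one_apply] at this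
    rcases eq_or_ne i l with rfl | h
    · rfl
    · simpa [h, h.symm] using this.symm
  refine ⟨fun x y => ?_, fun x => ?_, fun x => ?_⟩
  · rw [real_inner_comm, inner_hess, inner_hess, sum_comm]
    refine sum_congr rfl fun i _ => sum_congr rfl fun l _ => ?_
    rw [hs l i]; ring
  · have := inner_hess_nonneg h1 x
    rw [hess, map_sub, LinearMap.sub_apply, inner_sub_right] at this
    have h := inner_hess_smul_one m x
    rw [hess] at h ⊢
    linarith
  · have := inner_hess_nonneg h2 x
    rw [hess, map_sub, LinearMap.sub_apply, inner_sub_right] at this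
    have h := inner_hess_smul_one M x
    rw [hess] at h ⊢
    linarith

section Form

variable {E : Type*} [NormedAddCommGroup E] [InnerProductSpace ℝ E] {L : E →ₗ[ℝ] E} {m M : ℝ}

/-- Nonnegativity of the form at the gradient step x - M⁻¹Lx already gives ‖Lx‖² ≤ M⟨x, Lx⟩, so no
spectral decomposition is needed. -/
lemma FormBetween.norm_le_of_nonneg (h : FormBetween L 0 M) (hM : 0 < M) (x : E) :
    ‖L x‖ ≤ M * ‖x‖ := by
  have h1 := h.lower (x - M⁻¹ • L x)
  have h2 := h.upper (L x)
  have h3 := h.upper x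
  have e1 : ⟪x - M⁻¹ • L x, L (x - M⁻¹ • L x)⟫ =
      ⟪x, L x⟫ - 2 * M⁻¹ * ‖L x‖ ^ 2 + M⁻¹ ^ 2 * ⟪L x, L (L x)⟫ := by
    simp only [map_sub, map_smul, inner_sub_left, inner_sub_right, inner_smul_left,
      inner_smul_right, ← h.symm x (L x), real_inner_self_eq_norm_sq, conj_trivial]
    ring
  rw [e1] at h1
  have h4 : M⁻¹ ^ 2 * ⟪L x, L (L x)⟫ ≤ M⁻¹ ^ 2 * (M * ‖L x‖ ^ 2) := by gcongr
  have e2 : M⁻¹ ^ 2 * (M * ‖L x‖ ^ 2) = M⁻¹ * ‖L x‖ ^ 2 := by field_simp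
  have h5 : M⁻¹ * ‖L x‖ ^ 2 ≤ M * ‖x‖ ^ 2 := by linarith
  have h6 : ‖L x‖ ^ 2 ≤ (M * ‖x‖) ^ 2 := by
    rw [inv_mul_le_iff₀ hM] at h5
    nlinarith
  exact (abs_le_of_sq_le_sq' h6 (by positivity)).2

lemma FormBetween.norm_le (h : FormBetween L m M) (hm : 0 < m) (hM : 0 < M) (x : E) :
    ‖L x‖ ≤ M * ‖x‖ :=
  FormBetween.norm_le_of_nonneg ⟨h.symm, fun x => by
    have := h.lower x
    have : 0 ≤ m * ‖x‖ ^ 2 := by positivity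
    linarith, h.upper⟩ hM x

/-- The operator id - tL is symmetric with form between 0 and 1 - tm. With t = εk this is the
contraction that drives the convergence. -/
lemma FormBetween.norm_sub_smul_le (h : FormBetween L m M) {t : ℝ} (ht : 0 ≤ t)
    (hm : 0 < 1 - t * m) (hM : 0 ≤ 1 - t * M) (x : E) :
    ‖x - t • L x‖ ≤ (1 - t * m) * ‖x‖ := by
  refine FormBetween.norm_le_of_nonneg (L := LinearMap.id - t • L) ⟨?_, ?_, ?_⟩ hm x
  · intro x y
    simp [inner_sub_left, inner_sub_right, inner_smul_left, inner_smul_right, h.symm]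
  · intro x
    have := mul_le_mul_of_nonneg_left (h.upper x) ht
    have : 0 ≤ (1 - t * M) * ‖x‖ ^ 2 := by positivity
    simp only [LinearMap.sub_apply, LinearMap.id_apply, LinearMap.smul_apply, inner_sub_right,
      inner_smul_right, real_inner_self_eq_norm_sq]
    linarith
  · intro x
    have := mul_le_mul_of_nonneg_left (h.lower x) ht
    simp only [LinearMap.sub_apply, LinearMap.id_apply, LinearMap.smul_apply, inner_sub_right,
      inner_smul_right, real_inner_self_eq_norm_sq]
    linarith

lemma FormBetween.form_nonneg (h : FormBetween L m M) (hm : 0 < m) (x : E) : 0 ≤ ⟪x, L x⟫ :=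
  le_trans (by positivity) (h.lower x)

lemma FormBetween.abs_form_sub_le (h : FormBetween L m M) (hm : 0 < m) (hM : 0 < M) (x y : E) :
    |⟪x, L x⟫ - ⟪y, L y⟫| ≤ M * ‖x - y‖ * (‖x‖ + ‖y‖) := by
  have e : ⟪x, L x⟫ - ⟪y, L y⟫ = ⟪x - y, L (x + y)⟫ := by
    have := h.symm x y
    simp only [map_add, inner_add_right, inner_sub_left]
    rw [← h.symm x y, real_inner_comm (L x) y]
    ring
  rw [e]
  calc |⟪x - y, L (x + y)⟫| ≤ ‖x - y‖ * ‖L (x + y)‖ := abs_real_inner_le_norm _ _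
    _ ≤ ‖x - y‖ * (M * (‖x‖ + ‖y‖)) := by
        gcongr
        exact (h.norm_le hm hM _).trans (by gcongr; exact norm_add_le _ _)
    _ = _ := by ring

end Form

/-! ### Discrete antiderivatives of trigonometric sequences -/

/-- A discrete antiderivative of `j ↦ sin (ω j)`. -/
def sinPrim (ω : ℝ) (j : ℕ) : ℝ := -Real.cos (ω * (j - 1 / 2)) / (2 * Real.sin (ω / 2))

/-- A discrete antiderivative of `j ↦ cos (ω j)`. -/
def cosPrim (ω : ℝ) (j : ℕ) : ℝ := Real.sin (ω * (j - 1 / 2)) / (2 * Real.sin (ω / 2))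

lemma sinPrim_succ_sub {ω : ℝ} (h : Real.sin (ω / 2) ≠ 0) (j : ℕ) :
    sinPrim ω (j + 1) - sinPrim ω j = Real.sin (ω * j) := by
  have e1 : ω * (((j + 1 : ℕ) : ℝ) - 1 / 2) = ω * j + ω / 2 := by push_cast; ring
  have e2 : ω * ((j : ℝ) - 1 / 2) = ω * j - ω / 2 := by ring
  rw [sinPrim, sinPrim, e1, e2, Real.cos_add, Real.cos_sub]
  field_simp
  ring

lemma cosPrim_succ_sub {ω : ℝ} (h : Real.sin (ω / 2) ≠ 0) (j : ℕ) :
    cosPrim ω (j + 1) - cosPrim ω j = Real.cos (ω * j) := by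
  have e1 : ω * (((j + 1 : ℕ) : ℝ) - 1 / 2) = ω * j + ω / 2 := by push_cast; ring
  have e2 : ω * ((j : ℝ) - 1 / 2) = ω * j - ω / 2 := by ring
  rw [cosPrim, cosPrim, e1, e2, Real.sin_add, Real.sin_sub]
  field_simp
  ring

/-- The hypothesis gives πm/T ≤ 0.485, where sin x ≥ 0.96x, and 1/(2 · 0.96 · 3.14) < 0.17. The
constants of the theorem allow 0.19245 here; in ρ₂ the difference becomes the factor 0.9 of
`demodPrim_bound`. -/
lemma inv_two_mul_sin_le {m T : ℝ} (hm : 0 < m) (hT : 13 * m ≤ 2 * T) :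
    0 < Real.sin (Real.pi * m / T) ∧
      1 / (2 * Real.sin (Real.pi * m / T)) ≤ 17 / 100 * T / m := by
  have hT0 : 0 < T := by linarith
  set x := Real.pi * m / T with hx
  have hx0 : 0 < x := by positivity
  have hq : m / T ≤ 2 / 13 := by rw [div_le_iff₀ hT0]; linarith
  have hx1 : x ≤ 0.485 := by
    have : x = Real.pi * (m / T) := by rw [hx]; ring
    rw [this]
    have h1 := Real.pi_lt_d2
    have h2 : 0 < m / T := by positivity
    nlinarith [Real.pi_pos]
  have hs := Real.sin_gt_sub_cube hx0
  have h3 : 0.96 * x ≤ Real.sin x := by nlinarith [mul_pos hx0 hx0]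
  have hsx : 0 < Real.sin x := by linarith [mul_pos (by norm_num : (0 : ℝ) < 0.96) hx0]
  refine ⟨hsx, ?_⟩
  have hxm : 3.14 * m / T ≤ x := by
    rw [hx]; gcongr; exact Real.pi_gt_d2.le
  have h4 : 0.96 * (3.14 * m / T) ≤ Real.sin x := by linarith
  rw [div_le_div_iff₀ (by positivity) hm]
  have h5 : 0.96 * 3.14 * m ≤ Real.sin x * T := by
    have := mul_le_mul_of_nonneg_right h4 hT0.le
    have e : 0.96 * (3.14 * m / T) * T = 0.96 * 3.14 * m := by field_simp
    linarith
  nlinarith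

lemma sin_half_freq_ne_zero {m T : ℝ} (hm : m ≠ 0) (hT : 13 * |m| ≤ 2 * T) :
    Real.sin (2 * Real.pi * m / T / 2) ≠ 0 := by
  have e : 2 * Real.pi * m / T / 2 = Real.pi * m / T := by ring
  rw [e]
  rcases lt_or_gt_of_ne hm with h | h
  · rw [abs_of_neg h] at hT
    have := (inv_two_mul_sin_le (neg_pos.2 h) hT).1
    rw [mul_neg, neg_div, Real.sin_neg] at this
    linarith
  · rw [abs_of_pos h] at hT
    exact (inv_two_mul_sin_le h hT).1.ne'

lemma inv_two_mul_abs_sin_le {m T : ℝ} (hm : m ≠ 0) (hT : 13 * |m| ≤ 2 * T) :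
    1 / (2 * |Real.sin (2 * Real.pi * m / T / 2)|) ≤ 17 / 100 * T / |m| := by
  have e : 2 * Real.pi * m / T / 2 = Real.pi * m / T := by ring
  rw [e]
  rcases lt_or_gt_of_ne hm with h | h
  · rw [abs_of_neg h] at hT ⊢
    have := inv_two_mul_sin_le (neg_pos.2 h) hT
    rw [mul_neg, neg_div, Real.sin_neg] at this
    rw [abs_of_neg (by linarith [this.1])]
    exact this.2
  · rw [abs_of_pos h] at hT ⊢
    have := inv_two_mul_sin_le h hT
    rw [abs_of_pos this.1]
    exact this.2

lemma abs_sinPrim_le {m T : ℝ} (hm : m ≠ 0) (hT : 13 * |m| ≤ 2 * T) (j : ℕ) :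
    |sinPrim (2 * Real.pi * m / T) j| ≤ 17 / 100 * T / |m| := by
  refine le_trans ?_ (inv_two_mul_abs_sin_le hm hT)
  rw [sinPrim, abs_div, abs_neg, abs_mul, abs_two]
  gcongr
  exact Real.abs_cos_le_one _

lemma abs_cosPrim_le {m T : ℝ} (hm : m ≠ 0) (hT : 13 * |m| ≤ 2 * T) (j : ℕ) :
    |cosPrim (2 * Real.pi * m / T) j| ≤ 17 / 100 * T / |m| := by
  refine le_trans ?_ (inv_two_mul_abs_sin_le hm hT)
  rw [cosPrim, abs_div, abs_mul, abs_two]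
  gcongr
  exact Real.abs_sin_le_one _

/-! ### Antiderivatives of periodic sequences with zero mean -/

/-- The centred antiderivative of a `T`-periodic sequence with zero mean. -/
def meanPrim (T : ℕ) (f : ℕ → ℝ) (j : ℕ) : ℝ :=
  (1 / T) * ∑ s ∈ range T, ((s : ℝ) - (T - 1) / 2) * f (j + s)

lemma sum_range_add_of_periodic {T : ℕ} {f : ℕ → ℝ} (hf : ∀ j, f (j + T) = f j) (j : ℕ) :
    ∑ s ∈ range T, f (j + s) = ∑ s ∈ range T, f s := by
  induction j with
  | zero => simp
  | succ j ih =>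
    rw [← ih]
    have h1 := sum_range_succ' (fun s => f (j + s)) T
    have h2 := sum_range_succ (fun s => f (j + s)) T
    rw [h1, hf] at h2
    simp only [add_zero, add_left_inj] at h2
    rw [← h2]
    exact sum_congr rfl fun s _ => by congr 1; ring

/-- Shifting the window lowers every weight by 1 and leaves an end term T f(j). The lowered weights
contribute the sum of f over one period, which vanishes. -/
lemma meanPrim_succ_sub {T : ℕ} (hT : 0 < T) {f : ℕ → ℝ} (hf : ∀ j, f (j + T) = f j)
    (h0 : ∑ s ∈ range T, f s = 0) (j : ℕ) :
    meanPrim T f (j + 1) - meanPrim T f j = f j := by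
  have hT' : (T : ℝ) ≠ 0 := by positivity
  set c : ℝ := -((T - 1) / 2) with hc
  set a : ℕ → ℝ := fun s => ((s : ℝ) - 1 + c) * f (j + s) with ha
  have h1 := sum_range_succ' a T
  rw [sum_range_succ a T] at h1
  have e1 : ∑ s ∈ range T, ((s : ℝ) - (T - 1) / 2) * f (j + 1 + s) = ∑ s ∈ range T, a (s + 1) := by
    refine sum_congr rfl fun s _ => ?_
    simp only [ha]
    rw [show j + 1 + s = j + (s + 1) by ring]
    push_cast
    rw [hc]; ring
  have e2 : ∑ s ∈ range T, ((s : ℝ) - (T - 1) / 2) * f (j + s) = ∑ s ∈ range T, a s := by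
    have h2 : ∑ s ∈ range T, ((s : ℝ) - (T - 1) / 2) * f (j + s) - ∑ s ∈ range T, a s =
        ∑ s ∈ range T, f (j + s) := by
      rw [← sum_sub_distrib]
      refine sum_congr rfl fun s _ => ?_
      simp only [ha, hc]; ring
    rw [sum_range_add_of_periodic hf, h0] at h2
    linarith
  have e3 : a T - a 0 = T * f j := by
    simp only [ha, hf, add_zero]; push_cast; ring
  rw [meanPrim, meanPrim, e1, e2]
  have : ∑ s ∈ range T, a (s + 1) = ∑ s ∈ range T, a s + T * f j := by linarith
  rw [this]
  field_simp
  ring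

/-- Passing from T to T + 2 adds two end terms T + 1 and keeps the centred middle, hence the
induction in steps of two. -/
lemma sum_abs_centred_le (T : ℕ) : ∑ s ∈ range T, |2 * (s : ℝ) - (T - 1)| ≤ (T : ℝ) ^ 2 / 2 := by
  induction T using Nat.twoStepInduction with
  | zero => simp
  | one => simp
  | more T ih _ =>
    rw [sum_range_succ, sum_range_succ']
    have e : ∑ s ∈ range T, |2 * ((s + 1 : ℕ) : ℝ) - (((T + 2 : ℕ) : ℝ) - 1)| =
        ∑ s ∈ range T, |2 * (s : ℝ) - (T - 1)| := by
      refine sum_congr rfl fun s _ => ?_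
      congr 1; push_cast; ring
    rw [e]
    have hT : (0 : ℝ) ≤ T := by positivity
    have h1 : |2 * ((0 : ℕ) : ℝ) - (((T + 2 : ℕ) : ℝ) - 1)| = T + 1 := by
      rw [show 2 * ((0 : ℕ) : ℝ) - (((T + 2 : ℕ) : ℝ) - 1) = -((T : ℝ) + 1) by push_cast; ring,
        abs_neg, abs_of_nonneg (by linarith)]
    have h2 : |2 * ((T + 1 : ℕ) : ℝ) - (((T + 2 : ℕ) : ℝ) - 1)| = T + 1 := by
      rw [show 2 * ((T + 1 : ℕ) : ℝ) - (((T + 2 : ℕ) : ℝ) - 1) = ((T : ℝ) + 1) by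
        push_cast; ring, abs_of_nonneg (by linarith)]
    rw [h1, h2]
    push_cast
    nlinarith

lemma abs_meanPrim_le {T : ℕ} (hT : 0 < T) {f : ℕ → ℝ} {F : ℝ} (hf : ∀ j, |f j| ≤ F) (j : ℕ) :
    |meanPrim T f j| ≤ T / 4 * F := by
  have hT' : (0 : ℝ) < T := by positivity
  have hF : 0 ≤ F := (abs_nonneg _).trans (hf 0)
  have h1 : |∑ s ∈ range T, ((s : ℝ) - (T - 1) / 2) * f (j + s)| ≤ (T : ℝ) ^ 2 / 4 * F := by
    calc _ ≤ ∑ s ∈ range T, |((s : ℝ) - (T - 1) / 2) * f (j + s)| := abs_sum_le_sum_abs _ _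
      _ ≤ ∑ s ∈ range T, (1 / 2 * |2 * (s : ℝ) - (T - 1)|) * F := by
          refine sum_le_sum fun s _ => ?_
          rw [abs_mul, show (s : ℝ) - (T - 1) / 2 = 1 / 2 * (2 * (s : ℝ) - (T - 1)) by ring,
            abs_mul,
            abs_of_pos (by norm_num : (0 : ℝ) < 1 / 2)]
          gcongr
          exact hf _
      _ = 1 / 2 * (∑ s ∈ range T, |2 * (s : ℝ) - (T - 1)|) * F := by
          rw [← sum_mul, ← mul_sum]
      _ ≤ 1 / 2 * ((T : ℝ) ^ 2 / 2) * F := by gcongr; exact sum_abs_centred_le T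
      _ = _ := by ring
  rw [meanPrim, abs_mul, abs_of_pos (by positivity)]
  calc 1 / (T : ℝ) * _ ≤ 1 / (T : ℝ) * ((T : ℝ) ^ 2 / 4 * F) := by gcongr
    _ = _ := by field_simp

lemma sum_range_eq_zero_of_odd {T : ℕ} {f : ℕ → ℝ} (h0 : f 0 = 0)
    (hodd : ∀ s, s ≤ T → f (T - s) = -f s) : ∑ s ∈ range T, f s = 0 := by
  have hTz : f T = 0 := by simpa [h0] using hodd 0 (Nat.zero_le _)
  -- On T + 1 points s ↦ T - s is a bijection; the extra term f T = -f 0 vanishes.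
  have h1 : ∑ s ∈ range (T + 1), f (T + 1 - 1 - s) = ∑ s ∈ range (T + 1), f s :=
    sum_range_reflect f (T + 1)
  have h2 : ∑ s ∈ range (T + 1), f (T + 1 - 1 - s) = -∑ s ∈ range (T + 1), f s := by
    rw [← sum_neg_distrib]
    refine sum_congr rfl fun s hs => ?_
    rw [Nat.add_sub_cancel]
    exact hodd s (Nat.lt_succ_iff.1 (mem_range.1 hs))
  have h3 : ∑ s ∈ range (T + 1), f s = 0 := by linarith
  rwa [sum_range_succ, hTz, add_zero] at h3

/-! ### Norm estimates by coordinates -/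

lemma norm_le_mul_sqrt_sum (v : EuclideanSpace ℝ (Fin n)) (b : Fin n → ℝ) {c : ℝ} (hc : 0 ≤ c)
    (h : ∀ i, |v i| ≤ c * |b i|) : ‖v‖ ≤ c * √(∑ i, b i ^ 2) := by
  rw [EuclideanSpace.norm_eq]
  apply Real.sqrt_le_iff.2
  refine ⟨by positivity, ?_⟩
  rw [mul_pow, Real.sq_sqrt (sum_nonneg fun i _ => sq_nonneg _), mul_sum]
  refine sum_le_sum fun i _ => ?_
  rw [Real.norm_eq_abs, ← sq_abs (b i), ← mul_pow]
  exact pow_le_pow_left₀ (abs_nonneg _) (h i) 2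

lemma norm_le_mul_ampNorm (P : Params n) (v : EuclideanSpace ℝ (Fin n)) {c : ℝ} (hc : 0 ≤ c)
    (h : ∀ i, |v i| ≤ c * |P.a i|) : ‖v‖ ≤ c * ampNorm P :=
  norm_le_mul_sqrt_sum v P.a hc h

lemma norm_le_mul_invAmpNorm (P : Params n) (v : EuclideanSpace ℝ (Fin n)) {c : ℝ} (hc : 0 ≤ c)
    (h : ∀ i, |v i| ≤ c / |P.a i|) : ‖v‖ ≤ c * invAmpNorm P := by
  have := norm_le_mul_sqrt_sum v (fun i => 1 / P.a i) hc fun i => by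
    rw [abs_div, abs_one, mul_one_div]; exact h i
  simpa [invAmpNorm, one_div] using this

lemma norm_le_sum_abs (v : EuclideanSpace ℝ (Fin n)) : ‖v‖ ≤ ∑ i, |v i| := by
  rw [EuclideanSpace.norm_eq]
  apply Real.sqrt_le_iff.2
  refine ⟨sum_nonneg fun i _ => abs_nonneg _, ?_⟩
  simp only [Real.norm_eq_abs]
  exact sum_sq_le_sq_sum_of_nonneg fun i _ => abs_nonneg _

lemma abs_coord_le_norm (v : EuclideanSpace ℝ (Fin n)) (i : Fin n) : |v i| ≤ ‖v‖ :=
  PiLp.norm_apply_le v i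

/-- The sum of the absolute values of the entries dominates the operator norm; ρ₁ is modelled on
this sum. -/
lemma abs_hess_norm_le (K : Matrix (Fin n) (Fin n) ℝ) {c : ℝ} (h : ∑ i, ∑ l, |K i l| ≤ c)
    (y : EuclideanSpace ℝ (Fin n)) : ‖hess K y‖ ≤ c * ‖y‖ := by
  refine (norm_le_sum_abs _).trans ?_
  refine le_trans ?_ (mul_le_mul_of_nonneg_right h (norm_nonneg y))
  rw [sum_mul]
  refine sum_le_sum fun i _ => ?_
  rw [hess_apply, sum_mul]
  refine (abs_sum_le_sum_abs _ _).trans (sum_le_sum fun l _ => ?_)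
  rw [abs_mul]
  gcongr
  exact abs_coord_le_norm y l

/-! ### The dithers -/

lemma pert_apply (P : Params n) (ε : ℝ) (j : ℕ) (i : Fin n) :
    pert P ε j i = P.a i * Real.sin (freq P ε i * j) := rfl

lemma demod_apply (P : Params n) (ε : ℝ) (j : ℕ) (i : Fin n) :
    demod P ε j i = 2 / P.a i * Real.sin (freq P ε i * j) := rfl

lemma norm_pert_le (P : Params n) (ε : ℝ) (j : ℕ) : ‖pert P ε j‖ ≤ ampNorm P := by
  have := norm_le_mul_ampNorm P (pert P ε j) zero_le_one fun i => by
    rw [pert_apply, abs_mul, mul_comm]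
    gcongr
    exact Real.abs_sin_le_one _
  simpa using this

lemma norm_demod_le (P : Params n) (ε : ℝ) (j : ℕ) : ‖demod P ε j‖ ≤ 2 * invAmpNorm P := by
  refine norm_le_mul_invAmpNorm P _ zero_le_two fun i => ?_
  rw [demod_apply, abs_mul, abs_div, abs_two]
  exact mul_le_of_le_one_right (by positivity) (Real.abs_sin_le_one _)

lemma period_pos (P : Params n) (ε : ℝ) : 0 < period P ε :=
  lt_of_lt_of_le (by omega) (le_max_right _ _)

lemma freq_pos (P : Params n) (ε : ℝ) (i : Fin n) : 0 < freq P ε i := by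
  have : (0 : ℝ) < period P ε := by exact_mod_cast period_pos P ε
  rw [freq]
  positivity

lemma freq_le (P : Params n) (ε : ℝ) (i : Fin n) :
    freq P ε i ≤ 2 * Real.pi * n / period P ε := by
  rw [freq]
  gcongr
  exact_mod_cast i.2

/-- All dithers start at phase 0, so they are small at early times. This is used while the delayed
input is still θ(0). -/
lemma norm_pert_le_mul (P : Params n) (ε : ℝ) (j : ℕ) :
    ‖pert P ε j‖ ≤ 2 * Real.pi * n / period P ε * j * ampNorm P := by
  refine norm_le_mul_ampNorm P _ (by positivity) fun i => ?_
  rw [pert_apply, abs_mul, mul_comm]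
  gcongr
  refine Real.abs_sin_le_abs.trans ?_
  rw [abs_of_nonneg (mul_nonneg (freq_pos P ε i).le (Nat.cast_nonneg j))]
  gcongr
  exact freq_le P ε i

/-- With z = μe^{iω} the left side is |Im((z - 1)e^{it})| ≤ |z - 1|, and |z - 1|² = (1 - μ)² + 2μ(1
- cos ω). -/
lemma abs_damped_sin_sub_le {μ ω : ℝ} (h0 : 0 ≤ μ) (h1 : μ ≤ 1) (t : ℝ) :
    |μ * Real.sin (t + ω) - Real.sin t| ≤ √((1 - μ) ^ 2 + ω ^ 2) := by
  apply Real.abs_le_sqrt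
  have e : μ * Real.sin (t + ω) - Real.sin t =
      (μ * Real.cos ω - 1) * Real.sin t + μ * Real.sin ω * Real.cos t := by
    rw [Real.sin_add]; ring
  have hc := Real.one_sub_sq_div_two_le_cos (x := ω)
  have h2 : (μ * Real.sin (t + ω) - Real.sin t) ^ 2 ≤
      (μ * Real.cos ω - 1) ^ 2 + (μ * Real.sin ω) ^ 2 := by
    rw [e]
    have h3 := Real.sin_sq_add_cos_sq t
    have h4 : ((μ * Real.cos ω - 1) * Real.sin t + μ * Real.sin ω * Real.cos t) ^ 2 =
      ((μ * Real.cos ω - 1) ^ 2 + (μ * Real.sin ω) ^ 2) * (Real.sin t ^ 2 + Real.cos t ^ 2) -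
        ((μ * Real.cos ω - 1) * Real.cos t - μ * Real.sin ω * Real.sin t) ^ 2 := by ring
    rw [h4, h3]
    nlinarith [sq_nonneg ((μ * Real.cos ω - 1) * Real.cos t - μ * Real.sin ω * Real.sin t)]
  have h5 : (μ * Real.cos ω - 1) ^ 2 + (μ * Real.sin ω) ^ 2 =
      (1 - μ) ^ 2 + 2 * μ * (1 - Real.cos ω) := by
    have := Real.sin_sq_add_cos_sq ω
    have h6 : Real.sin ω ^ 2 = 1 - Real.cos ω ^ 2 := by linarith
    rw [mul_pow, h6]; ring
  have h7 : 2 * μ * (1 - Real.cos ω) ≤ ω ^ 2 := by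
    have h8 : 0 ≤ 1 - Real.cos ω := by linarith [Real.cos_le_one ω]
    nlinarith
  linarith

lemma norm_damped_pert_sub_le (P : Params n) (ε : ℝ) {μ : ℝ} (h0 : 0 ≤ μ) (h1 : μ ≤ 1) (j : ℕ) :
    ‖μ • pert P ε (j + 1) - pert P ε j‖ ≤
      √((1 - μ) ^ 2 + (2 * Real.pi * n / period P ε) ^ 2) * ampNorm P := by
  refine norm_le_mul_ampNorm P _ (Real.sqrt_nonneg _) fun i => ?_
  have e : (μ • pert P ε (j + 1) - pert P ε j) i =
      (μ * Real.sin (freq P ε i * j + freq P ε i) - Real.sin (freq P ε i * j)) * P.a i := by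
    rw [PiLp.sub_apply, PiLp.smul_apply, pert_apply, pert_apply, smul_eq_mul]
    push_cast
    rw [mul_add_one]; ring
  rw [e, abs_mul]
  gcongr
  refine (abs_damped_sin_sub_le h0 h1 _).trans ?_
  have := freq_pos P ε i
  gcongr
  exact freq_le P ε i

/-! ### Antiderivatives of the demodulated signals -/

/-- An antiderivative of the demodulation. -/
def demodPrim (P : Params n) (ε : ℝ) (j : ℕ) : EuclideanSpace ℝ (Fin n) :=
  WithLp.toLp 2 fun i => 2 / P.a i * sinPrim (freq P ε i) j

/-- The matrix of an antiderivative of `M(j) S(j)ᵀ - I`. -/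
def corrMatrix (P : Params n) (ε : ℝ) (j : ℕ) : Matrix (Fin n) (Fin n) ℝ := fun i l =>
  if l = i then -cosPrim (2 * Real.pi * (2 * ((i : ℝ) + 1)) / period P ε) j
  else P.a l / P.a i *
    (cosPrim (2 * Real.pi * (((i : ℝ) + 1) - ((l : ℝ) + 1)) / period P ε) j -
      cosPrim (2 * Real.pi * (((i : ℝ) + 1) + ((l : ℝ) + 1)) / period P ε) j)

/-- An antiderivative of `|S(j)|_H² M(j) / 2`. -/
def cubicPrim (P : Params n) (ε : ℝ) (H : Matrix (Fin n) (Fin n) ℝ) (j : ℕ) :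
    EuclideanSpace ℝ (Fin n) :=
  WithLp.toLp 2 fun i =>
    meanPrim (period P ε) (fun s => 1 / 2 * wsq H (pert P ε s) * demod P ε s i) j

section Long

variable {P : Params n} {ε : ℝ}

/-- The number 13 is what √ε* ≤ 2/27 yields; 13n ≤ T also covers the frequency sums up to 2n in the
condition 13|m| ≤ 2T. -/
lemma thirteen_coord_le (hT : 13 * n ≤ period P ε) (i : Fin n) :
    13 * ((i : ℝ) + 1) ≤ period P ε := by
  have : 13 * ((i : ℕ) + 1) ≤ period P ε := by have := i.2; omega
  exact_mod_cast this

lemma demodPrim_succ_sub (hT : 13 * n ≤ period P ε) (j : ℕ) :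
    demodPrim P ε (j + 1) - demodPrim P ε j = demod P ε j := by
  ext i
  have h := thirteen_coord_le hT i
  have h0 : (0 : ℝ) < (i : ℝ) + 1 := by positivity
  have := sinPrim_succ_sub (ω := freq P ε i)
    (sin_half_freq_ne_zero h0.ne' (by rw [abs_of_pos h0]; linarith)) j
  rw [PiLp.sub_apply, demod_apply, ← this]
  simp only [demodPrim]
  ring

lemma norm_demodPrim_le (hT : 13 * n ≤ period P ε) (j : ℕ) :
    ‖demodPrim P ε j‖ ≤ 34 / 100 * period P ε * ∑ i : Fin n, 1 / (((i : ℝ) + 1) * |P.a i|) := by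
  refine (norm_le_sum_abs _).trans ?_
  rw [mul_sum]
  refine sum_le_sum fun i _ => ?_
  have h := thirteen_coord_le hT i
  have h0 : (0 : ℝ) < (i : ℝ) + 1 := by positivity
  have := abs_sinPrim_le h0.ne' (T := period P ε) (by rw [abs_of_pos h0]; linarith) j
  simp only [demodPrim]
  rw [abs_mul, abs_div, abs_two, freq]
  rw [abs_of_pos h0] at this
  calc _ ≤ 2 / |P.a i| * (17 / 100 * period P ε / ((i : ℝ) + 1)) := by gcongr
    _ = 34 / 100 * period P ε * (1 / (|P.a i| * ((i : ℝ) + 1))) := by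
        rw [one_div, mul_inv]; ring
    _ = _ := by rw [mul_comm |P.a i|]

/-- Product to sum: 2 sin a sin b = cos(a - b) - cos(a + b). On the diagonal the difference
frequency is 0, and its cosine is the mean 1 that is subtracted. -/
lemma corrMatrix_succ_sub (hP : ∀ i, P.a i ≠ 0) (hT : 13 * n ≤ period P ε) (j : ℕ)
    (i l : Fin n) : corrMatrix P ε (j + 1) i l - corrMatrix P ε j i l =
      demod P ε j i * pert P ε j l - if l = i then 1 else 0 := by
  have hi := thirteen_coord_le hT i
  have hl := thirteen_coord_le hT l
  have hi0 : (0 : ℝ) < (i : ℝ) + 1 := by positivity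
  have hl0 : (0 : ℝ) < (l : ℝ) + 1 := by positivity
  have ha := hP i
  have hb := hP l
  rw [demod_apply, pert_apply]
  unfold corrMatrix
  split_ifs with h
  · subst h
    have h1 := cosPrim_succ_sub (ω := 2 * Real.pi * (2 * ((l : ℝ) + 1)) / period P ε)
      (sin_half_freq_ne_zero (by positivity) (by rw [abs_of_pos (by positivity)]; linarith)) j
    have e : 2 * Real.pi * (2 * ((l : ℝ) + 1)) / period P ε * j = 2 * (freq P ε l * j) := by
      rw [freq]; ring
    rw [e, Real.cos_two_mul, Real.cos_sq'] at h1
    have h5 : 2 / P.a l * Real.sin (freq P ε l * j) * (P.a l * Real.sin (freq P ε l * j)) =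
        2 * Real.sin (freq P ε l * j) ^ 2 := by field_simp
    linear_combination -h5 - h1
  · have hne : ((i : ℝ) + 1) - ((l : ℝ) + 1) ≠ 0 := by
      intro h'
      apply h
      have : (l : ℝ) = i := by linarith
      exact Fin.ext (by exact_mod_cast this)
    have h1 := cosPrim_succ_sub
      (ω := 2 * Real.pi * (((i : ℝ) + 1) - ((l : ℝ) + 1)) / period P ε)
      (sin_half_freq_ne_zero hne (by
        have : |((i : ℝ) + 1) - ((l : ℝ) + 1)| ≤ ((i : ℝ) + 1) + ((l : ℝ) + 1) :=
          abs_le.2 ⟨by linarith, by linarith⟩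
        linarith)) j
    have h2 := cosPrim_succ_sub
      (ω := 2 * Real.pi * (((i : ℝ) + 1) + ((l : ℝ) + 1)) / period P ε)
      (sin_half_freq_ne_zero (by positivity) (by rw [abs_of_pos (by positivity)]; linarith)) j
    have e1 : 2 * Real.pi * (((i : ℝ) + 1) - ((l : ℝ) + 1)) / period P ε * j =
        freq P ε i * j - freq P ε l * j := by
      rw [freq, freq]; ring
    have e2 : 2 * Real.pi * (((i : ℝ) + 1) + ((l : ℝ) + 1)) / period P ε * j =
        freq P ε i * j + freq P ε l * j := by
      rw [freq, freq]; ring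
    rw [e1, Real.cos_sub] at h1
    rw [e2, Real.cos_add] at h2
    have h4 : P.a l / P.a i * (2 * (Real.sin (freq P ε i * j) * Real.sin (freq P ε l * j))) =
        2 / P.a i * Real.sin (freq P ε i * j) * (P.a l * Real.sin (freq P ε l * j)) := by ring
    rw [sub_zero, ← h4]
    linear_combination P.a l / P.a i * (h1 - h2)

lemma corr_succ_sub (hP : ∀ i, P.a i ≠ 0) (hT : 13 * n ≤ period P ε) (j : ℕ)
    (y : EuclideanSpace ℝ (Fin n)) :
    hess (corrMatrix P ε (j + 1)) y - hess (corrMatrix P ε j) y =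
      ⟪pert P ε j, y⟫ • demod P ε j - y := by
  ext i
  rw [PiLp.sub_apply, PiLp.sub_apply, PiLp.smul_apply, hess_apply, hess_apply, ← sum_sub_distrib,
    inner_eq_sum, smul_eq_mul, sum_mul]
  have : ∀ l, corrMatrix P ε (j + 1) i l * y l - corrMatrix P ε j i l * y l =
      pert P ε j l * y l * demod P ε j i - if l = i then y l else 0 := by
    intro l
    rw [← sub_mul, corrMatrix_succ_sub hP hT]
    split_ifs <;> ring
  simp only [this, sum_sub_distrib, sum_ite_eq', mem_univ, if_true]

lemma sum_abs_corrMatrix_le (hT : 13 * n ≤ period P ε) (j : ℕ) :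
    ∑ i, ∑ l, |corrMatrix P ε j i l| ≤ 17 / 100 * period P ε *
      ((∑ i : Fin n, 1 / ((i : ℝ) + 1)) +
        ∑ i : Fin n, ∑ l ∈ univ.filter (fun l : Fin n => l ≠ i),
          |P.a l| / |P.a i| *
            (1 / |((i : ℝ) + 1) - ((l : ℝ) + 1)| + 1 / (((i : ℝ) + 1) + ((l : ℝ) + 1)))) := by
  rw [← sum_add_distrib, mul_sum]
  refine sum_le_sum fun i _ => ?_
  have hi := thirteen_coord_le hT i
  have hi0 : (0 : ℝ) < (i : ℝ) + 1 := by positivity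
  have hTp : (0 : ℝ) ≤ period P ε := Nat.cast_nonneg _
  rw [← sum_filter_add_sum_filter_not univ (fun l : Fin n => l ≠ i), add_comm, mul_add]
  refine add_le_add ?_ ?_
  · have : univ.filter (fun l : Fin n => ¬ l ≠ i) = {i} := by ext; simp
    rw [this, sum_singleton]
    unfold corrMatrix
    rw [if_pos rfl, abs_neg]
    have := abs_cosPrim_le (m := 2 * ((i : ℝ) + 1)) (T := period P ε) (by positivity)
      (by rw [abs_of_pos (by positivity)]; linarith) j
    refine this.trans ?_
    rw [abs_of_pos (by positivity), mul_one_div]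
    gcongr
    linarith
  · rw [mul_sum]
    refine sum_le_sum fun l hl => ?_
    have hli : l ≠ i := (mem_filter.1 hl).2
    have hl := thirteen_coord_le hT l
    have hl0 : (0 : ℝ) < (l : ℝ) + 1 := by positivity
    have hne : ((i : ℝ) + 1) - ((l : ℝ) + 1) ≠ 0 := by
      intro h'
      apply hli
      have : (l : ℝ) = i := by linarith
      exact Fin.ext (by exact_mod_cast this)
    have h1 := abs_cosPrim_le (T := period P ε) hne (by
        have : |((i : ℝ) + 1) - ((l : ℝ) + 1)| ≤ ((i : ℝ) + 1) + ((l : ℝ) + 1) :=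
          abs_le.2 ⟨by linarith, by linarith⟩
        linarith) j
    have h2 := abs_cosPrim_le (m := ((i : ℝ) + 1) + ((l : ℝ) + 1)) (T := period P ε)
      (by positivity) (by rw [abs_of_pos (by positivity)]; linarith) j
    rw [abs_of_pos (a := ((i : ℝ) + 1) + ((l : ℝ) + 1)) (by positivity)] at h2
    unfold corrMatrix
    rw [if_neg hli, abs_mul, abs_div]
    have h3 := (abs_sub (cosPrim (2 * Real.pi * (((i : ℝ) + 1) - ((l : ℝ) + 1)) / period P ε) j)
      (cosPrim (2 * Real.pi * (((i : ℝ) + 1) + ((l : ℝ) + 1)) / period P ε) j)).trans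
      (add_le_add h1 h2)
    calc _ ≤ |P.a l| / |P.a i| * (17 / 100 * period P ε / |((i : ℝ) + 1) - ((l : ℝ) + 1)| +
          17 / 100 * period P ε / (((i : ℝ) + 1) + ((l : ℝ) + 1))) := by gcongr
      _ = _ := by ring

lemma freq_mul_period_sub (i : Fin n) {s : ℕ} (hs : s ≤ period P ε) :
    Real.sin (freq P ε i * ((period P ε - s : ℕ) : ℝ)) = -Real.sin (freq P ε i * s) := by
  have hT : (period P ε : ℝ) ≠ 0 := by exact_mod_cast (period_pos P ε).ne'
  have e : freq P ε i * ((period P ε - s : ℕ) : ℝ) =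
      ((i + 1 : ℕ) : ℝ) * (2 * Real.pi) - freq P ε i * s := by
    rw [Nat.cast_sub hs, freq]; push_cast; field_simp
  rw [e, Real.sin_nat_mul_two_pi_sub]

lemma freq_mul_add_period (i : Fin n) (s : ℕ) :
    Real.sin (freq P ε i * ((s + period P ε : ℕ) : ℝ)) = Real.sin (freq P ε i * s) := by
  have hT : (period P ε : ℝ) ≠ 0 := by exact_mod_cast (period_pos P ε).ne'
  have e : freq P ε i * ((s + period P ε : ℕ) : ℝ) =
      freq P ε i * s + ((i + 1 : ℕ) : ℝ) * (2 * Real.pi) := by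
    rw [freq]; push_cast; field_simp
  rw [e, Real.sin_add_nat_mul_two_pi]

lemma pert_add_period (s : ℕ) : pert P ε (s + period P ε) = pert P ε s := by
  ext i; rw [pert_apply, pert_apply, freq_mul_add_period]

lemma pert_period_sub {s : ℕ} (hs : s ≤ period P ε) : pert P ε (period P ε - s) = -pert P ε s := by
  ext i; rw [PiLp.neg_apply, pert_apply, pert_apply, freq_mul_period_sub i hs, mul_neg]

lemma wsq_neg (H : Matrix (Fin n) (Fin n) ℝ) (x : EuclideanSpace ℝ (Fin n)) :
    wsq H (-x) = wsq H x := by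
  rw [wsq_eq_inner, wsq_eq_inner, map_neg, inner_neg_neg]

/-- The product is cubic in the dithers, hence odd under s ↦ T - s, so it has zero mean over a
period whatever resonances occur among the frequencies. -/
lemma cubicPrim_succ_sub (H : Matrix (Fin n) (Fin n) ℝ) (j : ℕ) :
    cubicPrim P ε H (j + 1) - cubicPrim P ε H j =
      (1 / 2 * wsq H (pert P ε j)) • demod P ε j := by
  ext i
  rw [PiLp.sub_apply, PiLp.smul_apply, smul_eq_mul]
  refine meanPrim_succ_sub (period_pos P ε)
    (f := fun s => 1 / 2 * wsq H (pert P ε s) * demod P ε s i) (fun s => ?_)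
    (sum_range_eq_zero_of_odd ?_ fun s hs => ?_) j
  · simp only
    rw [pert_add_period, demod_apply, demod_apply, freq_mul_add_period]
  · simp [demod_apply]
  · simp only
    rw [pert_period_sub hs, wsq_neg, demod_apply, demod_apply, freq_mul_period_sub i hs]
    ring

lemma norm_cubicPrim_le {H : Matrix (Fin n) (Fin n) ℝ} {m M : ℝ} (hH : FormBetween (hess H) m M)
    (hm : 0 < m) (hM : 0 < M) (j : ℕ) :
    ‖cubicPrim P ε H j‖ ≤ period P ε / 4 * (M * ampNorm P ^ 2) * invAmpNorm P := by
  refine norm_le_mul_invAmpNorm P _ (by positivity) fun i => ?_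
  rw [mul_div_assoc]
  refine abs_meanPrim_le (period_pos P ε)
    (f := fun s => 1 / 2 * wsq H (pert P ε s) * demod P ε s i) (fun s => ?_) j
  have h0 : 0 ≤ wsq H (pert P ε s) := by
    rw [wsq_eq_inner]; exact hH.form_nonneg hm _
  have h1 : wsq H (pert P ε s) ≤ M * ampNorm P ^ 2 := by
    rw [wsq_eq_inner]
    refine (hH.upper _).trans ?_
    gcongr
    exact norm_pert_le P ε s
  rw [abs_mul, abs_of_nonneg (by positivity), demod_apply, abs_mul, abs_div, abs_two]
  calc _ ≤ 1 / 2 * (M * ampNorm P ^ 2) * (2 / |P.a i| * 1) := by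
        gcongr
        exact Real.abs_sin_le_one _
    _ = _ := by ring

end Long

/-! ### Consequences of the conditions on `ε*` -/

/-- The standing assumptions of the convergence statement. -/
structure Setting (P : Params n) (σ e : ℝ) : Prop where
  dim_pos : 0 < n
  valid : P.Valid
  hess_le : P.Hm ≤ P.HM
  init_lt : P.σ₀ < σ
  cond : Conditions P σ e

/-- The bound on the normalized increments of the estimate. -/
def deltaStep (P : Params n) (σ e : ℝ) : ℝ := delta P σ e + √e * deltaOut P σ e

/-- The bound on the normalized increments of the estimate in terms of the bounds on the
measurement and on the filter. -/
def rawStep (P : Params n) (σ e : ℝ) : ℝ :=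
  2 * P.k * (sigmaY P σ e + sigmaEta P σ e) * invAmpNorm P / P.α₀

/-- The factor of `√ε` in the bound on the estimation error. -/
def driftCoef (P : Params n) (σ e : ℝ) : ℝ :=
  2 * deltaG P σ e + deltaY P σ e / (P.k * P.Hm - P.lam)

/-- The bound on the normalized estimation error for the parameter `ε ≤ e`. -/
def sigmaAt (P : Params n) (σ e ε : ℝ) : ℝ :=
  P.σ₀ * ((1 - e * P.lam) ^ P.DM)⁻¹ + √ε * driftCoef P σ e

lemma ampNorm_nonneg (P : Params n) : 0 ≤ ampNorm P := Real.sqrt_nonneg _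

lemma invAmpNorm_nonneg (P : Params n) : 0 ≤ invAmpNorm P := Real.sqrt_nonneg _

lemma abs_le_ampNorm (P : Params n) (i : Fin n) : |P.a i| ≤ ampNorm P :=
  Real.abs_le_sqrt (single_le_sum (f := fun i => P.a i ^ 2) (fun _ _ => sq_nonneg _) (mem_univ i))

lemma one_div_abs_le_invAmpNorm (P : Params n) (i : Fin n) : 1 / |P.a i| ≤ invAmpNorm P := by
  rw [← abs_one, ← abs_div]
  refine Real.abs_le_sqrt ?_
  rw [div_pow, one_pow]
  exact single_le_sum (f := fun i => 1 / P.a i ^ 2) (fun _ _ => by positivity) (mem_univ i)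

lemma rho2_eq (P : Params n) : rho2 P = 2 * rho4 P := by
  rw [rho2, rho4]; ring

/-- R'²(q - p) ≤ 2dR'·(stR) ≤ 2dR'·Dp ≤ (R² - R'²)p. In the application p and q are filter
denominators at ε and ε*, R' and R the error radii, and d = √ε* - √ε. -/
lemma sq_mul_le_sq_mul {R R' p q d D s t : ℝ} (hR' : 0 ≤ R') (hp : 0 ≤ p) (hd : 0 ≤ d)
    (hD : 0 ≤ D) (hst : 0 ≤ s * t) (hq : q - p ≤ d * (2 * s) * t) (hR : R' + d * D ≤ R)
    (h : s * t * R ≤ D * p) : R' ^ 2 * q ≤ R ^ 2 * p := by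
  have hRR : R' ≤ R := by have := mul_nonneg hd hD; linarith
  have h3 : d * D * (R + R') ≤ (R - R') * (R + R') := by gcongr <;> linarith
  have h4 : R' ^ 2 * (q - p) ≤ R' ^ 2 * (d * (2 * s) * t) := by gcongr
  have h5 : R' * R' * (2 * d * (s * t)) ≤ R * R' * (2 * d * (s * t)) := by gcongr
  have h6 : 2 * d * R' * (s * t * R) ≤ 2 * d * R' * (D * p) := by gcongr
  have h7 : d * D * (2 * R') * p ≤ d * D * (R + R') * p := by gcongr; linarith
  have h8 : d * D * (R + R') * p ≤ (R - R') * (R + R') * p := by gcongr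
  linarith

namespace Setting

variable {P : Params n} {σ e : ℝ}

lemma e_pos (S : Setting P σ e) : 0 < e := S.cond.pos

lemma sqrt_pos (S : Setting P σ e) : 0 < √e := Real.sqrt_pos.2 S.e_pos

lemma sqrt_sq (S : Setting P σ e) : √e * √e = e := Real.mul_self_sqrt S.e_pos.le

lemma sigma_pos (S : Setting P σ e) : 0 < σ := S.valid.σ₀_pos.trans S.init_lt

/-- Without delay, condition (a) would read 2n + 1 ≤ 0. -/
lemma DM_pos (S : Setting P σ e) : 0 < P.DM := by
  rcases Nat.eq_zero_or_pos P.DM with h | h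
  · have := S.cond.cond_a
    rw [h] at this
    simp at this
  · exact h

lemma one_le_DM (S : Setting P σ e) : (1 : ℝ) ≤ P.DM := by exact_mod_cast S.DM_pos

lemma one_le_dim (S : Setting P σ e) : (1 : ℝ) ≤ n := by exact_mod_cast S.dim_pos

lemma decay_pos (S : Setting P σ e) : 0 < 1 - e * P.lam := by
  have h := S.cond.cond_b
  have h1 := mul_le_mul_of_nonneg_left (le_max_left (P.lam + P.k * P.Hm)
    (P.ωh + 2 * P.lam - e * P.lam ^ 2)) S.e_pos.le
  have h2 := mul_lt_mul_of_pos_left S.valid.gain S.e_pos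
  linarith

lemma abs_decay (S : Setting P σ e) : |1 - e * P.lam| = 1 - e * P.lam := abs_of_pos S.decay_pos

lemma decay_lt_one (S : Setting P σ e) : 1 - e * P.lam < 1 := by
  have := mul_pos S.e_pos S.valid.lam_pos
  linarith

/-- The second entry of the maximum in (b) is exactly the lower inequality; the upper one follows
from ω_h > 2λ. -/
lemma filter_lt (S : Setting P σ e) : |1 - e * P.ωh| < (1 - e * P.lam) ^ 2 := by
  have h := S.cond.cond_b
  have h1 := mul_le_mul_of_nonneg_left (le_max_right (P.lam + P.k * P.Hm)
    (P.ωh + 2 * P.lam - e * P.lam ^ 2)) S.e_pos.le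
  have h2 := mul_lt_mul_of_pos_left S.valid.filter S.e_pos
  rw [abs_lt]
  constructor
  · linarith
  · nlinarith [sq_nonneg (e * P.lam)]

lemma gain_lt (S : Setting P σ e) : |1 - e * P.k * P.Hm| < 1 - e * P.lam := by
  have h := S.cond.cond_b
  have h1 := mul_le_mul_of_nonneg_left (le_max_left (P.lam + P.k * P.Hm)
    (P.ωh + 2 * P.lam - e * P.lam ^ 2)) S.e_pos.le
  have h2 := mul_lt_mul_of_pos_left S.valid.gain S.e_pos
  rw [abs_lt]
  constructor <;> linarith

lemma gain_sub_pos (S : Setting P σ e) : 0 < P.k * P.Hm - P.lam := by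
  linarith [S.valid.gain]

lemma filter_pos (S : Setting P σ e) : 0 < |1 - e * P.ωh| := abs_pos.2 S.cond.ne_zero

lemma sqrt_lt_one (S : Setting P σ e) : √e < 1 := by
  rw [Real.sqrt_lt' one_pos]; simpa using S.cond.lt_one

/-- The first coordinate. -/
def first (S : Setting P σ e) : Fin n := ⟨0, S.dim_pos⟩

lemma amp_first_pos (S : Setting P σ e) : 0 < |P.a S.first| := abs_pos.2 (S.valid.a_ne _)

lemma ampNorm_pos (S : Setting P σ e) : 0 < ampNorm P :=
  S.amp_first_pos.trans_le (abs_le_ampNorm P _)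

lemma invAmpNorm_pos (S : Setting P σ e) : 0 < invAmpNorm P :=
  lt_of_lt_of_le (one_div_pos.2 S.amp_first_pos) (one_div_abs_le_invAmpNorm P S.first)

lemma one_le_amp_mul (S : Setting P σ e) : 1 ≤ ampNorm P * invAmpNorm P := by
  have h := mul_le_mul (abs_le_ampNorm P S.first) (one_div_abs_le_invAmpNorm P S.first)
    (one_div_pos.2 S.amp_first_pos).le (ampNorm_nonneg P)
  rwa [mul_one_div_cancel S.amp_first_pos.ne'] at h

lemma sum_inv_ge (S : Setting P σ e) :
    1 / |P.a S.first| ≤ ∑ i : Fin n, 1 / (((i : ℝ) + 1) * |P.a i|) := by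
  have := single_le_sum (f := fun i : Fin n => 1 / (((i : ℝ) + 1) * |P.a i|))
    (fun i _ => by positivity) (mem_univ S.first)
  simpa [first] using this

/-- Lower bounds on the constants are wanted because (c) is also read backwards: large constants
force ε* to be small. -/
lemma rho1_ge (S : Setting P σ e) : 0.19245 * P.DM * P.k * P.HM ≤ rho1 P := by
  have hv := S.valid
  have hk := hv.k_pos
  have hM := hv.HM_pos
  have h1 : (1 : ℝ) ≤ ∑ i : Fin n, 1 / ((i : ℝ) + 1) := by
    have := single_le_sum (f := fun i : Fin n => 1 / ((i : ℝ) + 1))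
      (fun i _ => by positivity) (mem_univ S.first)
    simpa [first] using this
  have h2 : 0 ≤ ∑ i : Fin n, ∑ l ∈ univ.filter (fun l : Fin n => l ≠ i),
        |P.a l| / |P.a i| *
          (1 / |((i : ℝ) + 1) - ((l : ℝ) + 1)| + 1 / (((i : ℝ) + 1) + ((l : ℝ) + 1))) :=
    sum_nonneg fun i _ => sum_nonneg fun l _ => by positivity
  rw [rho1]
  calc 0.19245 * P.DM * P.k * P.HM = 0.19245 * 1 * P.DM * P.k * P.HM * (1 + 0) := by ring
    _ ≤ _ := by
      gcongr
      exact S.one_le_dim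

lemma rho1_pos (S : Setting P σ e) : 0 < rho1 P := by
  have hk := S.valid.k_pos
  have hM := S.valid.HM_pos
  have hD := S.one_le_DM
  exact lt_of_lt_of_le (by positivity) S.rho1_ge

lemma rho4_ge (S : Setting P σ e) : 0.19245 * P.DM * P.k / |P.a S.first| ≤ rho4 P := by
  have hk := S.valid.k_pos
  rw [rho4]
  calc 0.19245 * P.DM * P.k / |P.a S.first| =
      0.19245 * 1 * P.DM * P.k * (1 / |P.a S.first|) := by ring
    _ ≤ _ := by
      gcongr
      · exact S.one_le_dim
      · exact S.sum_inv_ge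

lemma rho4_pos (S : Setting P σ e) : 0 < rho4 P := by
  have hk := S.valid.k_pos
  have hD := S.one_le_DM
  have ha := S.amp_first_pos
  exact lt_of_lt_of_le (by positivity) S.rho4_ge

lemma rho2_pos (S : Setting P σ e) : 0 < rho2 P := by
  rw [rho2_eq]; linarith [S.rho4_pos]

lemma rho3_nonneg (S : Setting P σ e) : 0 ≤ rho3 P e := by
  have hk := S.valid.k_pos
  have hM := S.valid.HM_pos
  rw [rho3]
  have : 0 ≤ ∑ s, P.a s ^ 2 := sum_nonneg fun _ _ => sq_nonneg _
  positivity

/-- The bound `σ + α₀ A` on the normalized input error. -/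
lemma radius_pos (S : Setting P σ e) : 0 < σ + P.α₀ * ampNorm P := by
  have h := mul_pos S.valid.α₀_pos S.ampNorm_pos
  linarith [S.sigma_pos]

lemma sigmaY_eq (S : Setting P σ e) : sigmaY P σ e =
    P.HM / 2 * ((1 - e * P.lam) ^ (2 * P.DM))⁻¹ * (σ + P.α₀ * ampNorm P) ^ 2 := by
  rw [sigmaY, S.abs_decay]

lemma sigmaY_ge (S : Setting P σ e) :
    P.HM / 2 * (σ + P.α₀ * ampNorm P) ^ 2 ≤ sigmaY P σ e := by
  have hM := S.valid.HM_pos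
  rw [S.sigmaY_eq]
  have h : 1 ≤ ((1 - e * P.lam) ^ (2 * P.DM))⁻¹ :=
    (one_le_inv₀ (pow_pos S.decay_pos _)).2 (pow_le_one₀ S.decay_pos.le S.decay_lt_one.le)
  calc P.HM / 2 * (σ + P.α₀ * ampNorm P) ^ 2 =
      P.HM / 2 * 1 * (σ + P.α₀ * ampNorm P) ^ 2 := by ring
    _ ≤ _ := by gcongr

lemma sigmaY_pos (S : Setting P σ e) : 0 < sigmaY P σ e := by
  have hM := S.valid.HM_pos
  have := S.radius_pos
  exact lt_of_lt_of_le (by positivity) S.sigmaY_ge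

lemma sigmaEta_eq (S : Setting P σ e) : sigmaEta P σ e =
    P.ΔQ * (|1 - e * P.ωh| ^ P.DM)⁻¹ +
    e * P.ωh * sigmaY P σ e / ((1 - e * P.lam) ^ 2 - |1 - e * P.ωh|) := by
  rw [sigmaEta, S.abs_decay]

lemma sigmaEta_pos (S : Setting P σ e) : 0 < sigmaEta P σ e := by
  rw [S.sigmaEta_eq]
  have h1 := S.valid.ΔQ_pos
  have h2 := S.filter_pos
  have h3 := sub_pos.2 S.filter_lt
  have h4 := S.sigmaY_pos
  have h5 := S.e_pos
  have h6 := S.valid.ωh_pos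
  positivity

lemma deltaG_pos (S : Setting P σ e) : 0 < deltaG P σ e := by
  rw [deltaG]
  have := S.rho1_pos
  have := S.rho2_pos
  have := S.rho3_nonneg
  have := S.rho4_pos
  have := S.sigma_pos
  have := S.sigmaEta_pos
  have := S.valid.α₀_pos
  have := S.valid.HM_pos
  positivity

lemma delta_ge (S : Setting P σ e) :
    P.k * P.HM * (σ + P.α₀ * ampNorm P) ^ 2 * invAmpNorm P / P.α₀ ≤ delta P σ e := by
  have h1 := S.valid.α₀_pos
  have h2 := S.valid.k_pos
  have h3 := S.sigmaEta_pos
  have h4 := S.invAmpNorm_pos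
  rw [delta]
  calc _ = 2 * P.k / P.α₀ * (P.HM / 2 * (σ + P.α₀ * ampNorm P) ^ 2 + 0) * invAmpNorm P := by ring
    _ ≤ _ := by gcongr

lemma delta_pos (S : Setting P σ e) : 0 < delta P σ e := by
  have h1 := S.valid.α₀_pos
  have h2 := S.valid.k_pos
  have h3 := S.valid.HM_pos
  have h4 := S.invAmpNorm_pos
  have h5 := S.radius_pos
  exact lt_of_lt_of_le (by positivity) S.delta_ge

lemma rawStep_pos (S : Setting P σ e) : 0 < rawStep P σ e := by
  have h1 := S.valid.α₀_pos
  have h2 := S.valid.k_pos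
  have h3 := S.sigmaEta_pos
  have h4 := S.invAmpNorm_pos
  have h5 := S.sigmaY_pos
  rw [rawStep]
  positivity

/-- The bound on the effect of the delays dominates its two main contributions. -/
lemma deltaOut_ge (S : Setting P σ e) :
    P.k * P.DM * P.HM / P.α₀ * invAmpNorm P * (σ + P.α₀ * ampNorm P) *
      (1 + ((1 - e * P.lam) ^ P.DM)⁻¹) *
      (√e * rawStep P σ e + P.α₀ * ampNorm P *
        (P.lam * √e + 2 * Real.pi / ((1 - √e) * P.DM))) ≤ deltaOut P σ e := by
  have h1 := S.valid.α₀_pos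
  have h2 := S.valid.k_pos
  have h3 := S.valid.HM_pos
  have h4 := S.invAmpNorm_pos
  have h5 := S.radius_pos
  have h6 := S.decay_pos
  have h7 := S.ampNorm_pos
  have h8 := sub_pos.2 S.sqrt_lt_one
  have h9 := S.valid.lam_pos
  have h10 := S.one_le_DM
  have h11 := S.sqrt_pos
  rw [deltaOut, S.abs_decay]
  gcongr ?_ * ?_
  refine add_le_add (le_of_eq ?_) ?_
  · rw [rawStep]; ring
  · rw [le_div_iff₀ h6]
    have : P.lam * √e + 2 * Real.pi / ((1 - √e) * P.DM) ≤
        P.lam * √e + 2 * Real.pi / ((1 - √e) * P.DM) *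
          (Real.pi * √e / ((1 - √e) * P.DM) + 1) := by
      gcongr
      refine le_mul_of_one_le_right (by positivity) ?_
      have : 0 ≤ Real.pi * √e / ((1 - √e) * P.DM) := by positivity
      linarith
    calc _ ≤ P.α₀ * ampNorm P * (P.lam * √e + 2 * Real.pi / ((1 - √e) * P.DM)) * 1 := by
          gcongr
          exact S.decay_lt_one.le
      _ ≤ _ := by rw [mul_one]; gcongr

/-- Only the dither-frequency term is kept, with 1 + (1 - eλ)^(-D_M) ≥ 2. The factors D_M cancel, so
the resulting bound on ε* is absolute. -/
lemma deltaOut_ge_pi (S : Setting P σ e) :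
    4 * Real.pi * (P.k * P.HM * (σ + P.α₀ * ampNorm P) * (ampNorm P * invAmpNorm P)) ≤
      (1 - √e) * deltaOut P σ e := by
  have h1 := S.valid.α₀_pos
  have h2 := S.valid.k_pos
  have h3 := S.valid.HM_pos
  have h4 := S.invAmpNorm_pos
  have h5 := S.radius_pos
  have h6 := S.decay_pos
  have h7 := S.ampNorm_pos
  have h8 := sub_pos.2 S.sqrt_lt_one
  have h9 := S.valid.lam_pos
  have h10 := S.one_le_DM
  have h11 := S.sqrt_pos
  have h12 := S.rawStep_pos
  have h : 1 ≤ ((1 - e * P.lam) ^ P.DM)⁻¹ :=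
    (one_le_inv₀ (pow_pos S.decay_pos _)).2 (pow_le_one₀ S.decay_pos.le S.decay_lt_one.le)
  refine le_trans ?_ (mul_le_mul_of_nonneg_left S.deltaOut_ge h8.le)
  calc _ = (1 - √e) * (P.k * P.DM * P.HM / P.α₀ * invAmpNorm P * (σ + P.α₀ * ampNorm P) *
      (1 + 1) * (0 + P.α₀ * ampNorm P * (0 + 2 * Real.pi / ((1 - √e) * P.DM)))) := by
        field_simp; ring
    _ ≤ _ := by
      gcongr <;> positivity

lemma deltaOut_pos (S : Setting P σ e) : 0 < deltaOut P σ e := by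
  have h2 := S.valid.k_pos
  have h3 := S.valid.HM_pos
  have h4 := S.invAmpNorm_pos
  have h5 := S.radius_pos
  have h7 := S.ampNorm_pos
  have h8 := sub_pos.2 S.sqrt_lt_one
  have := lt_of_lt_of_le (by positivity) S.deltaOut_ge_pi
  exact pos_of_mul_pos_right this h8.le

lemma deltaStep_pos (S : Setting P σ e) : 0 < deltaStep P σ e := by
  have := S.delta_pos
  have := S.deltaOut_pos
  rw [deltaStep]; positivity

lemma delta_le_deltaStep (S : Setting P σ e) : delta P σ e ≤ deltaStep P σ e := by
  have := mul_pos S.sqrt_pos S.deltaOut_pos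
  rw [deltaStep]; linarith

lemma deltaY_terms (S : Setting P σ e) :
    P.k * P.HM * deltaG P σ e ≤ deltaY P σ e ∧ rho1 P * deltaStep P σ e ≤ deltaY P σ e ∧
    P.ωh * rho2 P / P.α₀ * (sigmaY P σ e + sigmaEta P σ e) ≤ deltaY P σ e ∧
    2 * rho4 P * σ * P.α₀⁻¹ * P.HM * deltaStep P σ e ≤ deltaY P σ e ∧
    deltaOut P σ e ≤ deltaY P σ e := by
  have hα := S.valid.α₀_pos
  have hk := S.valid.k_pos
  have hM := S.valid.HM_pos
  have hω := S.valid.ωh_pos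
  have hlam := S.valid.lam_pos
  have hσ := S.sigma_pos
  have r1 := S.rho1_pos
  have r2 := S.rho2_pos
  have r3 := S.rho3_nonneg
  have r4 := S.rho4_pos
  have hG := S.deltaG_pos
  have hS := S.deltaStep_pos
  have hO := S.deltaOut_pos
  have hη := S.sigmaEta_pos
  have hy := S.sigmaY_pos
  have he := S.e_pos
  have hd := S.decay_pos
  rw [deltaY, S.abs_decay, ← deltaStep]
  have t1 : 0 ≤ P.k * P.HM * deltaG P σ e := by positivity
  have t2 : 0 ≤ rho1 P * deltaStep P σ e := by positivity
  have t3 : 0 ≤ P.ωh * rho2 P / P.α₀ * (sigmaY P σ e + sigmaEta P σ e) := by positivity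
  have t4 : 0 ≤ rho2 P * P.lam * (sigmaEta P σ e * |1 - e * P.ωh| + e * P.ωh * sigmaY P σ e) /
      (P.α₀ * (1 - e * P.lam)) := by positivity
  have t5 : 0 ≤ rho3 P e * P.α₀ * P.lam := by positivity
  have t6 : 0 ≤ 2 * rho4 P * σ * P.α₀⁻¹ * P.HM * deltaStep P σ e := by positivity
  have t7 : 0 ≤ e * rho4 P * P.α₀⁻¹ * P.HM * deltaStep P σ e ^ 2 := by positivity
  have t8 : 0 ≤ rho4 P * P.α₀⁻¹ * P.lam / (1 - e * P.lam) * P.HM *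
      (σ + e * deltaStep P σ e) ^ 2 := by positivity
  refine ⟨?_, ?_, ?_, ?_, ?_⟩ <;> linarith

lemma deltaY_pos (S : Setting P σ e) : 0 < deltaY P σ e :=
  S.deltaOut_pos.trans_le S.deltaY_terms.2.2.2.2

lemma driftCoef_pos (S : Setting P σ e) : 0 < driftCoef P σ e := by
  have := S.deltaG_pos
  have := S.deltaY_pos
  have := S.gain_sub_pos
  rw [driftCoef]; positivity

/-! ### Smallness of ε* forced by condition (c) -/

lemma sqrt_mul_deltaY_lt (S : Setting P σ e) :
    √e * deltaY P σ e < σ * (P.k * P.Hm - P.lam) := by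
  have h := S.cond.cond_c
  rw [S.abs_decay] at h
  have h1 := S.deltaG_pos
  have h2 := S.decay_pos
  have h3 := S.sqrt_pos
  have h4 := S.valid.σ₀_pos
  have t1 : 0 ≤ (P.σ₀ + √e * deltaG P σ e * (1 - e * P.lam) ^ P.DM) *
      (|1 - e * P.k * P.Hm| ^ P.DM)⁻¹ := by positivity
  have t2 : 0 < √e * deltaG P σ e := by positivity
  have h5 : √e ^ 3 * deltaY P σ e / (1 - e * P.lam - |1 - e * P.k * P.Hm|) < σ := by linarith
  rw [div_lt_iff₀ (sub_pos.2 S.gain_lt)] at h5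
  -- The sign of 1 - ekH_m is not yet known; only 1 - ekH_m ≤ |1 - ekH_m| is used.
  have h6 : 1 - e * P.lam - |1 - e * P.k * P.Hm| ≤ e * (P.k * P.Hm - P.lam) := by
    have := le_abs_self (1 - e * P.k * P.Hm)
    linarith
  have h7 : √e ^ 3 * deltaY P σ e < σ * (e * (P.k * P.Hm - P.lam)) :=
    h5.trans_le (mul_le_mul_of_nonneg_left h6 S.sigma_pos.le)
  have e1 : √e ^ 3 * deltaY P σ e = e * (√e * deltaY P σ e) := by
    rw [← S.sqrt_sq]; simp only [Real.sqrt_mul_self h3.le]; ring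
  rw [e1] at h7
  have h8 : e * (√e * deltaY P σ e) < e * (σ * (P.k * P.Hm - P.lam)) := by linarith
  exact lt_of_mul_lt_mul_left h8 S.e_pos.le

/-- Applied with x a single term of Δ_Y: bounding that term below by a multiple of kH_Mσ makes this
factor cancel. -/
lemma sqrt_mul_lt_of_le (S : Setting P σ e) {x : ℝ} (hx : x ≤ deltaY P σ e) :
    √e * x < P.k * P.HM * σ := by
  have h1 := S.sqrt_mul_deltaY_lt
  have h2 := mul_le_mul_of_nonneg_left hx S.sqrt_pos.le
  have h3 : σ * (P.k * P.Hm - P.lam) ≤ P.k * P.HM * σ := by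
    have := mul_le_mul_of_nonneg_left S.hess_le S.valid.k_pos.le
    have := S.valid.lam_pos
    have h4 : P.k * P.Hm - P.lam ≤ P.k * P.HM := by linarith
    nlinarith [S.sigma_pos]
  linarith

/-- `ε*` is small. -/
lemma sqrt_le (S : Setting P σ e) : √e ≤ 2 / 27 := by
  have h1 := S.sqrt_mul_lt_of_le S.deltaY_terms.2.2.2.2
  have h2 := S.deltaOut_ge_pi
  have h3 := S.sqrt_pos
  have hk := S.valid.k_pos
  have hM := S.valid.HM_pos
  have hσ := S.sigma_pos
  have h4 : P.k * P.HM * σ ≤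
      P.k * P.HM * (σ + P.α₀ * ampNorm P) * (ampNorm P * invAmpNorm P) := by
    have h5 := mul_pos S.valid.α₀_pos S.ampNorm_pos
    calc P.k * P.HM * σ = P.k * P.HM * (σ + 0) * 1 := by ring
      _ ≤ _ := by
        gcongr
        exact S.one_le_amp_mul
  have h6 := Real.pi_gt_d2
  set X := P.k * P.HM * σ with hX
  have hXp : 0 < X := by positivity
  have h7 : 4 * Real.pi * X ≤ (1 - √e) * deltaOut P σ e :=
    le_trans (by gcongr) h2
  have h8 : √e * (4 * Real.pi * X) ≤ (1 - √e) * (√e * deltaOut P σ e) := by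
    have := mul_le_mul_of_nonneg_left h7 h3.le
    linarith
  have h9 : (1 - √e) * (√e * deltaOut P σ e) < (1 - √e) * X :=
    mul_lt_mul_of_pos_left h1 (sub_pos.2 S.sqrt_lt_one)
  have h10 : √e * (4 * Real.pi) * X < (1 - √e) * X := by linarith
  have h11 := lt_of_mul_lt_mul_right h10 hXp.le
  -- Here 4π√e < 1 - √e, so √e < 1/(1 + 4π) < 2/27.
  nlinarith

lemma four_mul_le_radius_sq (_ : Setting P σ e) :
    4 * σ * (P.α₀ * ampNorm P) ≤ (σ + P.α₀ * ampNorm P) ^ 2 := by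
  nlinarith [sq_nonneg (σ - P.α₀ * ampNorm P)]

/-- From the term ρ₁Δ', where Δ' ≥ 4kH_Mσ by (σ + α₀A)² ≥ 4σα₀A and AB ≥ 1. The constant is 1/(4 ·
0.19245) < 1.3. -/
lemma gain_delay_le (S : Setting P σ e) : √e * P.DM * (P.k * P.HM) ≤ 1.3 := by
  have h1 := S.sqrt_mul_lt_of_le S.deltaY_terms.2.1
  have hk := S.valid.k_pos
  have hM := S.valid.HM_pos
  have hσ := S.sigma_pos
  have hα := S.valid.α₀_pos
  have hA := S.ampNorm_pos
  have hB := S.invAmpNorm_pos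
  have hs := S.sqrt_pos
  have h2 : 4 * (P.k * P.HM * σ) ≤ deltaStep P σ e := by
    refine le_trans ?_ (S.delta_ge.trans S.delta_le_deltaStep)
    rw [le_div_iff₀ hα]
    calc 4 * (P.k * P.HM * σ) * P.α₀ = P.k * P.HM * (4 * σ * P.α₀) * 1 := by ring
      _ ≤ P.k * P.HM * (4 * σ * P.α₀) * (ampNorm P * invAmpNorm P) := by
          gcongr; exact S.one_le_amp_mul
      _ = P.k * P.HM * (4 * σ * (P.α₀ * ampNorm P)) * invAmpNorm P := by ring
      _ ≤ _ := by gcongr; exact S.four_mul_le_radius_sq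
  set X := P.k * P.HM * σ with hX
  have hXp : 0 < X := by positivity
  have h3 : √e * (0.19245 * P.DM * P.k * P.HM * (4 * X)) ≤ √e * (rho1 P * deltaStep P σ e) := by
    gcongr
    · exact S.rho1_pos.le
    · exact S.rho1_ge
  have h4 : √e * P.DM * (P.k * P.HM) * 0.7698 * X < 1 * X := by linarith
  have := lt_of_mul_lt_mul_right h4 hXp.le
  linarith

/-- From the term ω_hρ₂σ_y/α₀ with σ_y ≥ 2H_Mσα₀|a₁|; the constant is again 1/0.7698. -/
lemma filter_gain_le (S : Setting P σ e) : √e * P.ωh ≤ 1.3 := by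
  have h1 := S.sqrt_mul_lt_of_le S.deltaY_terms.2.2.1
  have hk := S.valid.k_pos
  have hM := S.valid.HM_pos
  have hσ := S.sigma_pos
  have hα := S.valid.α₀_pos
  have hA := S.ampNorm_pos
  have hs := S.sqrt_pos
  have hω := S.valid.ωh_pos
  have ha := S.amp_first_pos
  have hD := S.one_le_DM
  have hη := S.sigmaEta_pos
  have r4 := S.rho4_pos
  have r2 := S.rho2_pos
  have h2 : P.HM / 2 * (4 * σ * (P.α₀ * |P.a S.first|)) ≤ sigmaY P σ e := by
    refine le_trans ?_ S.sigmaY_ge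
    refine mul_le_mul_of_nonneg_left (le_trans ?_ S.four_mul_le_radius_sq) (by positivity)
    gcongr
    exact abs_le_ampNorm P _
  have h3 : 2 * (0.19245 * 1 * P.k / |P.a S.first|) ≤ rho2 P := by
    rw [rho2_eq]
    have := S.rho4_ge
    have : 0.19245 * 1 * P.k / |P.a S.first| ≤ 0.19245 * P.DM * P.k / |P.a S.first| := by gcongr
    linarith
  set X := P.k * P.HM * σ with hX
  have hXp : 0 < X := by positivity
  have h4 : √e * P.ωh * 0.7698 * X ≤
      √e * (P.ωh * rho2 P / P.α₀ * (sigmaY P σ e + sigmaEta P σ e)) := by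
    calc √e * P.ωh * 0.7698 * X = √e * (P.ωh * (2 * (0.19245 * 1 * P.k / |P.a S.first|)) / P.α₀ *
          (P.HM / 2 * (4 * σ * (P.α₀ * |P.a S.first|)) + 0)) := by
          rw [hX]; field_simp; ring
      _ ≤ _ := by gcongr
  have h5 : √e * P.ωh * 0.7698 * X < 1 * X := by linarith
  have := lt_of_mul_lt_mul_right h5 hXp.le
  linarith

/-- From the term 2ρ₄σH_MΔ'/α₀; the constant is 1/0.3849 < 2.6. -/
lemma step_delay_le (S : Setting P σ e) :
    √e * P.DM * deltaStep P σ e ≤ 2.6 * (P.α₀ * |P.a S.first|) := by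
  have h1 := S.sqrt_mul_lt_of_le S.deltaY_terms.2.2.2.1
  have hk := S.valid.k_pos
  have hM := S.valid.HM_pos
  have hσ := S.sigma_pos
  have hα := S.valid.α₀_pos
  have hs := S.sqrt_pos
  have ha := S.amp_first_pos
  have hS := S.deltaStep_pos
  set X := P.k * P.HM * σ with hX
  have hXp : 0 < X := by positivity
  have h2 : 0.3849 * (√e * P.DM * deltaStep P σ e) / (P.α₀ * |P.a S.first|) * X ≤
      √e * (2 * rho4 P * σ * P.α₀⁻¹ * P.HM * deltaStep P σ e) := by
    calc _ = √e * (2 * (0.19245 * P.DM * P.k / |P.a S.first|) * σ * P.α₀⁻¹ * P.HM *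
          deltaStep P σ e) := by rw [hX]; field_simp; ring
      _ ≤ _ := by gcongr; exact S.rho4_ge
  have h3 : 0.3849 * (√e * P.DM * deltaStep P σ e) / (P.α₀ * |P.a S.first|) * X < 1 * X := by
    linarith
  have h4 := lt_of_mul_lt_mul_right h3 hXp.le
  rw [div_lt_one (by positivity)] at h4
  have : 0 < P.α₀ * |P.a S.first| := by positivity
  linarith

lemma step_delay_le_amp (S : Setting P σ e) :
    √e * P.DM * deltaStep P σ e ≤ 2.6 * (P.α₀ * ampNorm P) := by
  have hα := S.valid.α₀_pos
  refine S.step_delay_le.trans ?_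
  gcongr
  exact abs_le_ampNorm P _

/-- With R = σ + α₀A, one of the two factors R in Δ' ≥ kH_MR²B/α₀ is traded through RB/α₀ ≥ AB ≥ 1.
-/
lemma gain_delay_radius_le (S : Setting P σ e) :
    √e * P.DM * (P.k * P.HM) * (σ + P.α₀ * ampNorm P) ≤ 2.6 * (P.α₀ * ampNorm P) := by
  have hk := S.valid.k_pos
  have hM := S.valid.HM_pos
  have hα := S.valid.α₀_pos
  have hA := S.ampNorm_pos
  have hs := S.sqrt_pos
  have hR := S.radius_pos
  have hD := S.one_le_DM
  have hB := S.invAmpNorm_pos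
  have h1 := S.step_delay_le_amp
  have h2 := S.delta_ge.trans S.delta_le_deltaStep
  set R := σ + P.α₀ * ampNorm P with hR'
  have hRA : P.α₀ * ampNorm P ≤ R := by linarith [S.sigma_pos]
  have h3 : √e * P.DM * (P.k * P.HM * R ^ 2 * invAmpNorm P / P.α₀) ≤
      2.6 * (P.α₀ * ampNorm P) :=
    le_trans (by gcongr) h1
  refine le_trans ?_ h3
  calc √e * P.DM * (P.k * P.HM) * R = √e * P.DM * (P.k * P.HM * R * 1) := by ring
    _ ≤ √e * P.DM * (P.k * P.HM * R * (P.α₀ * ampNorm P * invAmpNorm P / P.α₀)) := by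
        gcongr
        rw [mul_assoc, mul_div_cancel_left₀ _ hα.ne']
        exact S.one_le_amp_mul
    _ ≤ √e * P.DM * (P.k * P.HM * R * (R * invAmpNorm P / P.α₀)) := by gcongr
    _ = _ := by ring

lemma lam_delay_le (S : Setting P σ e) : √e * P.DM * P.lam ≤ 1.3 := by
  refine le_trans ?_ S.gain_delay_le
  have h1 := S.valid.gain
  have h2 := mul_le_mul_of_nonneg_left S.hess_le S.valid.k_pos.le
  have hs := S.sqrt_pos
  gcongr
  linarith

/-- One more factor √e ≤ 2/27 gives 1.3 · 2/27 < 0.0963, the number that bounds the products of e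
with the gains from here on. -/
lemma e_gain_delay_le (S : Setting P σ e) : e * P.DM * (P.k * P.HM) ≤ 0.0963 := by
  have h1 := S.gain_delay_le
  have h2 := S.sqrt_le
  have h3 : e * P.DM * (P.k * P.HM) = √e * (√e * P.DM * (P.k * P.HM)) := by
    linear_combination (-(P.DM * (P.k * P.HM))) * S.sqrt_sq
  have hk := S.valid.k_pos
  have hM := S.valid.HM_pos
  rw [h3]
  have : √e * (√e * P.DM * (P.k * P.HM)) ≤ 2 / 27 * 1.3 := by gcongr
  norm_num at this ⊢
  linarith

lemma e_lam_delay_le (S : Setting P σ e) : e * P.DM * P.lam ≤ 0.0963 := by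
  refine le_trans ?_ S.e_gain_delay_le
  have h1 := S.valid.gain
  have h2 := mul_le_mul_of_nonneg_left S.hess_le S.valid.k_pos.le
  have hs := S.e_pos
  gcongr
  linarith

lemma e_filter_le (S : Setting P σ e) : e * P.ωh ≤ 0.0963 := by
  have h1 := S.filter_gain_le
  have h2 := S.sqrt_le
  have h3 : e * P.ωh = √e * (√e * P.ωh) := by rw [← mul_assoc, S.sqrt_sq]
  have hω := S.valid.ωh_pos
  rw [h3]
  have : √e * (√e * P.ωh) ≤ 2 / 27 * 1.3 := by gcongr
  norm_num at this ⊢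
  linarith

lemma abs_filter (S : Setting P σ e) : |1 - e * P.ωh| = 1 - e * P.ωh :=
  abs_of_pos (by linarith [S.e_filter_le])

lemma e_gain_le (S : Setting P σ e) : e * (P.k * P.HM) ≤ 0.0963 := by
  refine le_trans ?_ S.e_gain_delay_le
  have hk := S.valid.k_pos
  have hM := S.valid.HM_pos
  have he := S.e_pos
  have hD := S.one_le_DM
  calc e * (P.k * P.HM) = e * 1 * (P.k * P.HM) := by ring
    _ ≤ _ := by gcongr

lemma e_gain_lower_le (S : Setting P σ e) : e * (P.k * P.Hm) ≤ 0.0963 := by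
  refine le_trans ?_ S.e_gain_le
  have hk := S.valid.k_pos
  have he := S.e_pos
  have := S.hess_le
  gcongr

/-- The increment bound exceeds Δ only by the loss (1 - eλ)^(-2D_M) - 1 contained in σ_y, of order
eD_Mλ. The part √e Δ_out of Δ' swallows it, since 2.5 · 2.6 ≤ 4π. -/
lemma rawStep_le_deltaStep (S : Setting P σ e) : rawStep P σ e ≤ deltaStep P σ e := by
  have hk := S.valid.k_pos
  have hM := S.valid.HM_pos
  have hα := S.valid.α₀_pos
  have hA := S.ampNorm_pos
  have hs := S.sqrt_pos
  have hR := S.radius_pos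
  have hB := S.invAmpNorm_pos
  have hlam := S.valid.lam_pos
  have hO : 4 * Real.pi * (P.k * P.HM * (σ + P.α₀ * ampNorm P) * (ampNorm P * invAmpNorm P)) ≤
      deltaOut P σ e := by
    refine S.deltaOut_ge_pi.trans (mul_le_of_le_one_left S.deltaOut_pos.le ?_)
    linarith
  have hpow : 1 - 2 * (e * P.DM * P.lam) ≤ (1 - e * P.lam) ^ (2 * P.DM) := by
    have := one_add_mul_le_pow (a := -(e * P.lam)) (by linarith [S.decay_pos]) (2 * P.DM)
    push_cast at this
    rw [← sub_eq_add_neg] at this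
    linarith
  have hx := S.e_lam_delay_le
  have hq := pow_pos S.decay_pos (2 * P.DM)
  -- 2x/(1 - 2x) ≤ 2.5x for x ≤ 0.0963.
  have hinv : ((1 - e * P.lam) ^ (2 * P.DM))⁻¹ - 1 ≤ 2.5 * (e * P.DM * P.lam) := by
    have hx0 : 0 ≤ e * P.DM * P.lam := by have := S.e_pos; positivity
    rw [sub_le_iff_le_add, inv_le_iff_one_le_mul₀ hq]
    have : (2.5 * (e * P.DM * P.lam) + 1) * (1 - 2 * (e * P.DM * P.lam)) ≤
        (2.5 * (e * P.DM * P.lam) + 1) * (1 - e * P.lam) ^ (2 * P.DM) := by gcongr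
    nlinarith
  set R := σ + P.α₀ * ampNorm P with hR'
  have e1 : rawStep P σ e = delta P σ e +
      (((1 - e * P.lam) ^ (2 * P.DM))⁻¹ - 1) * (P.k * P.HM * R ^ 2 * invAmpNorm P / P.α₀) := by
    rw [rawStep, delta, S.sigmaY_eq]; ring
  rw [e1, deltaStep]
  refine add_le_add le_rfl ?_
  have hlk : P.lam ≤ P.k * P.HM :=
    S.valid.gain.le.trans (mul_le_mul_of_nonneg_left S.hess_le hk.le)
  calc _ ≤ 2.5 * (e * P.DM * P.lam) * (P.k * P.HM * R ^ 2 * invAmpNorm P / P.α₀) := by gcongr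
    _ ≤ 2.5 * (e * P.DM * (P.k * P.HM)) * (P.k * P.HM * R ^ 2 * invAmpNorm P / P.α₀) := by
        have := S.e_pos
        gcongr
    _ = 2.5 * √e * (√e * P.DM * (P.k * P.HM) * R) * (P.k * P.HM * R * invAmpNorm P / P.α₀) := by
        linear_combination (-(2.5 * P.DM * (P.k * P.HM) *
          (P.k * P.HM * R ^ 2 * invAmpNorm P / P.α₀))) * S.sqrt_sq
    _ ≤ 2.5 * √e * (2.6 * (P.α₀ * ampNorm P)) * (P.k * P.HM * R * invAmpNorm P / P.α₀) := by
        exact mul_le_mul_of_nonneg_right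
          (mul_le_mul_of_nonneg_left S.gain_delay_radius_le (by positivity)) (by positivity)
    _ = √e * (6.5 * (P.k * P.HM * R * (ampNorm P * invAmpNorm P))) := by
        field_simp; ring
    _ ≤ √e * (4 * Real.pi * (P.k * P.HM * R * (ampNorm P * invAmpNorm P))) := by
        gcongr
        linarith [Real.pi_gt_d2]
    _ ≤ _ := by gcongr

/-- The conditions bound the normalized estimation error by `σ`. -/
lemma sigmaAt_lt (S : Setting P σ e) : sigmaAt P σ e e < σ := by
  have h := S.cond.cond_c
  have hk0 : 0 < 1 - e * P.k * P.Hm := by linarith [S.e_gain_lower_le]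
  have hkap := S.gain_lt
  rw [abs_of_pos hk0] at hkap
  rw [S.abs_decay, abs_of_pos hk0] at h
  have hG := S.deltaG_pos
  have hs := S.sqrt_pos
  have hd := S.decay_pos
  have hσ0 := S.valid.σ₀_pos
  have e1 : √e ^ 3 * deltaY P σ e / (1 - e * P.lam - (1 - e * P.k * P.Hm)) =
      √e * (deltaY P σ e / (P.k * P.Hm - P.lam)) := by
    have h1 := S.gain_sub_pos
    have e2 : 1 - e * P.lam - (1 - e * P.k * P.Hm) = √e * √e * (P.k * P.Hm - P.lam) := by
      rw [S.sqrt_sq]; ring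
    rw [e2]
    field_simp
  rw [e1, add_mul] at h
  -- Replacing κ* by μ* weakens (c), and what remains depends on the parameter only through √ε once
  -- σ₀μ*^(-D_M) is kept fixed.
  have hp : (1 - e * P.k * P.Hm) ^ P.DM ≤ (1 - e * P.lam) ^ P.DM :=
    pow_le_pow_left₀ hk0.le hkap.le _
  have hkp := pow_pos hk0 P.DM
  have h2 : P.σ₀ * ((1 - e * P.lam) ^ P.DM)⁻¹ ≤ P.σ₀ * ((1 - e * P.k * P.Hm) ^ P.DM)⁻¹ := by
    gcongr
  have h3 : √e * deltaG P σ e ≤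
      √e * deltaG P σ e * (1 - e * P.lam) ^ P.DM * ((1 - e * P.k * P.Hm) ^ P.DM)⁻¹ := by
    rw [mul_assoc]
    refine le_mul_of_one_le_right (by positivity) ?_
    rwa [← div_eq_mul_inv, one_le_div hkp]
  rw [sigmaAt, driftCoef]
  linarith

lemma sigmaAt_add (P : Params n) (σ e ε : ℝ) :
    sigmaAt P σ e ε = sigmaAt P σ e e - (√e - √ε) * driftCoef P σ e := by
  rw [sigmaAt, sigmaAt]; ring

lemma sigmaAt_lt_of_le (S : Setting P σ e) {ε : ℝ} (h : ε ≤ e) : sigmaAt P σ e ε < σ := by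
  have h1 := S.sigmaAt_lt
  have h2 := mul_nonneg (sub_nonneg.2 (Real.sqrt_le_sqrt h)) S.driftCoef_pos.le
  rw [sigmaAt_add]; linarith

lemma init_le_sigmaAt (S : Setting P σ e) (ε : ℝ) :
    P.σ₀ * ((1 - e * P.lam) ^ P.DM)⁻¹ ≤ sigmaAt P σ e ε := by
  have := mul_nonneg (Real.sqrt_nonneg ε) S.driftCoef_pos.le
  rw [sigmaAt]; linarith

lemma sigmaAt_pos (S : Setting P σ e) (ε : ℝ) : 0 < sigmaAt P σ e ε := by
  have h1 := S.valid.σ₀_pos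
  have h2 := S.decay_pos
  exact lt_of_lt_of_le (by positivity) (S.init_le_sigmaAt ε)

lemma drift_ge (S : Setting P σ e) : 3 * deltaG P σ e ≤ driftCoef P σ e := by
  have h1 : deltaG P σ e ≤ deltaY P σ e / (P.k * P.Hm - P.lam) := by
    rw [le_div_iff₀ S.gain_sub_pos]
    refine le_trans ?_ S.deltaY_terms.1
    rw [mul_comm]
    have := mul_le_mul_of_nonneg_left S.hess_le S.valid.k_pos.le
    have := S.valid.lam_pos
    have := S.deltaG_pos
    gcongr
    linarith
  rw [driftCoef]; linarith

/-- The asymptotic gain of the filter is not monotone in `ε`; this is compensated by the smaller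
estimation error. -/
lemma filter_bound_le (S : Setting P σ e) {ε : ℝ} (h0 : 0 < ε) (h : ε ≤ e) :
    P.ωh * (P.HM / 2 * ((1 - e * P.lam) ^ (2 * P.DM))⁻¹ *
        (sigmaAt P σ e ε + P.α₀ * ampNorm P) ^ 2) /
      (P.ωh - 2 * P.lam + ε * P.lam ^ 2) ≤
    e * P.ωh * sigmaY P σ e / ((1 - e * P.lam) ^ 2 - |1 - e * P.ωh|) := by
  have hk := S.valid.k_pos
  have hM := S.valid.HM_pos
  have hα := S.valid.α₀_pos
  have hA := S.ampNorm_pos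
  have hs := S.sqrt_pos
  have hR := S.radius_pos
  have hlam := S.valid.lam_pos
  have hω := S.valid.ωh_pos
  have he := S.e_pos
  have hd := S.decay_pos
  have hG := S.deltaG_pos
  have hδ : 0 < P.ωh - 2 * P.lam := by linarith [S.valid.filter]
  have hsA := S.sigmaAt_pos ε
  set R := σ + P.α₀ * ampNorm P with hR'
  set R' := sigmaAt P σ e ε + P.α₀ * ampNorm P with hR''
  set q := P.ωh - 2 * P.lam + e * P.lam ^ 2 with hq
  set p := P.ωh - 2 * P.lam + ε * P.lam ^ 2 with hp
  have hqp : 0 < q := by positivity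
  have hpp : 0 < p := by positivity
  have hR'p : 0 < R' := by positivity
  have e1 : (1 - e * P.lam) ^ 2 - |1 - e * P.ωh| = e * q := by
    rw [S.abs_filter, hq]; ring
  have hη : P.ωh * (P.HM / 2 * R ^ 2) / q ≤ sigmaEta P σ e := by
    rw [S.sigmaEta_eq, e1]
    have h1 : 0 ≤ P.ΔQ * (|1 - e * P.ωh| ^ P.DM)⁻¹ := by
      have := S.valid.ΔQ_pos; positivity
    have h2 : e * P.ωh * sigmaY P σ e / (e * q) = P.ωh * sigmaY P σ e / q := by
      field_simp
    rw [h2]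
    have h3 : P.ωh * (P.HM / 2 * R ^ 2) / q ≤ P.ωh * sigmaY P σ e / q := by
      gcongr; exact S.sigmaY_ge
    linarith
  -- a lower bound on the averaging error
  have hGq : 0.3849 * P.lam ^ 2 * R ≤ deltaG P σ e * q := by
    have h1 : rho2 P * (sigmaEta P σ e / P.α₀) ≤ deltaG P σ e := by
      rw [deltaG]
      have := S.rho1_pos
      have := S.rho3_nonneg
      have := S.rho4_pos
      have := S.sigma_pos
      have t1 : 0 ≤ rho1 P * σ := by positivity
      have t2 : 0 ≤ rho3 P e * P.α₀ := by positivity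
      have t3 : 0 ≤ rho4 P * (σ ^ 2 * P.HM / P.α₀) := by positivity
      linarith
    have ha := S.amp_first_pos
    have hD := S.one_le_DM
    have h2 : 2 * (0.19245 * 1 * P.k / |P.a S.first|) ≤ rho2 P := by
      rw [rho2_eq]
      have := S.rho4_ge
      have : 0.19245 * 1 * P.k / |P.a S.first| ≤ 0.19245 * P.DM * P.k / |P.a S.first| := by gcongr
      linarith
    have r2 := S.rho2_pos
    have hkl : P.lam ≤ P.k * P.HM :=
      S.valid.gain.le.trans (mul_le_mul_of_nonneg_left S.hess_le hk.le)
    have hRa : P.α₀ * |P.a S.first| ≤ R := by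
      have := mul_le_mul_of_nonneg_left (abs_le_ampNorm P S.first) hα.le
      linarith [S.sigma_pos]
    have hωl : 2 * P.lam ≤ P.ωh := by linarith
    calc 0.3849 * P.lam ^ 2 * R = 0.19245 * P.lam * (2 * P.lam) * R := by ring
      _ ≤ 0.19245 * (P.k * P.HM) * P.ωh * R := by gcongr
      _ = 0.19245 * (P.k * P.HM) * P.ωh * R * (P.α₀ * |P.a S.first|) /
          (P.α₀ * |P.a S.first|) := by field_simp
      _ ≤ 0.19245 * (P.k * P.HM) * P.ωh * R * R / (P.α₀ * |P.a S.first|) := by gcongr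
      _ = 2 * (0.19245 * 1 * P.k / |P.a S.first|) * (P.ωh * (P.HM / 2 * R ^ 2) / q / P.α₀) * q := by
          field_simp
      _ ≤ rho2 P * (sigmaEta P σ e / P.α₀) * q := by gcongr
      _ ≤ _ := by gcongr
  -- the averaging error is smaller than `σ`
  have hGσ : 3 * (√e * deltaG P σ e) < R := by
    have h1 := S.sigmaAt_lt
    have h2 : √e * (3 * deltaG P σ e) ≤ √e * driftCoef P σ e := by
      gcongr; exact S.drift_ge
    have h3 : 0 ≤ P.σ₀ * ((1 - e * P.lam) ^ P.DM)⁻¹ := by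
      have := S.valid.σ₀_pos; positivity
    rw [sigmaAt] at h1
    have := mul_pos hα hA
    linarith
  -- Combining 3√eΔ_G < R with Δ_G q ≥ 0.3849λ²R gives 1.1547√eλ² ≤ q; a further factor √e ≤ 2/27
  -- does the rest.
  have hsq : e * P.lam ^ 2 ≤ 0.1 * q := by
    have h1 : 0.3849 * 3 * √e * P.lam ^ 2 * R ≤ q * R := by
      have h2 : 3 * √e * (0.3849 * P.lam ^ 2 * R) ≤ 3 * √e * (deltaG P σ e * q) := by gcongr
      have h3 := mul_le_mul_of_nonneg_right hGσ.le hqp.le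
      linarith
    have h4 := le_of_mul_le_mul_right h1 hR
    have h5 : √e * (0.3849 * 3 * √e * P.lam ^ 2) ≤ 2 / 27 * q := by
      have := S.sqrt_le
      gcongr
    have h6 : √e * (0.3849 * 3 * √e * P.lam ^ 2) = 1.1547 * (e * P.lam ^ 2) := by
      rw [← S.sqrt_sq]; simp only [Real.sqrt_mul_self hs.le]; ring
    linarith
  have hpq : 0.9 * q ≤ p := by
    have : 0 ≤ ε * P.lam ^ 2 := by positivity
    linarith
  have hgap : √e * P.lam ^ 2 * R ≤ 3 * deltaG P σ e * p := by
    have h1 : 3 * deltaG P σ e * (0.9 * q) ≤ 3 * deltaG P σ e * p := by gcongr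
    have h2 : √e * P.lam ^ 2 * R ≤ 2 / 27 * P.lam ^ 2 * R := by
      have := S.sqrt_le
      gcongr
    have h3 : 0 ≤ P.lam ^ 2 * R := by positivity
    linarith
  have hRR : R' + (√e - √ε) * (3 * deltaG P σ e) ≤ R := by
    have h1 := S.sigmaAt_lt
    have h2 := mul_le_mul_of_nonneg_left S.drift_ge (sub_nonneg.2 (Real.sqrt_le_sqrt h))
    have h3 := sigmaAt_add P σ e ε
    linarith
  have hsub : 0 ≤ √e - √ε := sub_nonneg.2 (Real.sqrt_le_sqrt h)
  -- The radius gains (√e - √ε) · 3Δ_G, whereas the denominator loses at most (√e - √ε) · 2√e · λ².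
  have hmain : R' ^ 2 * q ≤ R ^ 2 * p := by
    have hqd : q - p = (√e - √ε) * (√e + √ε) * P.lam ^ 2 := by
      have h1 := S.sqrt_sq
      have h2 := Real.mul_self_sqrt h0.le
      have : (√e - √ε) * (√e + √ε) = e - ε := by linear_combination h1 - h2
      rw [this, hq, hp]; ring
    refine sq_mul_le_sq_mul hR'p.le hpp.le hsub (by positivity) (by positivity) ?_ hRR hgap
    rw [hqd]
    have := Real.sqrt_le_sqrt h
    gcongr
    linarith
  rw [e1, S.sigmaY_eq, ← hR']
  rw [div_le_div_iff₀ hpp (by positivity)]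
  have hC : 0 ≤ e * P.ωh * (P.HM / 2) * ((1 - e * P.lam) ^ (2 * P.DM))⁻¹ := by positivity
  have := mul_le_mul_of_nonneg_left hmain hC
  linarith

end Setting

/-- Allows the bound T/4 for the centred antiderivative to be compared with ρ₃. With x = nD_M the
first summand of c_i is at least x²/6, enough for x ≥ 2. If x = 1 then n = 1, and the second summand
adds 0.09 > 1/12. -/
lemma cCoef_ge (P : Params n) {e : ℝ} (hD : 0 < P.DM) (i : Fin n) :
    (n : ℝ) * P.DM / 4 ≤ cCoef P e i := by
  have hn : 0 < n := i.pos
  have hs := Real.sqrt_nonneg e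
  have hp : (0 : ℝ) ≤ (n : ℝ) * P.DM := by positivity
  have hpi := Real.pi_pos
  have hx : (1 : ℝ) ≤ (n : ℝ) * P.DM := by exact_mod_cast Nat.mul_pos hn hD
  have h1 : ((n : ℝ) * P.DM) ^ 2 / 6 ≤ (n * P.DM + √e) * (2 * n * P.DM + √e) / 12 := by
    have : 0 ≤ √e * ((n : ℝ) * P.DM) := by positivity
    nlinarith
  have h2 : (P.DM : ℝ) ^ 2 * (n : ℝ) ^ 2 * (1 + 0) / (3.3072 * Real.pi * ((i : ℝ) + 1)) ≤
      (√e * (√e + n * P.DM) +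
        (P.DM : ℝ) ^ 2 * (n : ℝ) ^ 2 * (1 + 1 / (3.3072 * Real.pi * ((i : ℝ) + 1)))) /
      (3.3072 * Real.pi * ((i : ℝ) + 1)) := by
    gcongr ?_ / _
    have h3 : 0 ≤ √e * (√e + n * P.DM) := by positivity
    have h4 : (P.DM : ℝ) ^ 2 * (n : ℝ) ^ 2 * (1 + 0) ≤
        (P.DM : ℝ) ^ 2 * (n : ℝ) ^ 2 * (1 + 1 / (3.3072 * Real.pi * ((i : ℝ) + 1))) := by
      gcongr; positivity
    linarith
  rw [cCoef]
  rcases eq_or_lt_of_le (Nat.succ_le_of_lt (Nat.mul_pos hn hD)) with h | h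
  · have hn1 : n = 1 := Nat.eq_one_of_mul_eq_one_right h.symm
    have hi : (i : ℝ) = 0 := by
      have : (i : ℕ) = 0 := by omega
      exact_mod_cast this
    have hx1 : (n : ℝ) * P.DM = 1 := by exact_mod_cast h.symm
    have h5 : (P.DM : ℝ) ^ 2 * (n : ℝ) ^ 2 = 1 := by
      rw [← mul_pow, mul_comm, hx1, one_pow]
    rw [h5, hi, hx1] at h2
    have e2 : (2 : ℝ) * n * P.DM = 2 * (n * P.DM) := by ring
    rw [e2, hx1] at h1 ⊢
    rw [h5, hi]
    have h6 : 0.09 ≤ 1 * (1 + 0) / (3.3072 * Real.pi * (0 + 1)) := by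
      rw [le_div_iff₀ (by positivity)]
      linarith [Real.pi_lt_d2]
    linarith
  · have hx2 : (2 : ℝ) ≤ (n : ℝ) * P.DM := by exact_mod_cast h
    have h7 : 0 ≤ (P.DM : ℝ) ^ 2 * (n : ℝ) ^ 2 * (1 + 0) /
      (3.3072 * Real.pi * ((i : ℝ) + 1)) := by positivity
    nlinarith

/-- The bound on the normalized correction to the estimate in terms of the normalized
estimation error `r`. -/
def corrBound (P : Params n) (σ e r : ℝ) : ℝ :=
  rho1 P * r + rho2 P * (sigmaEta P σ e / P.α₀) + rho3 P e * P.α₀ +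
    rho4 P * (r ^ 2 * P.HM / P.α₀)

namespace Setting

variable {P : Params n} {σ e ε : ℝ}

/-! ### The period -/

lemma sqrt_small (S : Setting P σ e) (h : ε ≤ e) : √ε ≤ 2 / 27 :=
  (Real.sqrt_le_sqrt h).trans S.sqrt_le

lemma thirteen_le_floor (S : Setting P σ e) (h0 : 0 < ε) (h : ε ≤ e) : 13 ≤ ⌊1 / √ε⌋₊ := by
  apply Nat.le_floor
  have hs := Real.sqrt_pos.2 h0
  rw [le_div_iff₀ hs]
  have := S.sqrt_small h
  push_cast
  linarith

lemma period_eq (S : Setting P σ e) (h0 : 0 < ε) (h : ε ≤ e) :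
    period P ε = n * P.DM * ⌊1 / √ε⌋₊ := by
  apply max_eq_left
  have h1 := S.thirteen_le_floor h0 h
  have h2 := S.dim_pos
  have h3 := S.DM_pos
  calc 2 * n + 1 ≤ n * 1 * 13 := by omega
    _ ≤ _ := by gcongr; exact h3

lemma thirteen_dim_le (S : Setting P σ e) (h0 : 0 < ε) (h : ε ≤ e) : 13 * n ≤ period P ε := by
  rw [S.period_eq h0 h]
  have h1 := S.thirteen_le_floor h0 h
  have h3 := S.DM_pos
  calc 13 * n = n * 1 * 13 := by ring
    _ ≤ _ := by gcongr; exact h3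

/-- The source of the order √ε: antiderivatives are O(T), and T ≤ nD_M/√ε. -/
lemma eps_period_le (S : Setting P σ e) (h0 : 0 < ε) (h : ε ≤ e) :
    ε * period P ε ≤ √ε * (n * P.DM) := by
  have hs := Real.sqrt_pos.2 h0
  have h1 : (⌊1 / √ε⌋₊ : ℝ) ≤ 1 / √ε := Nat.floor_le (by positivity)
  rw [le_div_iff₀ hs] at h1
  have h2 := Real.mul_self_sqrt h0.le
  rw [S.period_eq h0 h]
  push_cast
  calc ε * (n * P.DM * (⌊1 / √ε⌋₊ : ℝ)) = √ε * (n * P.DM) * (⌊1 / √ε⌋₊ * √ε) := by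
        linear_combination (-(n * P.DM * (⌊1 / √ε⌋₊ : ℝ))) * h2
    _ ≤ √ε * (n * P.DM) * 1 := by gcongr
    _ = _ := mul_one _

lemma topFreq_eq (S : Setting P σ e) (h0 : 0 < ε) (h : ε ≤ e) :
    2 * Real.pi * n / period P ε = 2 * Real.pi / (P.DM * ⌊1 / √ε⌋₊) := by
  have hn : (n : ℝ) ≠ 0 := by have := S.dim_pos; positivity
  have hD : (P.DM : ℝ) ≠ 0 := by have := S.DM_pos; positivity
  have hf : (⌊1 / √ε⌋₊ : ℝ) ≠ 0 := by have := S.thirteen_le_floor h0 h; positivity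
  rw [S.period_eq h0 h]
  push_cast
  field_simp

/-- Rounding down 1/√ε costs at most a factor 1 - √ε ≥ 1 - √e, the denominator that appears in
Δ_out. -/
lemma topFreq_le (S : Setting P σ e) (h0 : 0 < ε) (h : ε ≤ e) :
    2 * Real.pi * n / period P ε ≤ √ε * (2 * Real.pi / ((1 - √e) * P.DM)) := by
  have hs := Real.sqrt_pos.2 h0
  have hD := S.one_le_DM
  have hf : (0 : ℝ) < ⌊1 / √ε⌋₊ := by have := S.thirteen_le_floor h0 h; positivity
  have h1 : 1 / √ε < ⌊1 / √ε⌋₊ + 1 := Nat.lt_floor_add_one _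
  rw [div_lt_iff₀ hs] at h1
  have h2 : 1 - √e ≤ ⌊1 / √ε⌋₊ * √ε := by
    have := Real.sqrt_le_sqrt h
    linarith
  have h3 := sub_pos.2 S.sqrt_lt_one
  rw [S.topFreq_eq h0 h, ← mul_div_assoc, div_le_div_iff₀ (by positivity) (by positivity)]
  have := mul_le_mul_of_nonneg_left h2 (by positivity : 0 ≤ 2 * Real.pi * P.DM)
  linarith

lemma le_topFreq (S : Setting P σ e) (h0 : 0 < ε) (h : ε ≤ e) :
    2 * Real.pi * √ε ≤ P.DM * (2 * Real.pi * n / period P ε) := by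
  have hs := Real.sqrt_pos.2 h0
  have hD := S.one_le_DM
  have hf : (0 : ℝ) < ⌊1 / √ε⌋₊ := by have := S.thirteen_le_floor h0 h; positivity
  have h1 : (⌊1 / √ε⌋₊ : ℝ) ≤ 1 / √ε := Nat.floor_le (by positivity)
  rw [le_div_iff₀ hs] at h1
  have e1 : P.DM * (2 * Real.pi / (P.DM * (⌊1 / √ε⌋₊ : ℝ))) = 2 * Real.pi / ⌊1 / √ε⌋₊ := by
    field_simp
  rw [S.topFreq_eq h0 h, e1, le_div_iff₀ hf]
  have := mul_le_mul_of_nonneg_left h1 (by positivity : 0 ≤ 2 * Real.pi)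
  linarith

lemma delay_topFreq_le (S : Setting P σ e) (h0 : 0 < ε) (h : ε ≤ e) :
    P.DM * (2 * Real.pi * n / period P ε) ≤ 0.485 := by
  have hD := S.one_le_DM
  have h1 : (13 : ℝ) ≤ ⌊1 / √ε⌋₊ := by exact_mod_cast S.thirteen_le_floor h0 h
  have hf : (0 : ℝ) < ⌊1 / √ε⌋₊ := by linarith
  have e1 : P.DM * (2 * Real.pi / (P.DM * (⌊1 / √ε⌋₊ : ℝ))) = 2 * Real.pi / ⌊1 / √ε⌋₊ := by
    field_simp
  rw [S.topFreq_eq h0 h, e1, div_le_iff₀ hf]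
  linarith [Real.pi_lt_d2]

/-! ### Bounds on the antiderivatives -/

lemma demodPrim_bound (S : Setting P σ e) (h0 : 0 < ε) (h : ε ≤ e) (j : ℕ) :
    ε * P.k * ‖demodPrim P ε j‖ ≤ 0.9 * √ε * rho2 P := by
  have hk := S.valid.k_pos
  have h1 := norm_demodPrim_le (S.thirteen_dim_le h0 h) j
  have h2 := S.eps_period_le h0 h
  rw [rho2]
  set Z := ∑ i : Fin n, 1 / (((i : ℝ) + 1) * |P.a i|) with hZ
  have hZ0 : 0 ≤ Z := sum_nonneg fun i _ => by positivity
  calc ε * P.k * ‖demodPrim P ε j‖ ≤ ε * P.k * (34 / 100 * period P ε * Z) := by gcongr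
    _ = (ε * period P ε) * (0.34 * P.k * Z) := by ring
    _ ≤ (√ε * (n * P.DM)) * (0.34 * P.k * Z) := by gcongr
    -- The factor 0.9 saved here is spent in `norm_corrected_succ_le`, against the factor 1 - eω_h ≥
    -- 0.9 of Δ_Y.
    _ ≤ (√ε * (n * P.DM)) * (0.9 * 0.3849 * P.k * Z) := by gcongr; norm_num
    _ = _ := by ring

lemma corr_bound (S : Setting P σ e) (h0 : 0 < ε) (h : ε ≤ e) (j : ℕ)
    {H : Matrix (Fin n) (Fin n) ℝ} (hH : FormBetween (hess H) P.Hm P.HM)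
    (x : EuclideanSpace ℝ (Fin n)) :
    ε * P.k * ‖hess (corrMatrix P ε j) (hess H x)‖ ≤ √ε * rho1 P * ‖x‖ := by
  have hk := S.valid.k_pos
  have hM := S.valid.HM_pos
  have h1 := abs_hess_norm_le _ (sum_abs_corrMatrix_le (S.thirteen_dim_le h0 h) j) (hess H x)
  have h2 := S.eps_period_le h0 h
  have h3 := hH.norm_le S.valid.Hm_pos hM x
  rw [rho1]
  set Z := (∑ i : Fin n, 1 / ((i : ℝ) + 1)) +
        ∑ i : Fin n, ∑ l ∈ univ.filter (fun l : Fin n => l ≠ i),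
          |P.a l| / |P.a i| *
            (1 / |((i : ℝ) + 1) - ((l : ℝ) + 1)| + 1 / (((i : ℝ) + 1) + ((l : ℝ) + 1))) with hZ
  have hZ0 : 0 ≤ Z := add_nonneg (sum_nonneg fun i _ => by positivity)
    (sum_nonneg fun i _ => sum_nonneg fun l _ => by positivity)
  calc _ ≤ ε * P.k * (17 / 100 * period P ε * Z * ‖hess H x‖) := by gcongr
    _ ≤ ε * P.k * (17 / 100 * period P ε * Z * (P.HM * ‖x‖)) := by gcongr
    _ = (ε * period P ε) * (0.17 * P.k * P.HM * Z * ‖x‖) := by ring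
    _ ≤ (√ε * (n * P.DM)) * (0.17 * P.k * P.HM * Z * ‖x‖) := by gcongr
    _ ≤ (√ε * (n * P.DM)) * (0.19245 * P.k * P.HM * Z * ‖x‖) := by gcongr; norm_num
    _ = _ := by ring

lemma cubicPrim_bound (S : Setting P σ e) (h0 : 0 < ε) (h : ε ≤ e) (j : ℕ)
    {H : Matrix (Fin n) (Fin n) ℝ} (hH : FormBetween (hess H) P.Hm P.HM) :
    ε * P.k * ‖cubicPrim P ε H j‖ ≤ √ε * rho3 P e := by
  have hk := S.valid.k_pos
  have hM := S.valid.HM_pos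
  have h1 := norm_cubicPrim_le (P := P) (ε := ε) hH S.valid.Hm_pos hM j
  have h2 := S.eps_period_le h0 h
  have hA : ∑ s, P.a s ^ 2 = ampNorm P ^ 2 :=
    (Real.sq_sqrt (sum_nonneg fun _ _ => sq_nonneg _)).symm
  have hB : (n : ℝ) * P.DM / 4 * invAmpNorm P ≤ √(∑ i, cCoef P e i ^ 2 / P.a i ^ 2) := by
    rw [invAmpNorm]
    apply Real.le_sqrt_of_sq_le
    rw [mul_pow, Real.sq_sqrt (sum_nonneg fun _ _ => by positivity), mul_sum]
    refine sum_le_sum fun i _ => ?_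
    rw [mul_one_div]
    gcongr
    exact cCoef_ge P S.DM_pos i
  have hB0 := invAmpNorm_nonneg P
  rw [rho3, hA]
  calc _ ≤ ε * P.k * (period P ε / 4 * (P.HM * ampNorm P ^ 2) * invAmpNorm P) := by gcongr
    _ = (ε * period P ε) * (P.k * P.HM * ampNorm P ^ 2 * (1 / 4 * invAmpNorm P)) := by ring
    _ ≤ (√ε * (n * P.DM)) * (P.k * P.HM * ampNorm P ^ 2 * (1 / 4 * invAmpNorm P)) := by gcongr
    _ = √ε * (P.k * P.HM * ampNorm P ^ 2 * ((n : ℝ) * P.DM / 4 * invAmpNorm P)) := by ring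
    _ ≤ _ := by gcongr

/-! ### The decay rate for `ε ≤ ε*` -/

lemma decay_le (S : Setting P σ e) (h : ε ≤ e) : 1 - e * P.lam ≤ 1 - ε * P.lam := by
  have := mul_le_mul_of_nonneg_right h S.valid.lam_pos.le
  linarith

lemma decay_pos' (S : Setting P σ e) (h : ε ≤ e) : 0 < 1 - ε * P.lam :=
  S.decay_pos.trans_le (S.decay_le h)

lemma decay_lt_one' (S : Setting P σ e) (h0 : 0 < ε) : 1 - ε * P.lam < 1 := by
  have := mul_pos h0 S.valid.lam_pos
  linarith

lemma eps_lam_delay_le (S : Setting P σ e) (h : ε ≤ e) : ε * P.DM * P.lam ≤ 0.0963 := by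
  refine le_trans ?_ S.e_lam_delay_le
  have := S.valid.lam_pos
  gcongr

lemma inv_pow_decay_sub_le (S : Setting P σ e) (h0 : 0 < ε) (h : ε ≤ e) :
    ((1 - ε * P.lam) ^ P.DM)⁻¹ - 1 ≤ 1.107 * (ε * P.DM * P.lam) := by
  have hl := S.valid.lam_pos
  have hpow : 1 - ε * P.DM * P.lam ≤ (1 - ε * P.lam) ^ P.DM := by
    have := one_add_mul_le_pow (a := -(ε * P.lam)) (by linarith [S.decay_pos' h]) P.DM
    rw [← sub_eq_add_neg] at this
    linarith
  have hx := S.eps_lam_delay_le h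
  have hx0 : 0 ≤ ε * P.DM * P.lam := by positivity
  have hq := pow_pos (S.decay_pos' h) P.DM
  -- x/(1 - x) ≤ 1.107x for x ≤ 0.0963.
  rw [sub_le_iff_le_add, inv_le_iff_one_le_mul₀ hq]
  have : (1.107 * (ε * P.DM * P.lam) + 1) * (1 - ε * P.DM * P.lam) ≤
      (1.107 * (ε * P.DM * P.lam) + 1) * (1 - ε * P.lam) ^ P.DM := by gcongr
  nlinarith

lemma eps_step_delay_le (S : Setting P σ e) (h : ε ≤ e) :
    P.DM * (ε * rawStep P σ e) ≤ 0.193 * (P.α₀ * ampNorm P) := by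
  have hs := S.sqrt_pos
  have hr := S.rawStep_pos
  have hα := S.valid.α₀_pos
  have hA := S.ampNorm_pos
  calc P.DM * (ε * rawStep P σ e) ≤ P.DM * (e * deltaStep P σ e) := by
        have := S.rawStep_le_deltaStep
        gcongr
        exact S.e_pos.le
    _ = √e * (√e * P.DM * deltaStep P σ e) := by
        linear_combination (-(P.DM * deltaStep P σ e)) * S.sqrt_sq
    _ ≤ 2 / 27 * (2.6 * (P.α₀ * ampNorm P)) :=
        mul_le_mul S.sqrt_le S.step_delay_le_amp (by have := S.deltaStep_pos; positivity)
          (by norm_num)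
    _ ≤ _ := by
      have : 0 ≤ P.α₀ * ampNorm P := by positivity
      linarith

/-- The increments over a delay, with the loss from the decay absorbed. -/
lemma delay_increment_le (S : Setting P σ e) (h0 : 0 < ε) (h : ε ≤ e) :
    ((1 - ε * P.lam) ^ P.DM)⁻¹ * (ε * rawStep P σ e + P.α₀ * ampNorm P *
      √((ε * P.lam) ^ 2 + (2 * Real.pi * n / period P ε) ^ 2)) ≤
    √ε * (√e * rawStep P σ e +
      P.α₀ * ampNorm P * (P.lam * √e + 2 * Real.pi / ((1 - √e) * P.DM))) := by
  have hs := Real.sqrt_pos.2 h0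
  have hse := Real.sqrt_le_sqrt h
  have hεε := Real.mul_self_sqrt h0.le
  have hr := S.rawStep_pos
  have hα := S.valid.α₀_pos
  have hA := S.ampNorm_pos
  have hl := S.valid.lam_pos
  have hD := S.one_le_DM
  have hω1 := S.topFreq_le h0 h
  have hω2 := S.le_topFreq h0 h
  have hω3 := S.delay_topFreq_le h0 h
  have hstep := S.eps_step_delay_le h
  have hinv := S.inv_pow_decay_sub_le h0 h
  have hdec := S.eps_lam_delay_le h
  set ω := 2 * Real.pi * n / period P ε with hω
  set a := P.α₀ * ampNorm P with ha
  have ha0 : 0 < a := by positivity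
  set u := ε * P.lam with hu
  have hu0 : 0 < u := by positivity
  have hω0 : 0 < ω := by
    have : 0 < P.DM * ω := lt_of_lt_of_le (by positivity) hω2
    exact pos_of_mul_pos_right this (by positivity)
  -- `u² ≤ 2 ω u / 9`
  have huω : u ≤ 0.22 * ω := by
    have h1 : √ε * P.DM * P.lam ≤ 1.3 := by
      refine le_trans ?_ S.lam_delay_le
      gcongr
    have h2 : P.DM * u = √ε * (√ε * P.DM * P.lam) := by
      rw [hu]; linear_combination (-(P.DM * P.lam)) * hεε
    have h3 : √ε * (√ε * P.DM * P.lam) ≤ √ε * 1.3 := by gcongr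
    have h4 : √ε * 1.3 ≤ P.DM * (0.22 * ω) := by
      have := Real.pi_gt_d2
      nlinarith
    have h5 : P.DM * u ≤ P.DM * (0.22 * ω) := by linarith
    exact le_of_mul_le_mul_left h5 (by linarith)
  -- The triangle bound ω + u would use up the whole term λ√e of Δ_out. Spending only 0.11u leaves
  -- room for the loss v from the decay over a delay.
  have hroot : √(u ^ 2 + ω ^ 2) ≤ ω + 0.11 * u := by
    apply Real.sqrt_le_iff.2
    refine ⟨by positivity, ?_⟩
    nlinarith [mul_pos hu0 hω0]
  set v := ((1 - ε * P.lam) ^ P.DM)⁻¹ - 1 with hv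
  have hv' : ((1 - ε * P.lam) ^ P.DM)⁻¹ = v + 1 := by rw [hv]; ring
  have hv0 : 0 ≤ v := by
    have : 1 ≤ ((1 - ε * P.lam) ^ P.DM)⁻¹ :=
      (one_le_inv₀ (pow_pos (S.decay_pos' h) _)).2
        (pow_le_one₀ (S.decay_pos' h).le (S.decay_lt_one' h0).le)
    linarith
  have hvD : v ≤ 1.107 * (P.DM * u) := by rw [hu]; linarith
  have hv1 : v ≤ 0.107 := by
    have : P.DM * u ≤ 0.0963 := by rw [hu]; linarith
    linarith
  have t1 : v * (ε * rawStep P σ e) ≤ 0.214 * (u * a) := by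
    calc v * (ε * rawStep P σ e) ≤ 1.107 * (P.DM * u) * (ε * rawStep P σ e) := by gcongr
      _ = 1.107 * u * (P.DM * (ε * rawStep P σ e)) := by ring
      _ ≤ 1.107 * u * (0.193 * a) := by gcongr
      _ ≤ _ := by
        have : 0 < u * a := by positivity
        linarith
  have t2 : a * (v * ω) ≤ 0.537 * (u * a) := by
    calc a * (v * ω) ≤ a * (1.107 * (P.DM * u) * ω) := by gcongr
      _ = 1.107 * (a * u) * (P.DM * ω) := by ring
      _ ≤ 1.107 * (a * u) * 0.485 := by gcongr
      _ ≤ _ := by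
        have : 0 < u * a := by positivity
        linarith
  have t3 : a * (v * u) ≤ 0.107 * (u * a) := by
    calc a * (v * u) ≤ a * (0.107 * u) := by gcongr
      _ = _ := by ring
  have hL : (v + 1) * (ε * rawStep P σ e + a * √(u ^ 2 + ω ^ 2)) ≤
      (v + 1) * (ε * rawStep P σ e + a * (ω + 0.11 * u)) := by gcongr
  have hεe : ε ≤ √ε * √e := hεε.symm.le.trans (by gcongr)
  have hR1 : ε * rawStep P σ e ≤ √ε * (√e * rawStep P σ e) := by
    rw [← mul_assoc]; gcongr
  have hR2 : u ≤ √ε * (P.lam * √e) := by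
    calc u ≤ √ε * √e * P.lam := mul_le_mul_of_nonneg_right hεe hl.le
      _ = _ := by ring
  have hR3 : a * (u + ω) ≤ a * (√ε * (P.lam * √e) +
      √ε * (2 * Real.pi / ((1 - √e) * P.DM))) := by gcongr
  have hua : 0 < u * a := by positivity
  rw [hv']
  -- The losses 0.214, 0.537 and 0.11 · 1.107, in units of ua, add up to less than 1.
  linarith

/-- The initial input carries no dither, so the increment of the dither over the delay is replaced
by S(j) itself with j ≤ 2D_M; hence the factor 2. -/
lemma delay_increment_init_le (S : Setting P σ e) (h0 : 0 < ε) (h : ε ≤ e) :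
    ((1 - ε * P.lam) ^ P.DM)⁻¹ * (ε * rawStep P σ e) + P.α₀ * ampNorm P *
      (2 * (2 * Real.pi * n / period P ε)) ≤
    2 * (√ε * (√e * rawStep P σ e +
      P.α₀ * ampNorm P * (P.lam * √e + 2 * Real.pi / ((1 - √e) * P.DM)))) := by
  have hs := Real.sqrt_pos.2 h0
  have hse := Real.sqrt_le_sqrt h
  have hεε := Real.mul_self_sqrt h0.le
  have hr := S.rawStep_pos
  have hα := S.valid.α₀_pos
  have hA := S.ampNorm_pos
  have hl := S.valid.lam_pos
  have hinv := S.inv_pow_decay_sub_le h0 h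
  have hdec := S.eps_lam_delay_le h
  have h1 : ((1 - ε * P.lam) ^ P.DM)⁻¹ ≤ 2 := by linarith
  have h2 : ((1 - ε * P.lam) ^ P.DM)⁻¹ * (ε * rawStep P σ e) ≤ 2 * (ε * rawStep P σ e) := by
    gcongr
  have hεe : ε ≤ √ε * √e := hεε.symm.le.trans (by gcongr)
  have hR1 : ε * rawStep P σ e ≤ √ε * (√e * rawStep P σ e) := by
    rw [← mul_assoc]; gcongr
  have h3 : P.α₀ * ampNorm P * (2 * (2 * Real.pi * n / period P ε)) ≤ P.α₀ * ampNorm P *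
      (2 * (√ε * (2 * Real.pi / ((1 - √e) * P.DM)))) := by
    have := S.topFreq_le h0 h
    gcongr
  have h4 : 0 ≤ P.α₀ * ampNorm P * (√ε * (P.lam * √e)) := by positivity
  linarith

/-! ### The implicit bound on the next estimation error -/

lemma corrBound_self (P : Params n) (σ e : ℝ) : corrBound P σ e σ = deltaG P σ e := rfl

lemma corrBound_mono (S : Setting P σ e) {r r' : ℝ} (h0 : 0 ≤ r) (h : r ≤ r') :
    corrBound P σ e r ≤ corrBound P σ e r' := by
  have := S.rho1_pos
  have := S.rho4_pos
  have := S.valid.HM_pos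
  have := S.valid.α₀_pos
  rw [corrBound, corrBound]
  gcongr

/-- The term ρ₁Δ' once more, with 2/(27 · 0.19245) < 0.385. -/
lemma e_deltaStep_le (S : Setting P σ e) : e * deltaStep P σ e ≤ 0.385 * σ := by
  have h1 := S.sqrt_mul_lt_of_le S.deltaY_terms.2.1
  have hk := S.valid.k_pos
  have hM := S.valid.HM_pos
  have hσ := S.sigma_pos
  have hs := S.sqrt_pos
  have hS := S.deltaStep_pos
  have hD := S.one_le_DM
  have h2 : √e * (0.19245 * 1 * P.k * P.HM * deltaStep P σ e) ≤
      √e * (rho1 P * deltaStep P σ e) := by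
    have h3 := S.rho1_ge
    have h4 : 0.19245 * 1 * P.k * P.HM ≤ 0.19245 * P.DM * P.k * P.HM := by gcongr
    gcongr
    linarith
  have hX : 0 < P.k * P.HM := by positivity
  have h3 : (0.19245 * (√e * deltaStep P σ e)) * (P.k * P.HM) < σ * (P.k * P.HM) := by linarith
  have h4 := lt_of_mul_lt_mul_right h3 hX.le
  have h5 : e * deltaStep P σ e = √e * (√e * deltaStep P σ e) := by
    rw [← mul_assoc, S.sqrt_sq]
  have h6 : √e * (√e * deltaStep P σ e) ≤ 2 / 27 * (√e * deltaStep P σ e) := by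
    have := S.sqrt_le
    gcongr
  linarith

lemma three_sqrt_deltaG_lt (S : Setting P σ e) : 3 * (√e * deltaG P σ e) < σ := by
  have h1 := S.sigmaAt_lt
  have h2 : √e * (3 * deltaG P σ e) ≤ √e * driftCoef P σ e := by
    have := S.sqrt_pos
    gcongr; exact S.drift_ge
  have h3 : 0 ≤ P.σ₀ * ((1 - e * P.lam) ^ P.DM)⁻¹ := by
    have := S.valid.σ₀_pos
    have := S.decay_pos
    positivity
  rw [sigmaAt] at h1
  linarith

/-- A bound `r ≤ Z + √ε corrBound r` improves itself. -/
lemma le_of_le_corrBound (S : Setting P σ e) (h : ε ≤ e) {r Z : ℝ} (hr : 0 ≤ r)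
    (hmax : r ≤ 1.54 * σ) (hZ : Z + √ε * deltaG P σ e ≤ σ)
    (hrZ : r ≤ Z + √ε * corrBound P σ e r) : r ≤ Z + √ε * deltaG P σ e := by
  have hσ := S.sigma_pos
  have h1 := S.rho1_pos
  have h4 := S.rho4_pos
  have hM := S.valid.HM_pos
  have hα := S.valid.α₀_pos
  have hs := Real.sqrt_nonneg ε
  -- For r between σ and 1.54σ the difference quotient of √ε `corrBound` from σ is below 1, because
  -- 3√eΔ_G < σ. Hence r > σ would give r - σ < r - σ.
  have hrσ : r ≤ σ := by
    by_contra! hlt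
    have hG := S.three_sqrt_deltaG_lt
    set c := rho4 P * P.HM / P.α₀ with hc
    have hc0 : 0 < c := by positivity
    have hG' : rho1 P * σ + c * σ ^ 2 ≤ deltaG P σ e := by
      rw [deltaG]
      have t1 : 0 ≤ rho2 P * (sigmaEta P σ e / P.α₀) := by
        have := S.rho2_pos
        have := S.sigmaEta_pos
        positivity
      have t2 : 0 ≤ rho3 P e * P.α₀ := by have := S.rho3_nonneg; positivity
      have : c * σ ^ 2 = rho4 P * (σ ^ 2 * P.HM / P.α₀) := by rw [hc]; ring
      linarith
    have h3 : √ε * (3 * (rho1 P + c * σ)) < 1 := by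
      have h5 : √e * (3 * (rho1 P + c * σ)) * σ < 1 * σ := by
        have := mul_le_mul_of_nonneg_left hG' S.sqrt_pos.le
        nlinarith
      have h6 := lt_of_mul_lt_mul_right h5 hσ.le
      refine lt_of_le_of_lt ?_ h6
      have := Real.sqrt_le_sqrt h
      gcongr
    have e1 : corrBound P σ e r - deltaG P σ e = (r - σ) * (rho1 P + c * (r + σ)) := by
      rw [corrBound, deltaG, hc]; ring
    have h7 : r - σ ≤ √ε * ((r - σ) * (rho1 P + c * (r + σ))) := by
      rw [← e1]; linarith
    have h8 : rho1 P + c * (r + σ) ≤ 3 * (rho1 P + c * σ) := by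
      have : c * (r + σ) ≤ c * (3 * σ) := by gcongr; linarith
      linarith
    have h9 : √ε * ((r - σ) * (rho1 P + c * (r + σ))) ≤
        (r - σ) * (√ε * (3 * (rho1 P + c * σ))) := by
      have : √ε * ((r - σ) * (rho1 P + c * (r + σ))) ≤
          √ε * ((r - σ) * (3 * (rho1 P + c * σ))) := by
        gcongr
      linarith
    have h10 : (r - σ) * (√ε * (3 * (rho1 P + c * σ))) < (r - σ) * 1 :=
      mul_lt_mul_of_pos_left h3 (by linarith)
    linarith
  have := S.corrBound_mono hr hrσ
  rw [corrBound_self] at this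
  have := mul_le_mul_of_nonneg_left this hs
  linarith

end Setting

/-! ### The closed loop -/

/-- A trajectory of the algorithm under the standing assumptions. -/
structure Run (P : Params n) (σ e ε : ℝ) (H : Matrix (Fin n) (Fin n) ℝ)
    (θs : EuclideanSpace ℝ (Fin n)) (Qs Q0 : ℝ) (D : ℕ → ℕ) (θ0 : EuclideanSpace ℝ (Fin n))
    (θh : ℕ → EuclideanSpace ℝ (Fin n)) (η : ℕ → ℝ) : Prop where
  setting : Setting P σ e
  eps_pos : 0 < ε
  eps_le : ε ≤ e
  form : FormBetween (hess H) P.Hm P.HM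
  init : ‖θ0 - θs‖ ≤ P.σ₀
  level : |Qs - Q0| ≤ P.ΔQ
  delay : ∀ j, D j ≤ P.DM
  sol : IsESSolution P ε (quadMap H θs Qs) D θ0 Q0 θh η

/-- The bound on the normalized filter error for the parameter `ε ≤ e`. -/
def filterBound (P : Params n) (σ e ε : ℝ) : ℝ :=
  P.ΔQ * ((1 - e * P.lam) ^ (2 * P.DM))⁻¹ +
    P.ωh * (P.HM / 2 * ((1 - e * P.lam) ^ (2 * P.DM))⁻¹ *
        (sigmaAt P σ e ε + P.α₀ * ampNorm P) ^ 2) /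
      (P.ωh - 2 * P.lam + ε * P.lam ^ 2)

/-- The slowly varying factor of the demodulation in the estimation error dynamics. -/
def slowGain (P : Params n) (ε : ℝ) (H : Matrix (Fin n) (Fin n) ℝ)
    (θs : EuclideanSpace ℝ (Fin n)) (Qs : ℝ) (θh : ℕ → EuclideanSpace ℝ (Fin n)) (η : ℕ → ℝ)
    (j : ℕ) : ℝ :=
  (1 / 2 * wsq H (θh j - θs) - (η j - Qs)) / alpha P ε j

/-- The correction of the estimation error which removes the oscillating terms. -/
def correction (P : Params n) (ε : ℝ) (H : Matrix (Fin n) (Fin n) ℝ)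
    (θs : EuclideanSpace ℝ (Fin n)) (Qs : ℝ) (θh : ℕ → EuclideanSpace ℝ (Fin n)) (η : ℕ → ℝ)
    (j : ℕ) : EuclideanSpace ℝ (Fin n) :=
  slowGain P ε H θs Qs θh η j • demodPrim P ε j +
    hess (corrMatrix P ε j) (hess H (θh j - θs)) + alpha P ε j • cubicPrim P ε H j

/-- The corrected estimation error. -/
def corrected (P : Params n) (ε : ℝ) (H : Matrix (Fin n) (Fin n) ℝ)
    (θs : EuclideanSpace ℝ (Fin n)) (Qs : ℝ) (θh : ℕ → EuclideanSpace ℝ (Fin n)) (η : ℕ → ℝ)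
    (j : ℕ) : EuclideanSpace ℝ (Fin n) :=
  (θh j - θs) + (ε * P.k) • correction P ε H θs Qs θh η j

/-- The perturbation of the output by the delay. -/
def delayError (P : Params n) (ε : ℝ) (H : Matrix (Fin n) (Fin n) ℝ)
    (θs : EuclideanSpace ℝ (Fin n)) (D : ℕ → ℕ) (θ0 : EuclideanSpace ℝ (Fin n))
    (θh : ℕ → EuclideanSpace ℝ (Fin n)) (j : ℕ) : ℝ :=
  1 / 2 * (wsq H (input P ε θ0 θh (j - D j) - θs) -
    wsq H (θh j - θs + alpha P ε j • pert P ε j))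

/-- Strictness comes from the initial term: (1 - eλ)² > |1 - eω_h| and D_M > 0. -/
lemma Setting.filterBound_lt {P : Params n} {σ e ε : ℝ} (S : Setting P σ e) (h0 : 0 < ε)
    (h : ε ≤ e) : filterBound P σ e ε < sigmaEta P σ e := by
  rw [filterBound, S.sigmaEta_eq]
  refine add_lt_add_of_lt_of_le ?_ (S.filter_bound_le h0 h)
  refine mul_lt_mul_of_pos_left ?_ S.valid.ΔQ_pos
  have hw := S.filter_pos
  rw [inv_lt_inv₀ (pow_pos S.decay_pos _) (pow_pos hw _), pow_mul]
  exact pow_lt_pow_left₀ S.filter_lt hw.le S.DM_pos.ne'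

lemma wsq_add_smul {H : Matrix (Fin n) (Fin n) ℝ} {m M : ℝ} (hH : FormBetween (hess H) m M)
    (x y : EuclideanSpace ℝ (Fin n)) (c : ℝ) :
    wsq H (x + c • y) = wsq H x + 2 * c * ⟪y, hess H x⟫ + c ^ 2 * wsq H y := by
  simp only [wsq_eq_inner, map_add, map_smul, inner_add_left, inner_add_right, inner_smul_left,
    inner_smul_right, conj_trivial]
  rw [← hH.symm x y, real_inner_comm y (hess H x)]
  ring

/-- Summation by parts for one step: writing M, sM - L and wM/2 as increments of ψ, W, V moves the
differences onto the slow factors. In the application c = εk, L = Hx and K = H(correction), and c²K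
is added and subtracted so that H acts on the whole corrected error. -/
lemma correction_identity {E : Type*} [AddCommGroup E] [Module ℝ E]
    {x x' M ψ ψ' V V' W W' U L K : E}
    {c g g' s w d a a' : ℝ} (hx : x' = x - (c * (g + s + a / 2 * w + d)) • M) (hψ : ψ' = ψ + M)
    (hW : W' = W + s • M - L) (hV : V' = V + (1 / 2 * w) • M) :
    x' + c • (g' • ψ' + U + a' • V') =
      (x + c • (g • ψ + W + a • V)) - c • (L + c • K) + (c ^ 2 • K - (c * d) • M +
        c • ((g' - g) • ψ' + (U - W') + (a' - a) • V')) := by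
  subst hx hψ hW hV
  module

namespace Run

variable {P : Params n} {σ e ε : ℝ} {H : Matrix (Fin n) (Fin n) ℝ}
  {θs : EuclideanSpace ℝ (Fin n)} {Qs Q0 : ℝ} {D : ℕ → ℕ} {θ0 : EuclideanSpace ℝ (Fin n)}
  {θh : ℕ → EuclideanSpace ℝ (Fin n)} {η : ℕ → ℝ}

lemma decay_pos (R : Run P σ e ε H θs Qs Q0 D θ0 θh η) : 0 < 1 - ε * P.lam :=
  R.setting.decay_pos' R.eps_le

lemma decay_lt_one (R : Run P σ e ε H θs Qs Q0 D θ0 θh η) : 1 - ε * P.lam < 1 :=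
  R.setting.decay_lt_one' R.eps_pos

lemma decay_le (R : Run P σ e ε H θs Qs Q0 D θ0 θh η) : 1 - e * P.lam ≤ 1 - ε * P.lam :=
  R.setting.decay_le R.eps_le

lemma alpha_pos (R : Run P σ e ε H θs Qs Q0 D θ0 θh η) (j : ℕ) : 0 < alpha P ε j :=
  mul_pos R.setting.valid.α₀_pos (pow_pos R.decay_pos j)

lemma wsq_nonneg (R : Run P σ e ε H θs Qs Q0 D θ0 θh η) (x : EuclideanSpace ℝ (Fin n)) :
    0 ≤ wsq H x := by
  rw [wsq_eq_inner]; exact R.form.form_nonneg R.setting.valid.Hm_pos x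

lemma wsq_le (R : Run P σ e ε H θs Qs Q0 D θ0 θh η) {x : EuclideanSpace ℝ (Fin n)} {b : ℝ}
    (h : ‖x‖ ≤ b) : wsq H x ≤ P.HM * b ^ 2 := by
  have := R.setting.valid.HM_pos
  rw [wsq_eq_inner]
  refine (R.form.upper x).trans ?_
  gcongr

lemma abs_wsq_sub_le (R : Run P σ e ε H θs Qs Q0 D θ0 θh η) (x y : EuclideanSpace ℝ (Fin n)) :
    |wsq H x - wsq H y| ≤ P.HM * ‖x - y‖ * (‖x‖ + ‖y‖) := by
  rw [wsq_eq_inner, wsq_eq_inner]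
  exact R.form.abs_form_sub_le R.setting.valid.Hm_pos R.setting.valid.HM_pos x y

/-- Shifting the exponent back by a delay costs at most the worst decay over `DM` steps. -/
lemma pow_sub_le (R : Run P σ e ε H θs Qs Q0 D θ0 θh η) {j d : ℕ} (hd : d ≤ P.DM) (hj : d ≤ j) :
    (1 - ε * P.lam) ^ (j - d) ≤ ((1 - e * P.lam) ^ P.DM)⁻¹ * (1 - ε * P.lam) ^ j := by
  have h1 : (1 - e * P.lam) ^ P.DM ≤ (1 - ε * P.lam) ^ d :=
    (pow_le_pow_left₀ R.setting.decay_pos.le R.decay_le _).trans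
      (pow_le_pow_of_le_one R.decay_pos.le R.decay_lt_one.le hd)
  have h2 : (1 - ε * P.lam) ^ j = (1 - ε * P.lam) ^ (j - d) * (1 - ε * P.lam) ^ d := by
    rw [← pow_add, Nat.sub_add_cancel hj]
  rw [← div_eq_inv_mul, le_div_iff₀ (pow_pos R.setting.decay_pos _), h2]
  have := pow_pos R.decay_pos (j - d)
  gcongr

lemma pow_sub_le' (R : Run P σ e ε H θs Qs Q0 D θ0 θh η) {j d : ℕ} (hd : d ≤ P.DM) (hj : d ≤ j) :
    (1 - ε * P.lam) ^ (j - d) ≤ ((1 - ε * P.lam) ^ P.DM)⁻¹ * (1 - ε * P.lam) ^ j := by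
  have h1 : (1 - ε * P.lam) ^ P.DM ≤ (1 - ε * P.lam) ^ d :=
    pow_le_pow_of_le_one R.decay_pos.le R.decay_lt_one.le hd
  have h2 : (1 - ε * P.lam) ^ j = (1 - ε * P.lam) ^ (j - d) * (1 - ε * P.lam) ^ d := by
    rw [← pow_add, Nat.sub_add_cancel hj]
  rw [← div_eq_inv_mul, le_div_iff₀ (pow_pos R.decay_pos _), h2]
  have := pow_pos R.decay_pos (j - d)
  gcongr

lemma init_le (R : Run P σ e ε H θs Qs Q0 D θ0 θh η) {r : ℝ}
    (hr : P.σ₀ * ((1 - e * P.lam) ^ P.DM)⁻¹ ≤ r) {i : ℕ} (hi : i ≤ P.DM) :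
    ‖θ0 - θs‖ ≤ r * (1 - ε * P.lam) ^ i := by
  have h := R.pow_sub_le le_rfl (j := P.DM) le_rfl
  rw [Nat.sub_self, pow_zero] at h
  have hσ := R.setting.valid.σ₀_pos
  have hd := R.setting.decay_pos
  have hr0 : 0 < r := lt_of_lt_of_le (by positivity) hr
  calc ‖θ0 - θs‖ ≤ P.σ₀ * 1 := by rw [mul_one]; exact R.init
    _ ≤ P.σ₀ * (((1 - e * P.lam) ^ P.DM)⁻¹ * (1 - ε * P.lam) ^ P.DM) := by gcongr
    _ = (P.σ₀ * ((1 - e * P.lam) ^ P.DM)⁻¹) * (1 - ε * P.lam) ^ P.DM := by ring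
    _ ≤ r * (1 - ε * P.lam) ^ i := by
        have := pow_pos R.decay_pos P.DM
        have h2 := pow_le_pow_of_le_one R.decay_pos.le R.decay_lt_one.le hi
        gcongr

lemma input_le (R : Run P σ e ε H θs Qs Q0 D θ0 θh η) {r : ℝ}
    (hr : P.σ₀ * ((1 - e * P.lam) ^ P.DM)⁻¹ ≤ r) {i : ℕ}
    (hx : P.DM ≤ i → ‖θh i - θs‖ ≤ r * (1 - ε * P.lam) ^ i) :
    ‖input P ε θ0 θh i - θs‖ ≤ (r + P.α₀ * ampNorm P) * (1 - ε * P.lam) ^ i := by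
  have hα := R.setting.valid.α₀_pos
  have hA := R.setting.ampNorm_pos
  have hp := pow_pos R.decay_pos i
  rw [input]
  split_ifs with hi
  · refine (R.init_le hr hi).trans ?_
    gcongr
    have : 0 < P.α₀ * ampNorm P := by positivity
    linarith
  · have h1 := hx (by omega)
    have h2 : ‖alpha P ε i • pert P ε i‖ ≤ P.α₀ * ampNorm P * (1 - ε * P.lam) ^ i := by
      rw [norm_smul, Real.norm_of_nonneg (R.alpha_pos i).le, alpha]
      have := norm_pert_le P ε i
      calc _ ≤ P.α₀ * (1 - ε * P.lam) ^ i * ampNorm P := by gcongr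
        _ = _ := by ring
    have e1 : θh i + alpha P ε i • pert P ε i - θs = (θh i - θs) + alpha P ε i • pert P ε i := by
      abel
    rw [e1, add_mul]
    exact (norm_add_le _ _).trans (add_le_add h1 h2)

lemma meas_eq (R : Run P σ e ε H θs Qs Q0 D θ0 θh η) {j : ℕ} (hj : P.DM ≤ j) :
    meas P ε (quadMap H θs Qs) D θ0 θh j - Qs =
      1 / 2 * wsq H (input P ε θ0 θh (j - D j) - θs) := by
  have _ := R.eps_pos
  rw [meas, if_neg (by omega), quadMap]
  ring

lemma abs_meas_le (R : Run P σ e ε H θs Qs Q0 D θ0 θh η) {r : ℝ}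
    (hr : P.σ₀ * ((1 - e * P.lam) ^ P.DM)⁻¹ ≤ r) {j : ℕ} (hj : P.DM ≤ j)
    (hx : ∀ i, P.DM ≤ i → i ≤ j → ‖θh i - θs‖ ≤ r * (1 - ε * P.lam) ^ i) :
    |meas P ε (quadMap H θs Qs) D θ0 θh j - Qs| ≤
      P.HM / 2 * ((1 - e * P.lam) ^ (2 * P.DM))⁻¹ * (r + P.α₀ * ampNorm P) ^ 2 *
        (1 - ε * P.lam) ^ (2 * j) := by
  have hM := R.setting.valid.HM_pos
  have hα := R.setting.valid.α₀_pos
  have hA := R.setting.ampNorm_pos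
  have hσ := R.setting.valid.σ₀_pos
  have hd := R.setting.decay_pos
  have hr0 : 0 < r := lt_of_lt_of_le (by positivity) hr
  have h1 := R.input_le hr (i := j - D j) fun h => hx _ h (Nat.sub_le _ _)
  have h2 := R.pow_sub_le (R.delay j) ((R.delay j).trans hj)
  rw [R.meas_eq hj, abs_of_nonneg (mul_nonneg (by norm_num) (R.wsq_nonneg _))]
  have h3 : ‖input P ε θ0 θh (j - D j) - θs‖ ≤ (r + P.α₀ * ampNorm P) *
      (((1 - e * P.lam) ^ P.DM)⁻¹ * (1 - ε * P.lam) ^ j) := h1.trans (by gcongr)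
  have h4 := R.wsq_le h3
  calc _ ≤ 1 / 2 * (P.HM * ((r + P.α₀ * ampNorm P) *
      (((1 - e * P.lam) ^ P.DM)⁻¹ * (1 - ε * P.lam) ^ j)) ^ 2) := by gcongr
    _ = _ := by rw [mul_comm 2 P.DM, mul_comm 2 j, pow_mul, pow_mul, ← inv_pow]; ring

lemma filter_err_succ (R : Run P σ e ε H θs Qs Q0 D θ0 θh η) {j : ℕ} (hj : P.DM ≤ j) :
    η (j + 1) - Qs = (1 - ε * P.ωh) * (η j - Qs) +
      ε * P.ωh * (meas P ε (quadMap H θs Qs) D θ0 θh j - Qs) := by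
  rw [R.sol.filter_step j hj]; ring

lemma filter_err_init (R : Run P σ e ε H θs Qs Q0 D θ0 θh η) :
    |η P.DM - Qs| ≤ filterBound P σ e ε * (1 - ε * P.lam) ^ (2 * P.DM) := by
  have S := R.setting
  have hM := S.valid.HM_pos
  have hQ := S.valid.ΔQ_pos
  have hω := S.valid.ωh_pos
  have hd := S.decay_pos
  have hε := R.eps_pos
  have hδ : 0 < P.ωh - 2 * P.lam := by linarith [S.valid.filter]
  rw [R.sol.filter_init, abs_sub_comm]
  refine R.level.trans ?_
  have h1 : P.ΔQ * ((1 - e * P.lam) ^ (2 * P.DM))⁻¹ ≤ filterBound P σ e ε := by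
    rw [filterBound]
    have : 0 ≤ P.ωh * (P.HM / 2 * ((1 - e * P.lam) ^ (2 * P.DM))⁻¹ *
        (sigmaAt P σ e ε + P.α₀ * ampNorm P) ^ 2) / (P.ωh - 2 * P.lam + ε * P.lam ^ 2) := by
      positivity
    linarith
  have h2 : (1 - e * P.lam) ^ (2 * P.DM) ≤ (1 - ε * P.lam) ^ (2 * P.DM) :=
    pow_le_pow_left₀ hd.le R.decay_le _
  have hp := pow_pos hd (2 * P.DM)
  calc P.ΔQ = P.ΔQ * ((1 - e * P.lam) ^ (2 * P.DM))⁻¹ * (1 - e * P.lam) ^ (2 * P.DM) := by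
        field_simp
    _ ≤ filterBound P σ e ε * (1 - ε * P.lam) ^ (2 * P.DM) := by
        gcongr
        exact le_trans (by positivity) h1

/-- Since (1 - ελ)² = 1 - εω_h + εp with p = ω_h - 2λ + ελ², a bound K reproduces itself as soon as
Kp ≥ ω_hY; this dictates the second term of `filterBound`. -/
lemma filter_err_step (R : Run P σ e ε H θs Qs Q0 D θ0 θh η) {j : ℕ} (hj : P.DM ≤ j)
    (hx : ∀ i, P.DM ≤ i → i ≤ j → ‖θh i - θs‖ ≤ sigmaAt P σ e ε * (1 - ε * P.lam) ^ i)
    (hη : |η j - Qs| ≤ filterBound P σ e ε * (1 - ε * P.lam) ^ (2 * j)) :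
    |η (j + 1) - Qs| ≤ filterBound P σ e ε * (1 - ε * P.lam) ^ (2 * (j + 1)) := by
  have S := R.setting
  have hQ := S.valid.ΔQ_pos
  have hω := S.valid.ωh_pos
  have hd := S.decay_pos
  have hε := R.eps_pos
  have hw : 0 < 1 - ε * P.ωh := by
    have := mul_le_mul_of_nonneg_right R.eps_le hω.le
    linarith [S.e_filter_le]
  have hδ : 0 < P.ωh - 2 * P.lam := by linarith [S.valid.filter]
  have hm := R.abs_meas_le (S.init_le_sigmaAt ε) hj hx
  set Y := P.HM / 2 * ((1 - e * P.lam) ^ (2 * P.DM))⁻¹ *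
    (sigmaAt P σ e ε + P.α₀ * ampNorm P) ^ 2 with hY
  set p := P.ωh - 2 * P.lam + ε * P.lam ^ 2 with hp
  have hp0 : 0 < p := by positivity
  have hK : P.ωh * Y ≤ filterBound P σ e ε * p := by
    rw [filterBound, ← hY, ← hp, add_mul, div_mul_cancel₀ _ hp0.ne']
    have : 0 ≤ P.ΔQ * ((1 - e * P.lam) ^ (2 * P.DM))⁻¹ * p := by positivity
    linarith
  set K := filterBound P σ e ε with hKdef
  have hpw := pow_pos R.decay_pos (2 * j)
  set m := (1 - ε * P.lam) ^ (2 * j) with hm'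
  rw [R.filter_err_succ hj]
  calc _ ≤ |(1 - ε * P.ωh) * (η j - Qs)| +
        |ε * P.ωh * (meas P ε (quadMap H θs Qs) D θ0 θh j - Qs)| := abs_add_le _ _
    _ ≤ (1 - ε * P.ωh) * (K * m) + ε * P.ωh * (Y * m) := by
        rw [abs_mul, abs_mul, abs_of_pos hw, abs_of_pos (mul_pos hε hω)]
        gcongr
    _ ≤ (1 - ε * P.ωh) * (K * m) + ε * (K * p) * m := by
        have := mul_le_mul_of_nonneg_left hK (mul_pos hε hpw).le
        linarith
    _ = K * (1 - ε * P.lam) ^ (2 * (j + 1)) := by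
        rw [show 2 * (j + 1) = 2 * j + 2 by ring, pow_add, ← hm', hp]; ring

lemma abs_output_le (R : Run P σ e ε H θs Qs Q0 D θ0 θh η) {j : ℕ} (hj : P.DM ≤ j)
    (hx : ∀ i, P.DM ≤ i → i ≤ j → ‖θh i - θs‖ ≤ σ * (1 - ε * P.lam) ^ i)
    (hη : |η j - Qs| ≤ sigmaEta P σ e * (1 - ε * P.lam) ^ (2 * j)) :
    |meas P ε (quadMap H θs Qs) D θ0 θh j - η j| ≤
      (sigmaY P σ e + sigmaEta P σ e) * (1 - ε * P.lam) ^ (2 * j) := by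
  have S := R.setting
  have hm := R.abs_meas_le (r := σ)
    ((S.init_le_sigmaAt ε).trans (S.sigmaAt_lt_of_le R.eps_le).le) hj hx
  rw [← S.sigmaY_eq] at hm
  rw [show meas P ε (quadMap H θs Qs) D θ0 θh j - η j =
    (meas P ε (quadMap H θs Qs) D θ0 θh j - Qs) - (η j - Qs) by ring, add_mul]
  exact (abs_sub _ _).trans (add_le_add hm hη)

/-- The output decays like μ^(2j), so division by α(j) still leaves μ^j. -/
lemma norm_step_le (R : Run P σ e ε H θs Qs Q0 D θ0 θh η) {j : ℕ} (hj : P.DM ≤ j)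
    (hx : ∀ i, P.DM ≤ i → i ≤ j → ‖θh i - θs‖ ≤ σ * (1 - ε * P.lam) ^ i)
    (hη : |η j - Qs| ≤ sigmaEta P σ e * (1 - ε * P.lam) ^ (2 * j)) :
    ‖θh (j + 1) - θh j‖ ≤ ε * rawStep P σ e * (1 - ε * P.lam) ^ j := by
  have S := R.setting
  have h1 := R.abs_output_le hj hx hη
  have hα := S.valid.α₀_pos
  have hk := S.valid.k_pos
  have hε := R.eps_pos
  have hp := pow_pos R.decay_pos j
  have hB := S.invAmpNorm_pos
  have hy := S.sigmaY_pos
  have hs := S.sigmaEta_pos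
  rw [R.sol.est_step j hj, sub_sub_cancel_left, norm_neg, norm_smul, Real.norm_eq_abs, abs_mul,
    abs_of_pos (mul_pos hε (div_pos hk (R.alpha_pos j)))]
  have h2 := norm_demod_le P ε j
  calc _ ≤ ε * (P.k / alpha P ε j) * ((sigmaY P σ e + sigmaEta P σ e) *
        (1 - ε * P.lam) ^ (2 * j)) * (2 * invAmpNorm P) := by
        have := R.alpha_pos j
        have := pow_pos R.decay_pos (2 * j)
        gcongr
    _ = _ := by
        rw [alpha, rawStep, mul_comm 2 j, pow_mul]
        field_simp

/-! ### The effect of the delay -/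

lemma norm_delay_le (R : Run P σ e ε H θs Qs Q0 D θ0 θh η) {j : ℕ} (hj : P.DM ≤ j)
    (hstep : ∀ i, P.DM ≤ i → i < j →
      ‖θh (i + 1) - θh i‖ ≤ ε * rawStep P σ e * (1 - ε * P.lam) ^ i) :
    ‖(input P ε θ0 θh (j - D j) - θs) - (θh j - θs + alpha P ε j • pert P ε j)‖ ≤
      (if j ≤ 2 * P.DM then 2 else 1) * (P.DM * (√ε * (√e * rawStep P σ e +
        P.α₀ * ampNorm P * (P.lam * √e + 2 * Real.pi / ((1 - √e) * P.DM)))) *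
        (1 - ε * P.lam) ^ j) := by
  have S := R.setting
  have hα := S.valid.α₀_pos
  have hlam := S.valid.lam_pos
  have hA := S.ampNorm_pos
  have hε := R.eps_pos
  have hr := S.rawStep_pos
  have hμ := R.decay_pos
  have hs := Real.sqrt_pos.2 hε
  have hse := S.sqrt_pos
  have h1s := sub_pos.2 S.sqrt_lt_one
  have hDj := R.delay j
  set C := √ε * (√e * rawStep P σ e +
        P.α₀ * ampNorm P * (P.lam * √e + 2 * Real.pi / ((1 - √e) * P.DM))) with hC
  have hC0 : 0 ≤ C := by positivity
  set μ := 1 - ε * P.lam with hμdef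
  -- A delay spans at most D_M increments, each compared with μ^j at the cost of μ^(-D_M).
  have hsum : ∀ (b : ℝ), 0 ≤ b → ∀ m, j - m ≤ P.DM → m ≤ j →
      ∑ i ∈ Ico m j, b * μ ^ i ≤ P.DM * (b * ((μ ^ P.DM)⁻¹ * μ ^ j)) := by
    intro b hb m hm hmj
    have h1 : ∀ i ∈ Ico m j, b * μ ^ i ≤ b * ((μ ^ P.DM)⁻¹ * μ ^ j) := by
      intro i hi
      have hi' := mem_Ico.1 hi
      have h2 := R.pow_sub_le' (d := j - i) (j := j) (by omega) (by omega)
      rw [Nat.sub_sub_self hi'.2.le] at h2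
      gcongr
    refine (sum_le_card_nsmul _ _ _ h1).trans ?_
    rw [Nat.card_Ico, nsmul_eq_mul]
    gcongr
  by_cases hcase : j - D j ≤ P.DM
  · -- the input is still the initial one
    have hj2 : j ≤ 2 * P.DM := by omega
    rw [if_pos hj2, input, if_pos hcase, ← R.sol.est_init P.DM le_rfl]
    have e1 : θh P.DM - θs - (θh j - θs + alpha P ε j • pert P ε j) =
        (θh P.DM - θh j) - alpha P ε j • pert P ε j := by abel
    rw [e1]
    have h1 : ‖θh P.DM - θh j‖ ≤ P.DM * (ε * rawStep P σ e * ((μ ^ P.DM)⁻¹ * μ ^ j)) := by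
      rw [← dist_eq_norm]
      refine (dist_le_Ico_sum_of_dist_le (f := θh) (d := fun i => ε * rawStep P σ e * μ ^ i) hj
        fun {i} hi hij => ?_).trans (hsum _ (by positivity) _ (by omega) hj)
      rw [dist_comm, dist_eq_norm]
      exact hstep i hi hij
    have h2 : ‖alpha P ε j • pert P ε j‖ ≤ P.DM * (P.α₀ * ampNorm P *
        (2 * (2 * Real.pi * n / period P ε)) * μ ^ j) := by
      rw [norm_smul, Real.norm_of_nonneg (R.alpha_pos j).le, alpha]
      have hj2' : (j : ℝ) ≤ 2 * P.DM := by exact_mod_cast hj2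
      calc _ ≤ P.α₀ * μ ^ j * (2 * Real.pi * n / period P ε * j * ampNorm P) := by
            gcongr; exact norm_pert_le_mul P ε j
        _ ≤ P.α₀ * μ ^ j * (2 * Real.pi * n / period P ε * (2 * P.DM) * ampNorm P) := by
            gcongr
        _ = _ := by ring
    have h3 := S.delay_increment_init_le hε R.eps_le
    rw [← hC, ← hμdef] at h3
    calc _ ≤ _ := norm_sub_le _ _
      _ ≤ _ := add_le_add h1 h2
      _ = P.DM * μ ^ j * ((μ ^ P.DM)⁻¹ * (ε * rawStep P σ e) + P.α₀ * ampNorm P *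
          (2 * (2 * Real.pi * n / period P ε))) := by ring
      _ ≤ P.DM * μ ^ j * (2 * C) := by gcongr
      _ = _ := by ring
  -- Now the delayed input is dithered too, and θ̂ + αS is telescoped over the delay.
  · push Not at hcase
    rw [input, if_neg (by omega)]
    set f : ℕ → EuclideanSpace ℝ (Fin n) := fun i => θh i + alpha P ε i • pert P ε i with hf
    have e1 : θh (j - D j) + alpha P ε (j - D j) • pert P ε (j - D j) - θs -
        (θh j - θs + alpha P ε j • pert P ε j) = f (j - D j) - f j := by
      simp only [hf]; abel
    rw [e1]
    set w := √((ε * P.lam) ^ 2 + (2 * Real.pi * n / period P ε) ^ 2) with hw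
    have h1 : ‖f (j - D j) - f j‖ ≤
        P.DM * ((ε * rawStep P σ e + P.α₀ * ampNorm P * w) * ((μ ^ P.DM)⁻¹ * μ ^ j)) := by
      rw [← dist_eq_norm]
      refine (dist_le_Ico_sum_of_dist_le (f := f)
        (d := fun i => (ε * rawStep P σ e + P.α₀ * ampNorm P * w) * μ ^ i) (Nat.sub_le _ _)
        fun {i} hi hij => ?_).trans (hsum _ (by positivity) _ (by omega) (Nat.sub_le _ _))
      rw [dist_comm, dist_eq_norm]
      -- Decay and rotation of the dither are kept together, so that they add in quadrature.
      have e2 : f (i + 1) - f i = (θh (i + 1) - θh i) +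
          alpha P ε i • (μ • pert P ε (i + 1) - pert P ε i) := by
        have e3 : alpha P ε (i + 1) = alpha P ε i * μ := by
          rw [alpha, alpha, pow_succ, ← hμdef]; ring
        simp only [hf]
        rw [e3]; module
      have h2 := norm_damped_pert_sub_le P ε hμ.le R.decay_lt_one.le i
      rw [show 1 - μ = ε * P.lam by rw [hμdef]; ring, ← hw] at h2
      rw [e2, add_mul]
      refine (norm_add_le _ _).trans (add_le_add (hstep i (by omega) hij) ?_)
      rw [norm_smul, Real.norm_of_nonneg (R.alpha_pos i).le, alpha]
      calc _ ≤ P.α₀ * μ ^ i * (w * ampNorm P) := by gcongr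
        _ = _ := by ring
    have h3 := S.delay_increment_le hε R.eps_le
    rw [← hC, ← hμdef, ← hw] at h3
    have h4 : (1 : ℝ) ≤ if j ≤ 2 * P.DM then 2 else 1 := by split_ifs <;> norm_num
    calc _ ≤ _ := h1
      _ = P.DM * μ ^ j * ((μ ^ P.DM)⁻¹ * (ε * rawStep P σ e + P.α₀ * ampNorm P * w)) := by ring
      _ ≤ P.DM * μ ^ j * C := by gcongr
      _ = 1 * (P.DM * C * μ ^ j) := by ring
      _ ≤ _ := by gcongr

lemma norm_delayError_le (R : Run P σ e ε H θs Qs Q0 D θ0 θh η) {j : ℕ} (hj : P.DM ≤ j)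
    (hx : ∀ i, P.DM ≤ i → i ≤ j → ‖θh i - θs‖ ≤ σ * (1 - ε * P.lam) ^ i)
    (hstep : ∀ i, P.DM ≤ i → i < j →
      ‖θh (i + 1) - θh i‖ ≤ ε * rawStep P σ e * (1 - ε * P.lam) ^ i) :
    ‖(P.k * (delayError P ε H θs D θ0 θh j / alpha P ε j)) • demod P ε j‖ ≤
      √ε * ((if j ≤ 2 * P.DM then 2 else 1) * deltaOut P σ e) * (1 - ε * P.lam) ^ j := by
  have S := R.setting
  have hα := S.valid.α₀_pos
  have hM := S.valid.HM_pos
  have hk := S.valid.k_pos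
  have hA := S.ampNorm_pos
  have hB := S.invAmpNorm_pos
  have hR := S.radius_pos
  have hε := R.eps_pos
  have hμ := R.decay_pos
  have hd := S.decay_pos
  have hlam := S.valid.lam_pos
  have hr := S.rawStep_pos
  have h1s := sub_pos.2 S.sqrt_lt_one
  have h1 := R.norm_delay_le hj hstep
  have hO := S.deltaOut_ge
  have hσ := (S.init_le_sigmaAt ε).trans (S.sigmaAt_lt_of_le R.eps_le).le
  have h2 := R.input_le hσ (i := j - D j) fun h => hx _ h (Nat.sub_le _ _)
  have h3 := R.pow_sub_le (R.delay j) ((R.delay j).trans hj)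
  set C := √e * rawStep P σ e +
        P.α₀ * ampNorm P * (P.lam * √e + 2 * Real.pi / ((1 - √e) * P.DM)) with hC
  have hC0 : 0 ≤ C := by positivity
  set c : ℝ := if j ≤ 2 * P.DM then 2 else 1 with hc
  have hc0 : 0 ≤ c := by rw [hc]; split_ifs <;> norm_num
  set μ := 1 - ε * P.lam with hμdef
  have hp := pow_pos hμ j
  have h4 : ‖θh j - θs + alpha P ε j • pert P ε j‖ ≤ (σ + P.α₀ * ampNorm P) * μ ^ j := by
    refine (norm_add_le _ _).trans ?_
    rw [norm_smul, Real.norm_of_nonneg (R.alpha_pos j).le, alpha, add_mul]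
    refine add_le_add (hx j hj le_rfl) ?_
    have := norm_pert_le P ε j
    calc _ ≤ P.α₀ * μ ^ j * ampNorm P := by gcongr
      _ = _ := by ring
  have h5 : |delayError P ε H θs D θ0 θh j| ≤ 1 / 2 * (P.HM *
      (c * (P.DM * (√ε * C) * μ ^ j)) * ((σ + P.α₀ * ampNorm P) *
        (((1 - e * P.lam) ^ P.DM)⁻¹ * μ ^ j) + (σ + P.α₀ * ampNorm P) * μ ^ j)) := by
    rw [delayError, abs_mul, abs_of_pos (by norm_num : (0 : ℝ) < 1 / 2)]
    refine mul_le_mul_of_nonneg_left ((R.abs_wsq_sub_le _ _).trans ?_) (by norm_num)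
    gcongr
    exact h2.trans (by gcongr)
  have ha : alpha P ε j = P.α₀ * μ ^ j := rfl
  rw [norm_smul, Real.norm_eq_abs, abs_mul, abs_div, abs_of_pos hk, abs_of_pos (R.alpha_pos j)]
  have h6 := norm_demod_le P ε j
  calc _ ≤ P.k * (1 / 2 * (P.HM *
      (c * (P.DM * (√ε * C) * μ ^ j)) * ((σ + P.α₀ * ampNorm P) *
        (((1 - e * P.lam) ^ P.DM)⁻¹ * μ ^ j) + (σ + P.α₀ * ampNorm P) * μ ^ j)) /
        alpha P ε j) * (2 * invAmpNorm P) := by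
        have := R.alpha_pos j
        gcongr
    _ = √ε * (c * (P.k * P.DM * P.HM / P.α₀ * invAmpNorm P * (σ + P.α₀ * ampNorm P) *
      (1 + ((1 - e * P.lam) ^ P.DM)⁻¹) * C)) * μ ^ j := by
        rw [ha]; field_simp; ring
    _ ≤ _ := by gcongr

/-! ### The corrected error -/

lemma eq_corrected_sub (j : ℕ) : θh j - θs = corrected P ε H θs Qs θh η j -
    (ε * P.k) • correction P ε H θs Qs θh η j := by
  rw [corrected]; abel

lemma corrected_succ (R : Run P σ e ε H θs Qs Q0 D θ0 θh η) {j : ℕ} (hj : P.DM ≤ j) :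
    corrected P ε H θs Qs θh η (j + 1) =
      (corrected P ε H θs Qs θh η j - (ε * P.k) • hess H (corrected P ε H θs Qs θh η j)) +
      ((ε * P.k) ^ 2 • hess H (correction P ε H θs Qs θh η j) -
        (ε * P.k * (delayError P ε H θs D θ0 θh j / alpha P ε j)) • demod P ε j +
        (ε * P.k) • ((slowGain P ε H θs Qs θh η (j + 1) - slowGain P ε H θs Qs θh η j) •
            demodPrim P ε (j + 1) +
          hess (corrMatrix P ε (j + 1)) (hess H (θh (j + 1) - θh j)) +
          (alpha P ε (j + 1) - alpha P ε j) • cubicPrim P ε H (j + 1))) := by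
  have hT := R.setting.thirteen_dim_le R.eps_pos R.eps_le
  have hα := (R.alpha_pos j).ne'
  have hψ := eq_add_of_sub_eq' (demodPrim_succ_sub (P := P) hT j)
  have hV := eq_add_of_sub_eq' (cubicPrim_succ_sub (P := P) (ε := ε) H j)
  have hW := eq_add_of_sub_eq'
    (corr_succ_sub (P := P) R.setting.valid.a_ne hT j (hess H (θh j - θs)))
  rw [← add_sub_assoc] at hW
  have hx : θh (j + 1) - θs = (θh j - θs) - (ε * P.k * (slowGain P ε H θs Qs θh η j +
      ⟪pert P ε j, hess H (θh j - θs)⟫ + alpha P ε j / 2 * wsq H (pert P ε j) +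
      delayError P ε H θs D θ0 θh j / alpha P ε j)) • demod P ε j := by
    have hm := R.meas_eq hj
    -- The quadratic map is expanded at x + αS: slow part, parts linear and quadratic in the dither,
    -- and the effect of the delay.
    have e1 : meas P ε (quadMap H θs Qs) D θ0 θh j - η j = alpha P ε j *
        (slowGain P ε H θs Qs θh η j +
      ⟪pert P ε j, hess H (θh j - θs)⟫ + alpha P ε j / 2 * wsq H (pert P ε j) +
      delayError P ε H θs D θ0 θh j / alpha P ε j) := by
      rw [mul_add, mul_div_cancel₀ _ hα, delayError, wsq_add_smul R.form, mul_add, mul_add,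
        slowGain, mul_div_cancel₀ _ hα]
      linear_combination hm
    rw [R.sol.est_step j hj, e1, sub_right_comm]
    congr 2
    field_simp
  have key := correction_identity (K := hess H (correction P ε H θs Qs θh η j))
    (U := hess (corrMatrix P ε (j + 1)) (hess H (θh (j + 1) - θs)))
    (g' := slowGain P ε H θs Qs θh η (j + 1)) (a' := alpha P ε (j + 1)) hx hψ hW hV
  have e2 : hess (corrMatrix P ε (j + 1)) (hess H (θh (j + 1) - θh j)) =
      hess (corrMatrix P ε (j + 1)) (hess H (θh (j + 1) - θs)) -
        hess (corrMatrix P ε (j + 1)) (hess H (θh j - θs)) := by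
    rw [← map_sub, ← map_sub, sub_sub_sub_cancel_right]
  have e3 : hess H (corrected P ε H θs Qs θh η j) = hess H (θh j - θs) +
      (ε * P.k) • hess H (correction P ε H θs Qs θh η j) := by
    rw [corrected, map_add, map_smul]
  rw [e2, e3]
  exact key

lemma norm_correction_le (R : Run P σ e ε H θs Qs Q0 D θ0 θh η) {j : ℕ} {r : ℝ}
    (hx : ‖θh j - θs‖ ≤ r * (1 - ε * P.lam) ^ j)
    (hη : |η j - Qs| ≤ sigmaEta P σ e * (1 - ε * P.lam) ^ (2 * j)) :
    ε * P.k * ‖correction P ε H θs Qs θh η j‖ ≤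
      √ε * corrBound P σ e r * (1 - ε * P.lam) ^ j := by
  have S := R.setting
  have hα := S.valid.α₀_pos
  have hM := S.valid.HM_pos
  have hk := S.valid.k_pos
  have hε := R.eps_pos
  have hμ := R.decay_pos
  have hs := Real.sqrt_pos.2 hε
  have r1 := S.rho1_pos
  have r2 := S.rho2_pos
  have r3 := S.rho3_nonneg
  have hse := S.sigmaEta_pos
  have b1 := S.demodPrim_bound hε R.eps_le j
  have b2 := S.corr_bound hε R.eps_le j R.form (θh j - θs)
  have b3 := S.cubicPrim_bound hε R.eps_le j R.form
  have ha : alpha P ε j = P.α₀ * (1 - ε * P.lam) ^ j := rfl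
  have haj := R.alpha_pos j
  set μ := 1 - ε * P.lam with hμdef
  have hp := pow_pos hμ j
  have hg : |slowGain P ε H θs Qs θh η j| ≤
      (1 / 2 * P.HM * r ^ 2 + sigmaEta P σ e) / P.α₀ * μ ^ j := by
    rw [slowGain, abs_div, abs_of_pos haj, div_le_iff₀ haj, ha]
    have h1 := R.wsq_le hx
    have h2 := R.wsq_nonneg (θh j - θs)
    calc _ ≤ |1 / 2 * wsq H (θh j - θs)| + |η j - Qs| := abs_sub _ _
      _ ≤ 1 / 2 * (P.HM * (r * μ ^ j) ^ 2) + sigmaEta P σ e * μ ^ (2 * j) := by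
          rw [abs_of_nonneg (by positivity)]
          gcongr
      _ = _ := by rw [mul_comm 2 j, pow_mul]; field_simp
  have t1 : ε * P.k * ‖slowGain P ε H θs Qs θh η j • demodPrim P ε j‖ ≤
      √ε * rho2 P * ((1 / 2 * P.HM * r ^ 2 + sigmaEta P σ e) / P.α₀ * μ ^ j) := by
    rw [norm_smul, Real.norm_eq_abs]
    calc _ = |slowGain P ε H θs Qs θh η j| * (ε * P.k * ‖demodPrim P ε j‖) := by ring
      _ ≤ ((1 / 2 * P.HM * r ^ 2 + sigmaEta P σ e) / P.α₀ * μ ^ j) * (0.9 * √ε * rho2 P) := by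
          gcongr
      _ ≤ ((1 / 2 * P.HM * r ^ 2 + sigmaEta P σ e) / P.α₀ * μ ^ j) * (1 * √ε * rho2 P) := by
          gcongr; norm_num
      _ = _ := by ring
  have t2 : ε * P.k * ‖hess (corrMatrix P ε j) (hess H (θh j - θs))‖ ≤
      √ε * rho1 P * (r * μ ^ j) := b2.trans (by gcongr)
  have t3 : ε * P.k * ‖alpha P ε j • cubicPrim P ε H j‖ ≤ √ε * rho3 P e * (P.α₀ * μ ^ j) := by
    rw [norm_smul, Real.norm_of_nonneg haj.le, ha]
    calc _ = P.α₀ * μ ^ j * (ε * P.k * ‖cubicPrim P ε H j‖) := by ring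
      _ ≤ P.α₀ * μ ^ j * (√ε * rho3 P e) := by gcongr
      _ = _ := by ring
  have h3 : ‖correction P ε H θs Qs θh η j‖ ≤ ‖slowGain P ε H θs Qs θh η j • demodPrim P ε j‖ +
      ‖hess (corrMatrix P ε j) (hess H (θh j - θs))‖ + ‖alpha P ε j • cubicPrim P ε H j‖ :=
    norm_add₃_le
  calc _ ≤ ε * P.k * (‖slowGain P ε H θs Qs θh η j • demodPrim P ε j‖ +
      ‖hess (corrMatrix P ε j) (hess H (θh j - θs))‖ + ‖alpha P ε j • cubicPrim P ε H j‖) := by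
        gcongr
    _ ≤ √ε * rho2 P * ((1 / 2 * P.HM * r ^ 2 + sigmaEta P σ e) / P.α₀ * μ ^ j) +
      √ε * rho1 P * (r * μ ^ j) + √ε * rho3 P e * (P.α₀ * μ ^ j) := by
        rw [mul_add, mul_add]
        exact add_le_add (add_le_add t1 t2) t3
    -- Since ρ₂ = 2ρ₄, the quadratic part of the slow gain becomes the ρ₄ term of Δ_G.
    _ = _ := by rw [corrBound, rho2_eq]; ring

/-! ### The dynamics of the corrected error -/

lemma abs_slowGain_sub_le (R : Run P σ e ε H θs Qs Q0 D θ0 θh η) {j : ℕ} (hj : P.DM ≤ j)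
    (hx : ∀ i, P.DM ≤ i → i ≤ j → ‖θh i - θs‖ ≤ σ * (1 - ε * P.lam) ^ i)
    (hη : |η j - Qs| ≤ sigmaEta P σ e * (1 - ε * P.lam) ^ (2 * j))
    (hη' : |η (j + 1) - Qs| ≤ sigmaEta P σ e * (1 - ε * P.lam) ^ (2 * (j + 1))) :
    |slowGain P ε H θs Qs θh η (j + 1) - slowGain P ε H θs Qs θh η j| ≤
      ε * (1 / 2 * P.HM * (σ + e * deltaStep P σ e) ^ 2 * (P.lam / (P.α₀ * (1 - e * P.lam))) +
        1 / 2 * P.HM * deltaStep P σ e * (2 * σ + e * deltaStep P σ e) / P.α₀ +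
        sigmaEta P σ e * P.lam / P.α₀ + P.ωh * (sigmaY P σ e + sigmaEta P σ e) / P.α₀) *
        (1 - ε * P.lam) ^ j := by
  have S := R.setting
  have hα := S.valid.α₀_pos
  have hM := S.valid.HM_pos
  have hω := S.valid.ωh_pos
  have hlam := S.valid.lam_pos
  have hε := R.eps_pos
  have hμ := R.decay_pos
  have hμ1 := R.decay_lt_one
  have hd := S.decay_pos
  have hdμ := R.decay_le
  have hσ := S.sigma_pos
  have hse := S.sigmaEta_pos
  have hΔ := S.deltaStep_pos
  have hstep : ‖θh (j + 1) - θh j‖ ≤ ε * deltaStep P σ e * (1 - ε * P.lam) ^ j := by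
    refine (R.norm_step_le hj hx hη).trans ?_
    have := pow_pos hμ j
    have := S.rawStep_le_deltaStep
    gcongr
  have hout := R.abs_output_le hj hx hη
  have hxj := hx j hj le_rfl
  have hεe := R.eps_le
  have ha : alpha P ε j = P.α₀ * (1 - ε * P.lam) ^ j := rfl
  have ha' : alpha P ε (j + 1) = P.α₀ * ((1 - ε * P.lam) ^ j * (1 - ε * P.lam)) := by
    rw [alpha, pow_succ]
  have hp := pow_pos hμ j
  rw [mul_comm 2 (j + 1), pow_mul, pow_succ (1 - ε * P.lam) j] at hη'
  rw [mul_comm 2 j, pow_mul] at hout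
  set Δ := deltaStep P σ e with hΔdef
  set μ := 1 - ε * P.lam with hμdef
  set m := μ ^ j with hm
  have hxn : ‖θh (j + 1) - θs‖ ≤ (σ + e * Δ) * m := by
    have e1 : θh (j + 1) - θs = (θh j - θs) + (θh (j + 1) - θh j) := by abel
    rw [e1, add_mul]
    refine (norm_add_le _ _).trans (add_le_add hxj (hstep.trans ?_))
    gcongr
  have hw1 : |wsq H (θh (j + 1) - θs)| ≤ P.HM * ((σ + e * Δ) * m) ^ 2 := by
    rw [abs_of_nonneg (R.wsq_nonneg _)]
    exact R.wsq_le hxn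
  have hw2 : |wsq H (θh (j + 1) - θs) - wsq H (θh j - θs)| ≤
      P.HM * (ε * Δ * m) * ((2 * σ + e * Δ) * m) := by
    refine (R.abs_wsq_sub_le _ _).trans ?_
    rw [sub_sub_sub_cancel_right]
    gcongr
    linarith
  have hh : |η (j + 1) - η j| ≤ ε * P.ωh * ((sigmaY P σ e + sigmaEta P σ e) * m ^ 2) := by
    rw [R.sol.filter_step j hj, add_sub_cancel_left, abs_mul, abs_of_pos (mul_pos hε hω)]
    gcongr
  have hinv : 1 / alpha P ε (j + 1) - 1 / alpha P ε j = ε * P.lam / (P.α₀ * (m * μ)) := by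
    have h1 : ε * P.lam = 1 - μ := by rw [hμdef]; ring
    rw [ha, ha', h1]; field_simp
  -- Discrete product rule for the quotient by α: the factor comes from 1/α, |x|_H² or η, and each
  -- increment supplies a factor ε.
  have e1 : slowGain P ε H θs Qs θh η (j + 1) - slowGain P ε H θs Qs θh η j =
      1 / 2 * wsq H (θh (j + 1) - θs) * (ε * P.lam / (P.α₀ * (m * μ))) +
      1 / 2 * (wsq H (θh (j + 1) - θs) - wsq H (θh j - θs)) * (1 / (P.α₀ * m)) -
      (η (j + 1) - Qs) * (ε * P.lam / (P.α₀ * (m * μ))) -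
      (η (j + 1) - η j) * (1 / (P.α₀ * m)) := by
    rw [← hinv, ← ha, slowGain, slowGain]; ring
  have t1 : |1 / 2 * wsq H (θh (j + 1) - θs) * (ε * P.lam / (P.α₀ * (m * μ)))| ≤
      ε * (1 / 2 * P.HM * (σ + e * Δ) ^ 2 * (P.lam / (P.α₀ * (1 - e * P.lam)))) * m := by
    rw [abs_mul, abs_mul, abs_of_pos (by norm_num : (0 : ℝ) < 1 / 2),
      abs_of_pos (by positivity : 0 < ε * P.lam / (P.α₀ * (m * μ)))]
    calc _ ≤ 1 / 2 * (P.HM * ((σ + e * Δ) * m) ^ 2) * (ε * P.lam / (P.α₀ * (m * μ))) := by gcongr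
      _ = ε * (1 / 2 * P.HM * (σ + e * Δ) ^ 2 * (P.lam / (P.α₀ * μ))) * m := by field_simp
      _ ≤ _ := by gcongr
  have t2 : |1 / 2 * (wsq H (θh (j + 1) - θs) - wsq H (θh j - θs)) * (1 / (P.α₀ * m))| ≤
      ε * (1 / 2 * P.HM * Δ * (2 * σ + e * Δ) / P.α₀) * m := by
    rw [abs_mul, abs_mul, abs_of_pos (by norm_num : (0 : ℝ) < 1 / 2),
      abs_of_pos (by positivity : 0 < 1 / (P.α₀ * m))]
    calc _ ≤ 1 / 2 * (P.HM * (ε * Δ * m) * ((2 * σ + e * Δ) * m)) * (1 / (P.α₀ * m)) := by gcongr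
      _ = _ := by field_simp
  have t3 : |(η (j + 1) - Qs) * (ε * P.lam / (P.α₀ * (m * μ)))| ≤
      ε * (sigmaEta P σ e * P.lam / P.α₀) * m := by
    rw [abs_mul, abs_of_pos (by positivity : 0 < ε * P.lam / (P.α₀ * (m * μ)))]
    calc _ ≤ sigmaEta P σ e * (m * μ) ^ 2 * (ε * P.lam / (P.α₀ * (m * μ))) := by gcongr
      _ = ε * (sigmaEta P σ e * P.lam / P.α₀) * m * μ := by field_simp
      _ ≤ ε * (sigmaEta P σ e * P.lam / P.α₀) * m * 1 := by gcongr
      _ = _ := mul_one _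
  have t4 : |(η (j + 1) - η j) * (1 / (P.α₀ * m))| ≤
      ε * (P.ωh * (sigmaY P σ e + sigmaEta P σ e) / P.α₀) * m := by
    rw [abs_mul, abs_of_pos (by positivity : 0 < 1 / (P.α₀ * m))]
    calc _ ≤ ε * P.ωh * ((sigmaY P σ e + sigmaEta P σ e) * m ^ 2) * (1 / (P.α₀ * m)) := by gcongr
      _ = _ := by field_simp
  rw [e1]
  refine (abs_sub _ _).trans ?_
  refine (add_le_add ((abs_sub _ _).trans (add_le_add (abs_add_le _ _) le_rfl)) le_rfl).trans ?_
  linarith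

lemma norm_corrected_succ_le (R : Run P σ e ε H θs Qs Q0 D θ0 θh η) {j : ℕ} (hj : P.DM ≤ j)
    (hx : ∀ i, P.DM ≤ i → i ≤ j → ‖θh i - θs‖ ≤ σ * (1 - ε * P.lam) ^ i)
    (hη : ∀ i, P.DM ≤ i → i ≤ j → |η i - Qs| ≤ sigmaEta P σ e * (1 - ε * P.lam) ^ (2 * i))
    (hη' : |η (j + 1) - Qs| ≤ sigmaEta P σ e * (1 - ε * P.lam) ^ (2 * (j + 1))) :
    ‖corrected P ε H θs Qs θh η (j + 1)‖ ≤
      (1 - ε * P.k * P.Hm) * ‖corrected P ε H θs Qs θh η j‖ +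
        ε * √ε * ((if j ≤ 2 * P.DM then 2 else 1) * deltaY P σ e) * (1 - ε * P.lam) ^ j := by
  have S := R.setting
  have hα := S.valid.α₀_pos
  have hk := S.valid.k_pos
  have hM := S.valid.HM_pos
  have hω := S.valid.ωh_pos
  have hlam := S.valid.lam_pos
  have hε := R.eps_pos
  have hsε := Real.sqrt_pos.2 hε
  have hμ := R.decay_pos
  have hd := S.decay_pos
  have hσ := S.sigma_pos
  have hse := S.sigmaEta_pos
  have hsy := S.sigmaY_pos
  have hΔ := S.deltaStep_pos
  have r1 := S.rho1_pos
  have r2 := S.rho2_pos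
  have r3 := S.rho3_nonneg
  have hG := S.deltaG_pos
  have he := S.e_pos
  have hp := pow_pos hμ j
  have hxj := hx j hj le_rfl
  have hηj := hη j hj le_rfl
  have hstep : ‖θh (j + 1) - θh j‖ ≤ ε * deltaStep P σ e * (1 - ε * P.lam) ^ j := by
    refine (R.norm_step_le hj hx hηj).trans ?_
    have := S.rawStep_le_deltaStep
    gcongr
  have hg := R.abs_slowGain_sub_le hj hx hηj hη'
  have hdel := R.norm_delayError_le hj hx fun i hi hij =>
    R.norm_step_le hi (fun l hl hli => hx l hl (hli.trans hij.le)) (hη i hi hij.le)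
  have hcor := R.norm_correction_le hxj hηj
  have b1 := S.demodPrim_bound hε R.eps_le (j + 1)
  have b2 := S.corr_bound hε R.eps_le (j + 1) R.form (θh (j + 1) - θh j)
  have b3 := S.cubicPrim_bound hε R.eps_le (j + 1) R.form
  rw [Setting.corrBound_self] at hcor
  have hεk : 0 < ε * P.k := by positivity
  have hgain : ε * P.k * P.Hm ≤ 0.0963 := by
    refine le_trans ?_ S.e_gain_lower_le
    rw [mul_assoc]
    have := S.valid.Hm_pos
    exact mul_le_mul_of_nonneg_right R.eps_le (by positivity)
  have hgain' : ε * P.k * P.HM ≤ 0.0963 := by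
    refine le_trans ?_ S.e_gain_le
    rw [mul_assoc]
    exact mul_le_mul_of_nonneg_right R.eps_le (by positivity)
  have hz := R.form.norm_sub_smul_le hεk.le (by linarith) (by linarith)
    (corrected P ε H θs Qs θh η j)
  have hαd : |alpha P ε (j + 1) - alpha P ε j| = ε * (P.α₀ * P.lam) * (1 - ε * P.lam) ^ j := by
    have : alpha P ε (j + 1) - alpha P ε j = -(ε * (P.α₀ * P.lam) * (1 - ε * P.lam) ^ j) := by
      rw [alpha, alpha, pow_succ]; ring
    rw [this, abs_neg, abs_of_nonneg (by positivity)]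
  set c : ℝ := if j ≤ 2 * P.DM then 2 else 1 with hc
  have hc1 : 1 ≤ c := by rw [hc]; split_ifs <;> norm_num
  set Δ := deltaStep P σ e with hΔdef
  set m := (1 - ε * P.lam) ^ j with hm
  set Γ := ε * (1 / 2 * P.HM * (σ + e * Δ) ^ 2 * (P.lam / (P.α₀ * (1 - e * P.lam))) +
        1 / 2 * P.HM * Δ * (2 * σ + e * Δ) / P.α₀ +
        sigmaEta P σ e * P.lam / P.α₀ + P.ωh * (sigmaY P σ e + sigmaEta P σ e) / P.α₀) * m
    with hΓ
  have t1 : ‖(ε * P.k) ^ 2 • hess H (correction P ε H θs Qs θh η j)‖ ≤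
      ε * √ε * (P.k * P.HM * deltaG P σ e) * m := by
    rw [norm_smul, Real.norm_of_nonneg (by positivity)]
    have h1 := R.form.norm_le S.valid.Hm_pos hM (correction P ε H θs Qs θh η j)
    calc _ ≤ (ε * P.k) ^ 2 * (P.HM * ‖correction P ε H θs Qs θh η j‖) := by gcongr
      _ = ε * (P.k * P.HM) * (ε * P.k * ‖correction P ε H θs Qs θh η j‖) := by ring
      _ ≤ ε * (P.k * P.HM) * (√ε * deltaG P σ e * m) := by gcongr
      _ = _ := by ring
  have t2 : ‖(ε * P.k * (delayError P ε H θs D θ0 θh j / alpha P ε j)) • demod P ε j‖ ≤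
      ε * √ε * (c * deltaOut P σ e) * m := by
    rw [mul_assoc ε, mul_smul, norm_smul, Real.norm_of_nonneg hε.le]
    calc _ ≤ ε * (√ε * (c * deltaOut P σ e) * m) := by gcongr
      _ = _ := by ring
  have t3 : ‖(ε * P.k) • ((slowGain P ε H θs Qs θh η (j + 1) - slowGain P ε H θs Qs θh η j) •
      demodPrim P ε (j + 1))‖ ≤ 0.9 * √ε * rho2 P * Γ := by
    rw [norm_smul, norm_smul, Real.norm_of_nonneg hεk.le, Real.norm_eq_abs]
    calc _ = |slowGain P ε H θs Qs θh η (j + 1) - slowGain P ε H θs Qs θh η j| *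
          (ε * P.k * ‖demodPrim P ε (j + 1)‖) := by ring
      _ ≤ Γ * (0.9 * √ε * rho2 P) := by gcongr
      _ = _ := by ring
  have t4 : ‖(ε * P.k) • hess (corrMatrix P ε (j + 1)) (hess H (θh (j + 1) - θh j))‖ ≤
      ε * √ε * (rho1 P * Δ) * m := by
    rw [norm_smul, Real.norm_of_nonneg hεk.le]
    calc _ ≤ √ε * rho1 P * (ε * Δ * m) := b2.trans (by gcongr)
      _ = _ := by ring
  have t5 : ‖(ε * P.k) • ((alpha P ε (j + 1) - alpha P ε j) • cubicPrim P ε H (j + 1))‖ ≤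
      ε * √ε * (rho3 P e * P.α₀ * P.lam) * m := by
    rw [norm_smul, norm_smul, Real.norm_of_nonneg hεk.le, Real.norm_eq_abs, hαd]
    calc _ = ε * (P.α₀ * P.lam) * m * (ε * P.k * ‖cubicPrim P ε H (j + 1)‖) := by ring
      _ ≤ ε * (P.α₀ * P.lam) * m * (√ε * rho3 P e) := by gcongr
      _ = _ := by ring
  -- collecting the terms of `deltaY`
  have hsum : P.k * P.HM * deltaG P σ e + c * deltaOut P σ e + 0.9 * rho2 P *
      (1 / 2 * P.HM * (σ + e * Δ) ^ 2 * (P.lam / (P.α₀ * (1 - e * P.lam))) +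
        1 / 2 * P.HM * Δ * (2 * σ + e * Δ) / P.α₀ +
        sigmaEta P σ e * P.lam / P.α₀ + P.ωh * (sigmaY P σ e + sigmaEta P σ e) / P.α₀) +
      rho1 P * Δ + rho3 P e * P.α₀ * P.lam ≤ c * deltaY P σ e := by
    have u1 : 0.9 * rho2 P * (1 / 2 * P.HM * (σ + e * Δ) ^ 2 *
        (P.lam / (P.α₀ * (1 - e * P.lam)))) ≤
        rho4 P * P.α₀⁻¹ * P.lam / (1 - e * P.lam) * P.HM * (σ + e * Δ) ^ 2 := by
      have : 0 ≤ rho4 P * P.α₀⁻¹ * P.lam / (1 - e * P.lam) * P.HM * (σ + e * Δ) ^ 2 := by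
        have := S.rho4_pos
        positivity
      rw [rho2_eq]
      calc _ = 0.9 * (rho4 P * P.α₀⁻¹ * P.lam / (1 - e * P.lam) * P.HM * (σ + e * Δ) ^ 2) := by
            field_simp
        _ ≤ _ := by linarith
    have u2 : 0.9 * rho2 P * (1 / 2 * P.HM * Δ * (2 * σ + e * Δ) / P.α₀) ≤
        2 * rho4 P * σ * P.α₀⁻¹ * P.HM * Δ + e * rho4 P * P.α₀⁻¹ * P.HM * Δ ^ 2 := by
      have : 0 ≤ 2 * rho4 P * σ * P.α₀⁻¹ * P.HM * Δ + e * rho4 P * P.α₀⁻¹ * P.HM * Δ ^ 2 := by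
        have := S.rho4_pos
        positivity
      rw [rho2_eq]
      calc _ = 0.9 * (2 * rho4 P * σ * P.α₀⁻¹ * P.HM * Δ +
            e * rho4 P * P.α₀⁻¹ * P.HM * Δ ^ 2) := by field_simp
        _ ≤ _ := by linarith
    -- Here η̃(j+1) was bounded through σ_η, while Δ_Y contains σ_ηw* + eω_hσ_y; 0.9 ≤ 1 - eω_h
    -- makes up for the difference.
    have u3 : 0.9 * rho2 P * (sigmaEta P σ e * P.lam / P.α₀) ≤
        rho2 P * P.lam * (sigmaEta P σ e * (1 - e * P.ωh) + e * P.ωh * sigmaY P σ e) /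
          (P.α₀ * (1 - e * P.lam)) := by
      rw [le_div_iff₀ (by positivity)]
      have h1 : sigmaEta P σ e * 0.9 ≤
          sigmaEta P σ e * (1 - e * P.ωh) + e * P.ωh * sigmaY P σ e := by
        have : 0 ≤ e * P.ωh * sigmaY P σ e := by positivity
        have : sigmaEta P σ e * 0.9 ≤ sigmaEta P σ e * (1 - e * P.ωh) := by
          gcongr; linarith [S.e_filter_le]
        linarith
      calc 0.9 * rho2 P * (sigmaEta P σ e * P.lam / P.α₀) * (P.α₀ * (1 - e * P.lam)) =
          rho2 P * P.lam * (sigmaEta P σ e * 0.9) * (1 - e * P.lam) := by field_simp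
        _ ≤ rho2 P * P.lam * (sigmaEta P σ e * 0.9) * 1 := by
          gcongr; exact S.decay_lt_one.le
        _ ≤ _ := by rw [mul_one]; gcongr
    have u4 : 0.9 * rho2 P * (P.ωh * (sigmaY P σ e + sigmaEta P σ e) / P.α₀) ≤
        P.ωh * rho2 P / P.α₀ * (sigmaY P σ e + sigmaEta P σ e) := by
      have : 0 ≤ P.ωh * rho2 P / P.α₀ * (sigmaY P σ e + sigmaEta P σ e) := by positivity
      calc _ = 0.9 * (P.ωh * rho2 P / P.α₀ * (sigmaY P σ e + sigmaEta P σ e)) := by field_simp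
        _ ≤ _ := by linarith
    have hY : deltaY P σ e = P.k * P.HM * deltaG P σ e + rho1 P * Δ +
        P.ωh * rho2 P / P.α₀ * (sigmaY P σ e + sigmaEta P σ e) +
        rho2 P * P.lam * (sigmaEta P σ e * (1 - e * P.ωh) + e * P.ωh * sigmaY P σ e) /
          (P.α₀ * (1 - e * P.lam)) +
        rho3 P e * P.α₀ * P.lam + 2 * rho4 P * σ * P.α₀⁻¹ * P.HM * Δ + deltaOut P σ e +
        e * rho4 P * P.α₀⁻¹ * P.HM * Δ ^ 2 +
        rho4 P * P.α₀⁻¹ * P.lam / (1 - e * P.lam) * P.HM * (σ + e * Δ) ^ 2 := by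
      rw [deltaY, S.abs_decay, S.abs_filter, ← deltaStep]
    -- Only Δ_out needs the factor c, but enlarging the other terms by c ≥ 1 is harmless.
    have hrest : deltaY P σ e - deltaOut P σ e ≤ c * (deltaY P σ e - deltaOut P σ e) :=
      le_mul_of_one_le_left (sub_nonneg.2 S.deltaY_terms.2.2.2.2) hc1
    linarith
  rw [R.corrected_succ hj]
  refine (norm_add_le _ _).trans (add_le_add hz ?_)
  refine (norm_add_le _ _).trans ((add_le_add (norm_sub_le _ _) le_rfl).trans ?_)
  rw [smul_add, smul_add]
  refine (add_le_add (add_le_add t1 t2) (norm_add₃_le.trans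
    (add_le_add (add_le_add t3 t4) t5))).trans ?_
  calc _ = ε * √ε * (P.k * P.HM * deltaG P σ e + c * deltaOut P σ e + 0.9 * rho2 P *
      (1 / 2 * P.HM * (σ + e * Δ) ^ 2 * (P.lam / (P.α₀ * (1 - e * P.lam))) +
        1 / 2 * P.HM * Δ * (2 * σ + e * Δ) / P.α₀ +
        sigmaEta P σ e * P.lam / P.α₀ + P.ωh * (sigmaY P σ e + sigmaEta P σ e) / P.α₀) +
      rho1 P * Δ + rho3 P e * P.α₀ * P.lam) * m := by rw [hΓ]; ring
    _ ≤ _ := by gcongr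

/-! ### The bootstrap -/

/-- The bound on the estimation error follows from that on the corrected error. -/
lemma norm_le_of_corrected_le (R : Run P σ e ε H θs Qs Q0 D θ0 θh η) {j : ℕ} {Z : ℝ}
    (hmax : ‖θh j - θs‖ ≤ 1.54 * σ * (1 - ε * P.lam) ^ j)
    (hη : |η j - Qs| ≤ sigmaEta P σ e * (1 - ε * P.lam) ^ (2 * j))
    (hz : ‖corrected P ε H θs Qs θh η j‖ ≤ Z * (1 - ε * P.lam) ^ j)
    (hZ : Z + √ε * deltaG P σ e ≤ σ) :
    ‖θh j - θs‖ ≤ (Z + √ε * deltaG P σ e) * (1 - ε * P.lam) ^ j := by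
  have S := R.setting
  have hk := S.valid.k_pos
  have hε := R.eps_pos
  have hp := pow_pos R.decay_pos j
  set m := (1 - ε * P.lam) ^ j with hm
  have e1 : ‖θh j - θs‖ = ‖θh j - θs‖ / m * m := by field_simp
  have h1 := R.norm_correction_le e1.le hη
  rw [← div_le_iff₀ hp]
  refine S.le_of_le_corrBound R.eps_le (by positivity) ?_ hZ ?_
  · rwa [div_le_iff₀ hp]
  · rw [div_le_iff₀ hp, add_mul]
    have h2 : ‖θh j - θs‖ ≤ ‖corrected P ε H θs Qs θh η j‖ +
        ε * P.k * ‖correction P ε H θs Qs θh η j‖ := by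
      have h3 := norm_sub_le (corrected P ε H θs Qs θh η j)
        ((ε * P.k) • correction P ε H θs Qs θh η j)
      rw [← eq_corrected_sub, norm_smul, Real.norm_of_nonneg (by positivity)] at h3
      exact h3
    exact h2.trans (add_le_add hz h1)

/-- The contraction factor stays above one half times the decay over the initial window. -/
lemma decay_pow_le_two_mul (R : Run P σ e ε H θs Qs Q0 D θ0 θh η) {j : ℕ} (hj : P.DM ≤ j)
    (hj2 : j ≤ 2 * P.DM + 1) : (1 - ε * P.lam) ^ j ≤
      2 * ((1 - ε * P.k * P.Hm) ^ (j - P.DM) * (1 - ε * P.lam) ^ P.DM) := by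
  have S := R.setting
  have hk := S.valid.k_pos
  have hHm := S.valid.Hm_pos
  have hε := R.eps_pos
  have hg0 : 0 ≤ ε * P.k * P.Hm := by positivity
  have hD := S.one_le_DM
  have hgD : P.DM * (ε * P.k * P.Hm) ≤ 0.0963 := by
    refine le_trans ?_ S.e_gain_delay_le
    have := S.hess_le
    have := R.eps_le
    have := S.e_pos
    calc P.DM * (ε * P.k * P.Hm) = ε * P.DM * (P.k * P.Hm) := by ring
      _ ≤ _ := by gcongr
  have hg1 : ε * P.k * P.Hm ≤ 0.0963 := by nlinarith
  -- The window has at most D_M + 1 ≤ 2D_M steps, so by Bernoulli κ^(j - D_M) ≥ 1 - 2 · 0.0963 ≥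
  -- 1/2.
  have hm : ((j - P.DM : ℕ) : ℝ) ≤ 2 * P.DM := by
    have : j - P.DM ≤ 2 * P.DM := by have := S.DM_pos; omega
    exact_mod_cast this
  have h1 := one_add_mul_le_pow (a := -(ε * P.k * P.Hm)) (by linarith) (j - P.DM)
  rw [← sub_eq_add_neg] at h1
  have h2 : ((j - P.DM : ℕ) : ℝ) * (ε * P.k * P.Hm) ≤ 2 * P.DM * (ε * P.k * P.Hm) := by gcongr
  have h3 : 1 ≤ 2 * (1 - ε * P.k * P.Hm) ^ (j - P.DM) := by linarith
  have h4 : (1 - ε * P.lam) ^ j ≤ (1 - ε * P.lam) ^ P.DM :=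
    pow_le_pow_of_le_one R.decay_pos.le R.decay_lt_one.le hj
  have h5 := pow_pos R.decay_pos P.DM
  nlinarith

/-- The invariant of the induction. -/
def Invariant (P : Params n) (σ e ε : ℝ) (H : Matrix (Fin n) (Fin n) ℝ)
    (θs : EuclideanSpace ℝ (Fin n)) (Qs : ℝ) (θh : ℕ → EuclideanSpace ℝ (Fin n)) (η : ℕ → ℝ)
    (j : ℕ) : Prop :=
  ‖θh j - θs‖ ≤ sigmaAt P σ e ε * (1 - ε * P.lam) ^ j ∧
  |η j - Qs| ≤ filterBound P σ e ε * (1 - ε * P.lam) ^ (2 * j) ∧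
  (j ≤ 2 * P.DM + 1 → ‖corrected P ε H θs Qs θh η j‖ ≤
    (1 - ε * P.k * P.Hm) ^ (j - P.DM) *
      (P.σ₀ + √ε * deltaG P σ e * (1 - ε * P.lam) ^ P.DM) +
    2 * (√ε * deltaY P σ e / (P.k * P.Hm - P.lam)) *
      ((1 - ε * P.lam) ^ j - (1 - ε * P.k * P.Hm) ^ (j - P.DM) * (1 - ε * P.lam) ^ P.DM)) ∧
  ‖corrected P ε H θs Qs θh η j‖ ≤
    (1 - ε * P.k * P.Hm) ^ (j - P.DM) *
      (P.σ₀ + √ε * deltaG P σ e * (1 - ε * P.lam) ^ P.DM) +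
    √ε * deltaY P σ e / (P.k * P.Hm - P.lam) * (1 - ε * P.lam) ^ j

lemma sigma_le_of_sigmaAt (R : Run P σ e ε H θs Qs Q0 D θ0 θh η) {i : ℕ}
    (h : ‖θh i - θs‖ ≤ sigmaAt P σ e ε * (1 - ε * P.lam) ^ i) :
    ‖θh i - θs‖ ≤ σ * (1 - ε * P.lam) ^ i := by
  have := pow_pos R.decay_pos i
  exact h.trans (mul_le_mul_of_nonneg_right (R.setting.sigmaAt_lt_of_le R.eps_le).le this.le)

lemma sigmaEta_le_of_filterBound (R : Run P σ e ε H θs Qs Q0 D θ0 θh η) {i : ℕ}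
    (h : |η i - Qs| ≤ filterBound P σ e ε * (1 - ε * P.lam) ^ (2 * i)) :
    |η i - Qs| ≤ sigmaEta P σ e * (1 - ε * P.lam) ^ (2 * i) := by
  have := pow_pos R.decay_pos (2 * i)
  exact h.trans (mul_le_mul_of_nonneg_right
    (R.setting.filterBound_lt R.eps_pos R.eps_le).le this.le)

lemma invariant_init (R : Run P σ e ε H θs Qs Q0 D θ0 θh η) :
    Invariant P σ e ε H θs Qs θh η P.DM := by
  have S := R.setting
  have hk := S.valid.k_pos
  have hε := R.eps_pos
  have h1 : ‖θh P.DM - θs‖ ≤ sigmaAt P σ e ε * (1 - ε * P.lam) ^ P.DM := by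
    rw [R.sol.est_init P.DM le_rfl]
    exact R.init_le (S.init_le_sigmaAt ε) le_rfl
  have h2 := R.filter_err_init
  have h3 : ‖corrected P ε H θs Qs θh η P.DM‖ ≤
      P.σ₀ + √ε * deltaG P σ e * (1 - ε * P.lam) ^ P.DM := by
    have h4 := R.norm_correction_le (R.sigma_le_of_sigmaAt h1) (R.sigmaEta_le_of_filterBound h2)
    rw [Setting.corrBound_self] at h4
    rw [corrected]
    refine (norm_add_le _ _).trans (add_le_add ?_ ?_)
    · rw [R.sol.est_init P.DM le_rfl]; exact R.init
    · rwa [norm_smul, Real.norm_of_nonneg (by positivity)]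
  refine ⟨h1, h2, fun _ => ?_, ?_⟩
  · simpa using h3
  · have h5 : 0 ≤ √ε * deltaY P σ e / (P.k * P.Hm - P.lam) * (1 - ε * P.lam) ^ P.DM := by
      have := S.deltaY_pos
      have := S.gain_sub_pos
      have := R.decay_pos
      positivity
    simp only [Nat.sub_self, pow_zero, one_mul]
    linarith

/-- In the window with doubled delay error the geometric sum is kept exactly, as 2N(μ^j - κ^(j -
D_M)μ^(D_M)). There μ^j ≤ 2κ^(j - D_M)μ^(D_M), so this is at most Nμ^j and the doubling leaves no
trace in the last clause of the invariant. -/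
lemma invariant_step (R : Run P σ e ε H θs Qs Q0 D θ0 θh η) {j : ℕ} (hj : P.DM ≤ j)
    (IH : ∀ i, P.DM ≤ i → i ≤ j → Invariant P σ e ε H θs Qs θh η i) :
    Invariant P σ e ε H θs Qs θh η (j + 1) := by
  have S := R.setting
  have hk := S.valid.k_pos
  have hHm := S.valid.Hm_pos
  have hε := R.eps_pos
  have hsε := Real.sqrt_pos.2 hε
  have hμ := R.decay_pos
  have hμ1 := R.decay_lt_one
  have hY := S.deltaY_pos
  have hG := S.deltaG_pos
  have hgs := S.gain_sub_pos
  have hσ0 := S.valid.σ₀_pos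
  have hσ := S.sigma_pos
  have hx : ∀ i, P.DM ≤ i → i ≤ j → ‖θh i - θs‖ ≤ σ * (1 - ε * P.lam) ^ i :=
    fun i hi hij => R.sigma_le_of_sigmaAt (IH i hi hij).1
  have hη : ∀ i, P.DM ≤ i → i ≤ j → |η i - Qs| ≤ sigmaEta P σ e * (1 - ε * P.lam) ^ (2 * i) :=
    fun i hi hij => R.sigmaEta_le_of_filterBound (IH i hi hij).2.1
  have hfil := R.filter_err_step hj (fun i hi hij => (IH i hi hij).1) (IH j hj le_rfl).2.1
  have hη' := R.sigmaEta_le_of_filterBound hfil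
  have hzs := R.norm_corrected_succ_le hj hx hη hη'
  obtain ⟨_, _, hz1, hz2⟩ := IH j hj le_rfl
  have hgain : ε * P.k * P.Hm ≤ 0.0963 := by
    refine le_trans ?_ S.e_gain_lower_le
    rw [mul_assoc]
    exact mul_le_mul_of_nonneg_right R.eps_le (by positivity)
  have hκ : 0 < 1 - ε * P.k * P.Hm := by linarith
  have hκμ : 1 - ε * P.k * P.Hm ≤ 1 - ε * P.lam := by
    have := mul_le_mul_of_nonneg_left S.valid.gain.le hε.le
    linarith
  set κ := 1 - ε * P.k * P.Hm with hκdef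
  set μ := 1 - ε * P.lam with hμdef
  set v := P.σ₀ + √ε * deltaG P σ e * μ ^ P.DM with hv
  set N := √ε * deltaY P σ e / (P.k * P.Hm - P.lam) with hN
  have hN0 : 0 < N := by positivity
  -- As μ - κ = ε(kH_m - λ), the sequence Nμ^j solves the recursion z(j+1) = κz(j) + ε√εΔ_Yμ^j.
  have hNε : ε * √ε * deltaY P σ e = N * (μ - κ) := by
    rw [hN, hμdef, hκdef]; field_simp; ring
  have hsub : j + 1 - P.DM = (j - P.DM) + 1 := by omega
  have hmj := pow_pos hμ j
  have hw1 : j + 1 ≤ 2 * P.DM + 1 → ‖corrected P ε H θs Qs θh η (j + 1)‖ ≤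
      κ ^ (j + 1 - P.DM) * v + 2 * N * (μ ^ (j + 1) - κ ^ (j + 1 - P.DM) * μ ^ P.DM) := by
    intro hj2
    -- Forcing at times j ≤ 2D_M acts on z(j + 1), so the window for z reaches 2D_M + 1.
    rw [if_pos (by omega)] at hzs
    refine hzs.trans ?_
    have h1 := mul_le_mul_of_nonneg_left (hz1 (by omega)) hκ.le
    rw [hsub, pow_succ, pow_succ]
    have h2 : ε * √ε * (2 * deltaY P σ e) * μ ^ j = 2 * N * (μ - κ) * μ ^ j := by
      rw [mul_assoc 2 N, ← hNε]; ring
    rw [h2]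
    refine (add_le_add h1 le_rfl).trans (le_of_eq ?_)
    ring
  have hw2 : ‖corrected P ε H θs Qs θh η (j + 1)‖ ≤
      κ ^ (j + 1 - P.DM) * v + N * μ ^ (j + 1) := by
    by_cases hj2 : j + 1 ≤ 2 * P.DM + 1
    · refine (hw1 hj2).trans ?_
      have h1 := R.decay_pow_le_two_mul (j := j + 1) (by omega) hj2
      rw [← hκdef, ← hμdef] at h1
      have h2 := mul_le_mul_of_nonneg_left h1 hN0.le
      linarith
    · rw [if_neg (by omega), one_mul, hNε] at hzs
      refine hzs.trans ?_
      have h1 := mul_le_mul_of_nonneg_left hz2 hκ.le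
      rw [hsub, pow_succ, pow_succ]
      refine (add_le_add h1 le_rfl).trans (le_of_eq ?_)
      ring
  refine ⟨?_, hfil, hw1, hw2⟩
  -- the normalized bound on the corrected error
  set Z := P.σ₀ * ((1 - e * P.lam) ^ P.DM)⁻¹ + √ε * deltaG P σ e + N with hZ
  have hsig : Z + √ε * deltaG P σ e = sigmaAt P σ e ε := by
    rw [hZ, sigmaAt, driftCoef, hN]; ring
  have hzZ : ‖corrected P ε H θs Qs θh η (j + 1)‖ ≤ Z * μ ^ (j + 1) := by
    refine hw2.trans ?_
    have hκp : κ ^ (j + 1 - P.DM) ≤ μ ^ (j + 1 - P.DM) := pow_le_pow_left₀ hκ.le hκμ _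
    have h1 := R.pow_sub_le (j := j + 1) le_rfl (by omega : P.DM ≤ j + 1)
    have h2 : μ ^ (j + 1 - P.DM) * μ ^ P.DM = μ ^ (j + 1) := by
      rw [← pow_add, Nat.sub_add_cancel (by omega)]
    have h3 : 0 < √ε * deltaG P σ e * μ ^ P.DM := by positivity
    calc κ ^ (j + 1 - P.DM) * v + N * μ ^ (j + 1) ≤
        μ ^ (j + 1 - P.DM) * v + N * μ ^ (j + 1) := by gcongr
      _ = P.σ₀ * μ ^ (j + 1 - P.DM) +
          √ε * deltaG P σ e * (μ ^ (j + 1 - P.DM) * μ ^ P.DM) + N * μ ^ (j + 1) := by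
          rw [hv]; ring
      _ ≤ P.σ₀ * (((1 - e * P.lam) ^ P.DM)⁻¹ * μ ^ (j + 1)) +
          √ε * deltaG P σ e * μ ^ (j + 1) + N * μ ^ (j + 1) := by
          rw [h2]; gcongr
      _ = Z * μ ^ (j + 1) := by rw [hZ]; ring
  -- A crude bound from one step, to start the implicit estimate at time j + 1: 1.385/0.9037 < 1.54.
  have hmax : ‖θh (j + 1) - θs‖ ≤ 1.54 * σ * μ ^ (j + 1) := by
    have h1 := R.norm_step_le hj hx (hη j hj le_rfl)
    have h2 : ε * rawStep P σ e ≤ 0.385 * σ := by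
      refine le_trans ?_ S.e_deltaStep_le
      have := S.rawStep_le_deltaStep
      have := S.rawStep_pos
      have := R.eps_le
      have := S.e_pos
      gcongr
    have h3 : 0.9037 ≤ μ := by
      have h4 : ε * P.lam ≤ 0.0963 := by
        have h5 := mul_le_mul_of_nonneg_left S.valid.gain.le hε.le
        linarith
      rw [hμdef]; linarith
    have e1 : θh (j + 1) - θs = (θh j - θs) + (θh (j + 1) - θh j) := by abel
    rw [e1]
    calc _ ≤ σ * μ ^ j + ε * rawStep P σ e * μ ^ j :=
          (norm_add_le _ _).trans (add_le_add (hx j hj le_rfl) h1)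
      _ ≤ σ * μ ^ j + 0.385 * σ * μ ^ j := by gcongr
      _ = 1.385 * σ * μ ^ j := by ring
      _ ≤ (1.54 * 0.9037) * σ * μ ^ j := by gcongr; norm_num
      _ = 1.54 * σ * (μ ^ j * 0.9037) := by ring
      _ ≤ 1.54 * σ * (μ ^ j * μ) := by gcongr
      _ = _ := by rw [pow_succ]
  have := R.norm_le_of_corrected_le hmax hη' hzZ
    (by rw [hsig]; exact (S.sigmaAt_lt_of_le R.eps_le).le)
  rwa [hsig] at this

lemma invariant (R : Run P σ e ε H θs Qs Q0 D θ0 θh η) {j : ℕ} (hj : P.DM ≤ j) :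
    Invariant P σ e ε H θs Qs θh η j := by
  suffices h : ∀ i, P.DM ≤ i → i ≤ j → Invariant P σ e ε H θs Qs θh η i from h j hj le_rfl
  induction j, hj using Nat.le_induction with
  | base =>
    intro i h1 h2
    rw [le_antisymm h2 h1]
    exact R.invariant_init
  | succ j hj IH =>
    intro i h1 h2
    rcases Nat.lt_or_ge j i with h3 | h3
    · rw [show i = j + 1 by omega]
      exact R.invariant_step hj IH
    · exact IH i h1 h3

lemma est_lt (R : Run P σ e ε H θs Qs Q0 D θ0 θh η) {j : ℕ} (hj : P.DM ≤ j) :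
    ‖θh j - θs‖ < σ * (1 - ε * P.lam) ^ j :=
  (R.invariant hj).1.trans_lt (mul_lt_mul_of_pos_right (R.setting.sigmaAt_lt_of_le R.eps_le)
    (pow_pos R.decay_pos j))

lemma filter_lt (R : Run P σ e ε H θs Qs Q0 D θ0 θh η) {j : ℕ} (hj : P.DM ≤ j) :
    |η j - Qs| < sigmaEta P σ e * (1 - ε * P.lam) ^ (2 * j) :=
  (R.invariant hj).2.1.trans_lt (mul_lt_mul_of_pos_right
    (R.setting.filterBound_lt R.eps_pos R.eps_le) (pow_pos R.decay_pos _))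

lemma norm_input_le (R : Run P σ e ε H θs Qs Q0 D θ0 θh η) (j : ℕ) :
    ‖input P ε θ0 θh j - θs‖ ≤ (σ + P.α₀ * ampNorm P) * (1 - ε * P.lam) ^ j :=
  R.input_le ((R.setting.init_le_sigmaAt ε).trans (R.setting.sigmaAt_lt_of_le R.eps_le).le)
    fun hj => (R.est_lt hj).le

end Run

/-! ### Feasibility of the conditions -/

section Feasibility

open Filter Topology

/-- `f` agrees near `0` on the positive half-line with a function continuous at `0`. -/
def ExtendsAtZero (f : ℝ → ℝ) : Prop :=
  ∃ g : ℝ → ℝ, ContinuousAt g 0 ∧ ∀ᶠ e in 𝓝[>] (0 : ℝ), f e = g e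

lemma eventually_lt_of_continuousAt {g : ℝ → ℝ} (hg : ContinuousAt g 0) {b : ℝ} (h : g 0 < b) :
    ∀ᶠ e in 𝓝[>] (0 : ℝ), g e < b :=
  (hg.tendsto.mono_left nhdsWithin_le_nhds).eventually_lt_const h

lemma eventually_abs_one_sub_mul (c : ℝ) : ∀ᶠ e in 𝓝[>] (0 : ℝ), |1 - e * c| = 1 - e * c := by
  have h : ContinuousAt (fun e : ℝ => e * c) 0 := by fun_prop
  filter_upwards [eventually_lt_of_continuousAt h (b := 1) (by simp)] with e he
  exact abs_of_pos (by linarith)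

lemma continuousAt_sigmaY (P : Params n) (σ : ℝ) : ContinuousAt (sigmaY P σ) 0 := by
  unfold sigmaY
  fun_prop (disch := simp)

lemma continuousAt_rho3 (P : Params n) : ContinuousAt (rho3 P) 0 := by
  unfold rho3 cCoef
  fun_prop

/-- At e = 0 the quotient in σ_η is 0/0. Cancelling e leaves the denominator ω_h - 2λ + eλ², which
is positive at 0. -/
lemma extendsAtZero_sigmaEta {P : Params n} (hP : P.Valid) (σ : ℝ) :
    ExtendsAtZero (sigmaEta P σ) := by
  have hy := continuousAt_sigmaY P σ
  have hf := hP.filter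
  refine ⟨fun e => P.ΔQ * (|1 - e * P.ωh| ^ P.DM)⁻¹ +
    P.ωh * sigmaY P σ e / (P.ωh - 2 * P.lam + e * P.lam ^ 2), ?_, ?_⟩
  · refine ContinuousAt.add (by fun_prop (disch := simp)) (ContinuousAt.div (by fun_prop)
      (by fun_prop) ?_)
    simp only [zero_mul, add_zero]
    linarith
  · filter_upwards [self_mem_nhdsWithin, eventually_abs_one_sub_mul P.lam,
      eventually_abs_one_sub_mul P.ωh] with e he h1 h2
    have he : 0 < e := he
    have h3 : (1 - e * P.lam) ^ 2 - (1 - e * P.ωh) =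
      e * (P.ωh - 2 * P.lam + e * P.lam ^ 2) := by ring
    rw [sigmaEta, h1, h2, h3, mul_assoc e, mul_div_mul_left _ _ he.ne']

lemma extendsAtZero_deltaG {P : Params n} (hP : P.Valid) (σ : ℝ) :
    ExtendsAtZero (deltaG P σ) := by
  obtain ⟨s, hs, hse⟩ := extendsAtZero_sigmaEta hP σ
  have h3 := continuousAt_rho3 P
  refine ⟨fun e => rho1 P * σ + rho2 P * (s e / P.α₀) + rho3 P e * P.α₀ +
    rho4 P * (σ ^ 2 * P.HM / P.α₀), by fun_prop, hse.mono fun e h => ?_⟩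
  rw [deltaG, h]

lemma extendsAtZero_delta {P : Params n} (hP : P.Valid) (σ : ℝ) :
    ExtendsAtZero (delta P σ) := by
  obtain ⟨s, hs, hse⟩ := extendsAtZero_sigmaEta hP σ
  refine ⟨fun e => 2 * P.k / P.α₀ * (P.HM / 2 * (σ + P.α₀ * ampNorm P) ^ 2 + s e) *
    invAmpNorm P, by fun_prop, hse.mono fun e h => ?_⟩
  rw [delta, h]

lemma extendsAtZero_deltaOut {P : Params n} (hP : P.Valid) (hD : 0 < P.DM) (σ : ℝ) :
    ExtendsAtZero (deltaOut P σ) := by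
  obtain ⟨s, hs, hse⟩ := extendsAtZero_sigmaEta hP σ
  have hy := continuousAt_sigmaY P σ
  have hD' : P.DM ≠ 0 := hD.ne'
  refine ⟨fun e => P.k * P.DM * P.HM / P.α₀ * invAmpNorm P * (σ + P.α₀ * ampNorm P) *
    (1 + (|1 - e * P.lam| ^ P.DM)⁻¹) *
    (2 * √e * P.k * (sigmaY P σ e + s e) / P.α₀ * invAmpNorm P +
      P.α₀ * ampNorm P *
          (P.lam * √e +
            2 * Real.pi / ((1 - √e) * P.DM) * (Real.pi * √e / ((1 - √e) * P.DM) + 1)) /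
        |1 - e * P.lam|), by fun_prop (disch := simp [hD']), hse.mono fun e h => ?_⟩
  rw [deltaOut, h]

lemma extendsAtZero_deltaY {P : Params n} (hP : P.Valid) (hD : 0 < P.DM) (σ : ℝ) :
    ExtendsAtZero (deltaY P σ) := by
  obtain ⟨s, hs, hse⟩ := extendsAtZero_sigmaEta hP σ
  obtain ⟨G, hG, hGe⟩ := extendsAtZero_deltaG hP σ
  obtain ⟨d, hd, hde⟩ := extendsAtZero_delta hP σ
  obtain ⟨o, ho, hoe⟩ := extendsAtZero_deltaOut hP hD σ
  have hy := continuousAt_sigmaY P σ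
  have h3 := continuousAt_rho3 P
  have hα := hP.α₀_pos.ne'
  refine ⟨fun e => P.k * P.HM * G e +
    rho1 P * (d e + √e * o e) +
    P.ωh * rho2 P / P.α₀ * (sigmaY P σ e + s e) +
    rho2 P * P.lam * (s e * |1 - e * P.ωh| + e * P.ωh * sigmaY P σ e) /
      (P.α₀ * |1 - e * P.lam|) +
    rho3 P e * P.α₀ * P.lam +
    2 * rho4 P * σ * P.α₀⁻¹ * P.HM * (d e + √e * o e) +
    o e +
    e * rho4 P * P.α₀⁻¹ * P.HM * (d e + √e * o e) ^ 2 +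
    rho4 P * P.α₀⁻¹ * P.lam / |1 - e * P.lam| * P.HM *
      (σ + e * (d e + √e * o e)) ^ 2, by fun_prop (disch := simp [hα]), ?_⟩
  filter_upwards [hse, hGe, hde, hoe] with e h1 h2 h3 h4
  rw [deltaY, h1, h2, h3, h4]

/-- For small e the quotient √e³/(μ* - κ*) equals √e/(kH_m - λ), so the left side extends
continuously to 0 with value σ₀. -/
lemma eventually_cond_c {P : Params n} (hP : P.Valid) (hD : 0 < P.DM) {σ : ℝ} (hσ : P.σ₀ < σ) :
    ∀ᶠ e in 𝓝[>] (0 : ℝ),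
      (P.σ₀ + √e * deltaG P σ e * |1 - e * P.lam| ^ P.DM) * (|1 - e * P.k * P.Hm| ^ P.DM)⁻¹ +
        √e * deltaG P σ e +
        √e ^ 3 * deltaY P σ e / (|1 - e * P.lam| - |1 - e * P.k * P.Hm|) < σ := by
  obtain ⟨G, hG, hGe⟩ := extendsAtZero_deltaG hP σ
  obtain ⟨Y, hY, hYe⟩ := extendsAtZero_deltaY hP hD σ
  have hg := sub_pos.2 hP.gain
  have hc : ContinuousAt (fun e => (P.σ₀ + √e * G e * |1 - e * P.lam| ^ P.DM) *
      (|1 - e * P.k * P.Hm| ^ P.DM)⁻¹ + √e * G e + √e * Y e / (P.k * P.Hm - P.lam)) 0 := by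
    fun_prop (disch := simp)
  filter_upwards [self_mem_nhdsWithin, hGe, hYe, eventually_abs_one_sub_mul P.lam,
    eventually_abs_one_sub_mul (P.k * P.Hm),
    eventually_lt_of_continuousAt hc (b := σ) (by simpa using hσ)] with e he h1 h2 h3 h4 h5
  have he : 0 < e := he
  rw [← mul_assoc] at h4
  have h6 : √e ^ 3 * Y e / (1 - e * P.lam - (1 - e * P.k * P.Hm)) =
      √e * Y e / (P.k * P.Hm - P.lam) := by
    have e1 : 1 - e * P.lam - (1 - e * P.k * P.Hm) = e * (P.k * P.Hm - P.lam) := by ring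
    have e2 : √e ^ 3 * Y e = e * (√e * Y e) := by
      rw [pow_succ, Real.sq_sqrt he.le]; ring
    rw [e1, e2, mul_div_mul_left _ _ he.ne']
  rw [h1, h2]
  simp only [h3, h4, h6] at h5 ⊢
  exact h5

lemma exists_forall_conditions (hn : 0 < n) {P : Params n} (hP : P.Valid) (hD : 0 < P.DM)
    {σ : ℝ} (hσ : P.σ₀ < σ) :
    ∃ ε₀ : ℝ, 0 < ε₀ ∧ ∀ εs : ℝ, 0 < εs → εs ≤ ε₀ → Conditions P σ εs := by
  have hb : ContinuousAt (fun e : ℝ =>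
      e * max (P.lam + P.k * P.Hm) (P.ωh + 2 * P.lam - e * P.lam ^ 2)) 0 := by fun_prop
  have hω : ContinuousAt (fun e : ℝ => e * P.ωh) 0 := by fun_prop
  have ha : ContinuousAt (fun e : ℝ => √e * (2 * n + 1)) 0 := by fun_prop
  have key : ∀ᶠ e in 𝓝[>] (0 : ℝ), Conditions P σ e := by
    filter_upwards [self_mem_nhdsWithin, eventually_lt_of_continuousAt continuousAt_id one_pos,
      eventually_lt_of_continuousAt hω (b := 1) (by simp),
      eventually_lt_of_continuousAt ha (b := 1) (by simp),
      eventually_lt_of_continuousAt hb (b := 2) (by simp),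
      eventually_cond_c hP hD hσ] with e he h1 h2 h3 h4 h5
    have he : 0 < e := he
    refine ⟨he, h1, by linarith, ?_, h4, h5⟩
    have h6 : 2 * n + 1 ≤ ⌊1 / √e⌋₊ := by
      refine Nat.le_floor ?_
      rw [le_div_iff₀ (Real.sqrt_pos.2 he)]
      push_cast
      linarith
    exact h6.trans (Nat.le_mul_of_pos_left _ (Nat.mul_pos hn hD))
  obtain ⟨u, hu, hsub⟩ := mem_nhdsGT_iff_exists_Ioc_subset.1 key
  exact ⟨u, hu, fun e h1 h2 => hsub ⟨h1, h2⟩⟩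

end Feasibility

lemma Conditions.one_sub_mul_pos {P : Params n} (hP : P.Valid) {σ e : ℝ}
    (hc : Conditions P σ e) : 0 < 1 - e * P.lam := by
  have h1 := (mul_le_mul_of_nonneg_left (le_max_left (P.lam + P.k * P.Hm)
    (P.ωh + 2 * P.lam - e * P.lam ^ 2)) hc.pos.le).trans_lt hc.cond_b
  have h2 := mul_lt_mul_of_pos_left hP.gain hc.pos
  linarith

/-- H_m ≤ H_M is not assumed of the parameters; testing the form on a unit vector recovers it from
the existence of H. -/
lemma FormBetween.le_upper (hn : 0 < n)
    {L : EuclideanSpace ℝ (Fin n) →ₗ[ℝ] EuclideanSpace ℝ (Fin n)}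
    {m M : ℝ} (h : FormBetween L m M) : m ≤ M := by
  have h1 := (h.lower (EuclideanSpace.single ⟨0, hn⟩ 1)).trans (h.upper _)
  simpa using h1

end UnbiasedES

end

theorem theorem1 {n : ℕ} (hn : 0 < n) (P : UnbiasedES.Params n) (hP : P.Valid) :
    -- exponential unbiased convergence under the explicit conditions
    (∀ σ : ℝ, P.σ₀ < σ → ∀ εs : ℝ, UnbiasedES.Conditions P σ εs →
      ∀ ε : ℝ, 0 < ε → ε ≤ εs →
        |1 - ε * P.lam| < 1 ∧
        ∀ (H : Matrix (Fin n) (Fin n) ℝ) (θs : EuclideanSpace ℝ (Fin n)) (Qs Q0 : ℝ)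
          (D : ℕ → ℕ) (θ0 : EuclideanSpace ℝ (Fin n))
          (θh : ℕ → EuclideanSpace ℝ (Fin n)) (η : ℕ → ℝ),
          (H - P.Hm • (1 : Matrix (Fin n) (Fin n) ℝ)).PosSemidef →
          (P.HM • (1 : Matrix (Fin n) (Fin n) ℝ) - H).PosSemidef →
          ‖θ0 - θs‖ ≤ P.σ₀ →
          |Qs - Q0| ≤ P.ΔQ →
          (∀ j, D j ≤ P.DM) →
          UnbiasedES.IsESSolution P ε (UnbiasedES.quadMap H θs Qs) D θ0 Q0 θh η →
          (∀ j, P.DM ≤ j →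
            ‖θh j - θs‖ < σ * |1 - ε * P.lam| ^ j ∧
            |η j - Qs| < UnbiasedES.sigmaEta P σ εs * |1 - ε * P.lam| ^ (2 * j)) ∧
          (∀ j, ‖UnbiasedES.input P ε θ0 θh j - θs‖ ≤
            (σ + P.α₀ * UnbiasedES.ampNorm P) * |1 - ε * P.lam| ^ j)) ∧
    -- feasibility of the conditions
    (0 < P.DM → ∀ σ : ℝ, P.σ₀ < σ →
      ∃ ε₀ : ℝ, 0 < ε₀ ∧ ∀ εs : ℝ, 0 < εs → εs ≤ ε₀ → UnbiasedES.Conditions P σ εs) := by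
  refine ⟨fun σ hσ e hc ε h0 h => ?_, fun hD σ hσ =>
    UnbiasedES.exists_forall_conditions hn hP hD hσ⟩
  have hμ : 0 < 1 - ε * P.lam :=
    (hc.one_sub_mul_pos hP).trans_le (by have := hP.lam_pos; gcongr)
  rw [abs_of_pos hμ]
  refine ⟨by linarith [mul_pos h0 hP.lam_pos], ?_⟩
  intro H θs Qs Q0 D θ0 θh η h1 h2 hinit hlevel hD hsol
  have hform := UnbiasedES.formBetween_hess h1 h2
  have R : UnbiasedES.Run P σ e ε H θs Qs Q0 D θ0 θh η :=
    ⟨⟨hn, hP, hform.le_upper hn, hσ, hc⟩, h0, h, hform, hinit, hlevel, hD, hsol⟩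
  exact ⟨fun j hj => ⟨R.est_lt hj, R.filter_lt hj⟩, R.norm_input_le⟩
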